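/- Let $p>2$ be a prime, let $D_{\mathfrak p}$ be the quaternion division algebra over $\mathbb{Q}_p$ (i.e. a central division algebra of dimension $4$), and let $L$ be a finite extension of $\mathbb{Q}_p$ with ring of integers $\mathcal O$, together with an isomorphism $L\otimes_{\mathbb{Q}_p} D_{\mathfrak p}\cong M_2(L)$. Via $D_{\mathfrak p}^\times\to \mathrm{GL}_2(L)$ we view $\mathrm{Sym}^a L^2$ ($a\ge 0$) and $\det^b$ ($b\in\mathbb{Z}$) as representations of $D_{\mathfrak p}^\times$, and we let $\mathrm{Nrd}: D_{\mathfrak p}^\times\to\mathbb{Q}_p^\times$ be the reduced norm. Let $\mathrm B$ be a unitary representation of $D_{\mathfrak p}^\times$ on a finite-dimensional $L$-vector space, i.e. a continuous representation that preserves an open bounded $\mathcal O$-lattice, and assume that the centre $\mathbb{Q}_p^\times$ acts by a character $\zeta_{\mathrm B}:\mathbb{Q}_p^\times\to L^\times$. Then: 1. $\mathrm B$ is semisimple. 2. There are a finite index set $I$ and an isomorphism of $D_{\mathfrak p}^\times$-representations $$\mathrm B\cong\bigoplus_{i\in I}\mathrm{Sym}^{a_i}L^2\otimes{\det}^{b_i}\otimes\tau_i\otimes(\eta_i\circ\mathrm{Nrd}),$$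 with $a_i\in\mathbb{Z}_{\ge 0}$, $b_i\in\mathbb{Z}$, $\tau_i$ an irreducible smooth representation of $D_{\mathfrak p}^\times$ on a finite-dimensional $L$-vector space, and $\eta_i:\mathbb{Q}_p^\times\to\mathcal O^\times$ a continuous character. 3. If $\zeta_{\mathrm B}$ is locally algebraic, i.e. there is $c\in\mathbb{Z}$ with $\zeta_{\mathrm B}(x)=x^c$ for all $x$ in an open subgroup of $\mathbb{Q}_p^\times$, then there is a decomposition as in 2 in which each $\eta_i$ is either trivial or equal to $x\mapsto\sqrt{\mathrm{pr}(x|x|)}$. Here $|p|=p^{-1}$, $\mathrm{pr}:\mathbb{Z}_p^\times=\mu_{p-1}\times(1+p\mathbb{Z}_p)\to 1+p\mathbb{Z}_p$ is the projection, and the square root is the one in $1+p\mathbb{Z}_p$. -/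

import Mathlib

open scoped TensorProduct

noncomputable section

namespace QuatRep

/-! ### Square roots of principal units in `ℤ_p` and the character `x ↦ √(pr(x|x|))` -/

theorem not_dvd_two (p : ℕ) (hp : 2 < p) : ¬ p ∣ 2 := Nat.not_dvd_of_pos_of_lt (by omega) hp

section Padic

variable (p : ℕ) [Fact p.Prime]

/-- The group `1 + p ℤ_p` of principal units, the kernel of reduction `ℤ_pˣ → 𝔽_pˣ`. -/
def principalUnits : Subgroup ℤ_[p]ˣ :=
  (Units.map (PadicInt.toZMod (p := p) : ℤ_[p] →* ZMod p)).ker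

theorem mem_principalUnits {u : ℤ_[p]ˣ} :
    u ∈ principalUnits p ↔ ‖(u : ℤ_[p]) - 1‖ < 1 := by
  have h1 : u ∈ principalUnits p ↔ PadicInt.toZMod (u : ℤ_[p]) = 1 := by
    unfold principalUnits
    rw [MonoidHom.mem_ker, Units.ext_iff]
    simp
  rw [h1, ← sub_eq_zero, ← map_one (PadicInt.toZMod (p := p)), ← map_sub,
    ← RingHom.mem_ker, PadicInt.ker_toZMod, IsLocalRing.mem_maximalIdeal,
    PadicInt.mem_nonunits]

/-- Raising to a power prime to `p` is bijective on `1 + p ℤ_p`. -/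
theorem pow_bijective {n : ℕ} (hn : ¬ p ∣ n) :
    Function.Bijective (powMonoidHom n : principalUnits p →* principalUnits p) := by
  have hnorm : ‖(n : ℤ_[p])‖ = 1 := by
    have h := PadicInt.norm_int_lt_one_iff_dvd (p := p) (n : ℤ)
    have h2 : ¬ ‖((n : ℤ) : ℤ_[p])‖ < 1 := by
      rw [h]; exact_mod_cast hn
    push_cast at h2
    exact le_antisymm (PadicInt.norm_le_one _) (not_lt.mp h2)
  have key : ∀ c : ℤ_[p], ‖c - 1‖ < 1 → ∃ z : ℤ_[p], z ^ n = c ∧ ‖z - 1‖ < 1 ∧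
      ∀ z' : ℤ_[p], z' ^ n = c → ‖z' - 1‖ < 1 → z' = z := by
    intro c hc
    have hd : ‖(Polynomial.aeval (1 : ℤ_[p]))
        (Polynomial.derivative (Polynomial.X ^ n - Polynomial.C c))‖ = 1 := by
      rw [Polynomial.derivative_sub, Polynomial.derivative_C, sub_zero,
        Polynomial.derivative_X_pow, map_mul, map_pow, Polynomial.aeval_X, one_pow, mul_one,
        Polynomial.aeval_C, Algebra.algebraMap_self_apply]
      exact hnorm
    have hlt : ‖(Polynomial.aeval (1 : ℤ_[p])) (Polynomial.X ^ n - Polynomial.C c)‖ <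
        ‖(Polynomial.aeval (1 : ℤ_[p]))
          (Polynomial.derivative (Polynomial.X ^ n - Polynomial.C c))‖ ^ 2 := by
      rw [hd]
      simpa [norm_sub_rev] using hc
    obtain ⟨z, hz, hz1, -, hz2⟩ := hensels_lemma hlt
    rw [hd] at hz1 hz2
    refine ⟨z, ?_, hz1, fun z' h h' => hz2 z' ?_ h'⟩
    · simpa [sub_eq_zero] using hz
    · simp [h]
  constructor
  · intro x y hxy
    obtain ⟨z, -, -, hz⟩ := key _ ((mem_principalUnits p).1 (y ^ n).2)
    have hx : ((x : ℤ_[p]ˣ) : ℤ_[p]) ^ n = (((y ^ n : principalUnits p) : ℤ_[p]ˣ) : ℤ_[p]) := by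
      have := congrArg (fun t : principalUnits p => ((t : ℤ_[p]ˣ) : ℤ_[p])) hxy
      simpa using this
    have e1 := hz _ hx ((mem_principalUnits p).1 x.2)
    have e2 := hz ((y : ℤ_[p]ˣ) : ℤ_[p]) (by simp) ((mem_principalUnits p).1 y.2)
    exact Subtype.ext (Units.ext (e1.trans e2.symm))
  · intro c
    obtain ⟨z, hz, hz1, -⟩ := key _ ((mem_principalUnits p).1 c.2)
    have hu : IsUnit z := by
      rcases Nat.eq_zero_or_pos n with rfl | hpos
      · exact absurd (dvd_zero p) hn
      · exact isUnit_of_dvd_unit (dvd_pow_self z hpos.ne') (hz ▸ Units.isUnit _)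
    refine ⟨⟨hu.unit, (mem_principalUnits p).2 (by simpa using hz1)⟩, ?_⟩
    apply Subtype.ext
    apply Units.ext
    simpa using hz

/-- The inverse of `w ↦ w ^ n` on `1 + p ℤ_p`, for `n` prime to `p`. -/
def principalRoot {n : ℕ} (hn : ¬ p ∣ n) : principalUnits p →* principalUnits p :=
  (MulEquiv.ofBijective (powMonoidHom n : principalUnits p →* principalUnits p)
    (pow_bijective p hn)).symm.toMonoidHom

theorem principalRoot_pow {n : ℕ} (hn : ¬ p ∣ n) (w : principalUnits p) :
    principalRoot p hn w ^ n = w :=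
  (MulEquiv.ofBijective (powMonoidHom n : principalUnits p →* principalUnits p)
    (pow_bijective p hn)).apply_symm_apply w

theorem not_dvd_sub_one : ¬ p ∣ p - 1 := by
  have h := (Fact.out : p.Prime).two_le
  exact Nat.not_dvd_of_pos_of_lt (by omega) (by omega)

theorem pow_mem_principalUnits (u : ℤ_[p]ˣ) : u ^ (p - 1) ∈ principalUnits p := by
  unfold principalUnits
  rw [MonoidHom.mem_ker, map_pow, ZMod.units_pow_card_sub_one_eq_one]

/-- The projection `pr : ℤ_pˣ = μ_{p-1} × (1 + p ℤ_p) → 1 + p ℤ_p`: the element `pr u` is the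
principal unit with `(pr u) ^ (p - 1) = u ^ (p - 1)`, i.e. with `u / pr u` in `μ_{p-1}`. -/
def pr : ℤ_[p]ˣ →* principalUnits p :=
  (principalRoot p (not_dvd_sub_one p)).comp
    ((powMonoidHom (p - 1) : ℤ_[p]ˣ →* ℤ_[p]ˣ).codRestrict (principalUnits p)
      (pow_mem_principalUnits p))

theorem pr_spec (u : ℤ_[p]ˣ) : (u * (pr p u : ℤ_[p]ˣ)⁻¹) ^ (p - 1) = 1 := by
  have h := congrArg (fun t : principalUnits p => (t : ℤ_[p]ˣ))
    (principalRoot_pow p (not_dvd_sub_one p) (⟨u ^ (p - 1), pow_mem_principalUnits p u⟩))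
  have h' : (pr p u : ℤ_[p]ˣ) ^ (p - 1) = u ^ (p - 1) := h
  rw [mul_pow, inv_pow, h', mul_inv_cancel]

theorem norm_mul_abs (x : ℚ_[p]ˣ) :
    ‖(x : ℚ_[p]) * (p : ℚ_[p]) ^ (-(x : ℚ_[p]).valuation)‖ = 1 := by
  have hp : (0 : ℝ) < p := by exact_mod_cast (Fact.out : p.Prime).pos
  rw [norm_mul, Padic.norm_p_zpow, Padic.norm_eq_zpow_neg_valuation x.ne_zero, neg_neg,
    ← zpow_add₀ hp.ne']
  simp

/-- The homomorphism `ℚ_pˣ → ℤ_pˣ`, `x ↦ x |x|`, where `|x| = p ^ (-v(x))`. -/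
def mulAbs : ℚ_[p]ˣ →* ℤ_[p]ˣ where
  toFun x := PadicInt.mkUnits (norm_mul_abs p x)
  map_one' := by
    apply Units.ext
    apply Subtype.ext
    simp [PadicInt.mkUnits]
  map_mul' x y := by
    apply Units.ext
    apply Subtype.ext
    have hp : (p : ℚ_[p]) ≠ 0 := by exact_mod_cast (Fact.out : p.Prime).ne_zero
    have hv := Padic.valuation_mul x.ne_zero y.ne_zero
    change ((x * y : ℚ_[p]ˣ) : ℚ_[p]) * (p : ℚ_[p]) ^ (-((x * y : ℚ_[p]ˣ) : ℚ_[p]).valuation) =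
      ((x : ℚ_[p]) * (p : ℚ_[p]) ^ (-(x : ℚ_[p]).valuation)) *
        ((y : ℚ_[p]) * (p : ℚ_[p]) ^ (-(y : ℚ_[p]).valuation))
    rw [Units.val_mul, hv, neg_add, zpow_add₀ hp]
    ring

/-- For `p > 2`, the character `x ↦ √(pr(x|x|))` of `ℚ_pˣ`, with values in `Lˣ`; the square root
is the one in `1 + p ℤ_p`. -/
def sqrtPr (L : Type*) [Field L] [Algebra ℚ_[p] L] (hp : 2 < p) : ℚ_[p]ˣ →* Lˣ :=
  (Units.map ((algebraMap ℚ_[p] L).comp (algebraMap ℤ_[p] ℚ_[p]) : ℤ_[p] →* L)).comp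
    ((principalUnits p).subtype.comp
      ((principalRoot p (not_dvd_two p hp)).comp ((pr p).comp (mulAbs p))))

end Padic

/-! ### Representations -/

section Rep

variable {k G : Type*} [Field k] [Group G]

/-- The one-dimensional representation attached to a character. -/
def ofChar (χ : G →* kˣ) : Representation k G k where
  toFun g := ((χ g : kˣ) : k) • LinearMap.id
  map_one' := by ext; simp
  map_mul' g h := by ext; simp [mul_comm]

/-- A representation is smooth if every vector is fixed by an open subgroup. -/
def IsSmooth [TopologicalSpace G] {V : Type*} [AddCommGroup V] [Module k V]
    (ρ : Representation k G V) : Prop :=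
  ∀ v, ∃ U : Subgroup G, IsOpen (U : Set G) ∧ ∀ g ∈ U, ρ g v = v

variable (k) in
/-- Linear substitution of variables `X_j ↦ ∑ i, g i j X_i`. Identifying `X_0, X_1` with the
standard basis of `k²`, so that `k[X_0, X_1] = Sym (k²)`, this is the map `Sym g`. -/
def subst (g : Matrix (Fin 2) (Fin 2) k) :
    MvPolynomial (Fin 2) k →ₐ[k] MvPolynomial (Fin 2) k :=
  MvPolynomial.aeval fun j => ∑ i, MvPolynomial.C (g i j) * MvPolynomial.X i

theorem subst_one : subst k 1 = AlgHom.id k _ := by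
  ext j : 1
  simp [subst, Matrix.one_apply]

theorem subst_mul (g h : Matrix (Fin 2) (Fin 2) k) :
    subst k (g * h) = (subst k g).comp (subst k h) := by
  ext j : 1
  simp [subst, Matrix.mul_apply, MvPolynomial.algebraMap_eq]
  ring

theorem subst_mem (g : Matrix (Fin 2) (Fin 2) k) (a : ℕ) {f : MvPolynomial (Fin 2) k}
    (hf : f ∈ MvPolynomial.homogeneousSubmodule (Fin 2) k a) :
    subst k g f ∈ MvPolynomial.homogeneousSubmodule (Fin 2) k a := by
  have h := MvPolynomial.IsHomogeneous.aeval (R := k) (n := 1)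
    ((MvPolynomial.mem_homogeneousSubmodule a f).1 hf)
    (fun j => ∑ i, MvPolynomial.C (g i j) * MvPolynomial.X i) (fun j =>
      MvPolynomial.IsHomogeneous.sum _ _ _ fun i _ =>
        MvPolynomial.isHomogeneous_C_mul_X (g i j) i)
  rw [one_mul] at h
  exact (MvPolynomial.mem_homogeneousSubmodule a _).2 h

variable (k) in
/-- The representation `Sym^a k²` of `GL₂(k)`, on the degree `a` part of `k[X_0, X_1] = Sym (k²)`. -/
def symPow (a : ℕ) : Representation k (Matrix (Fin 2) (Fin 2) k)ˣ
    (MvPolynomial.homogeneousSubmodule (Fin 2) k a) where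
  toFun g := (subst k (g : Matrix (Fin 2) (Fin 2) k)).toLinearMap.restrict
    fun _ hf => subst_mem _ a hf
  map_one' := by
    ext f : 1
    apply Subtype.ext
    simp [subst_one]
  map_mul' g h := by
    ext f : 1
    apply Subtype.ext
    change subst k ((g * h : (Matrix (Fin 2) (Fin 2) k)ˣ) : Matrix (Fin 2) (Fin 2) k) (f : _) =
      subst k (g : Matrix (Fin 2) (Fin 2) k) (subst k (h : Matrix (Fin 2) (Fin 2) k) (f : _))
    rw [Units.val_mul, subst_mul, AlgHom.comp_apply]

end Rep

/-! ### The reduced norm -/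

section ReducedNorm

variable {K L D : Type*} [Field K] [Field L] [Algebra K L] [DivisionRing D] [Algebra K D]

/-- The embedding `Dˣ → GL₂(L)` given by a splitting of `D` over `L`. -/
def toGL (e : L ⊗[K] D ≃ₐ[L] Matrix (Fin 2) (Fin 2) L) :
    Dˣ →* (Matrix (Fin 2) (Fin 2) L)ˣ :=
  Units.map ((e : L ⊗[K] D →* Matrix (Fin 2) (Fin 2) L).comp
    (Algebra.TensorProduct.includeRight : D →ₐ[K] L ⊗[K] D))

theorem trace_mulLeft_matrix (M : Matrix (Fin 2) (Fin 2) L) :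
    LinearMap.trace L (Matrix (Fin 2) (Fin 2) L) (LinearMap.mulLeft L M) = 2 * M.trace := by
  rw [LinearMap.trace_eq_matrix_trace L (Matrix.stdBasis L (Fin 2) (Fin 2))]
  have h : ∀ i j : Fin 2, LinearMap.toMatrix (Matrix.stdBasis L (Fin 2) (Fin 2))
      (Matrix.stdBasis L (Fin 2) (Fin 2)) (LinearMap.mulLeft L M) (i, j) (i, j) = M i i := by
    intro i j
    rw [LinearMap.toMatrix_apply, Matrix.stdBasis_eq_single, LinearMap.mulLeft_apply]
    simp [Matrix.stdBasis, Pi.basisFun_repr, Matrix.mul_apply, Matrix.single]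
  rw [Matrix.trace, Fintype.sum_prod_type]
  simp only [Fin.sum_univ_two, Matrix.diag_apply, h, Matrix.trace_fin_two]
  ring

theorem trace_split [FiniteDimensional K D] (e : L ⊗[K] D ≃ₐ[L] Matrix (Fin 2) (Fin 2) L)
    (d : D) :
    algebraMap K L (LinearMap.trace K D (LinearMap.mulLeft K d)) =
      2 * (e (1 ⊗ₜ[K] d)).trace := by
  rw [← LinearMap.trace_baseChange, ← trace_mulLeft_matrix,
    ← LinearMap.trace_conj' _ e.toLinearEquiv]
  congr 1
  refine LinearMap.ext fun M => ?_
  obtain ⟨t, rfl⟩ := e.surjective M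
  have ht : (LinearMap.mulLeft K d).baseChange L t = (1 ⊗ₜ[K] d) * t := by
    induction t with
    | zero => simp
    | tmul a b => simp
    | add x y hx hy => rw [map_add, hx, hy, mul_add]
  simp [LinearEquiv.conj_apply, ht]

/-- The determinant of `d`, computed in `M₂(L)`, lies in `K`. -/
theorem exists_reducedNorm [CharZero K] [FiniteDimensional K D]
    (e : L ⊗[K] D ≃ₐ[L] Matrix (Fin 2) (Fin 2) L) (d : D) :
    ∃ c : K, algebraMap K L c = (e (1 ⊗ₜ[K] d)).det := by
  have : CharZero L := charZero_of_injective_algebraMap (algebraMap K L).injective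
  refine ⟨(LinearMap.trace K D (LinearMap.mulLeft K d)) ^ 2 / 8 -
    LinearMap.trace K D (LinearMap.mulLeft K (d * d)) / 4, ?_⟩
  have h1 := trace_split e d
  have h2 := trace_split e (d * d)
  have h3 : e (1 ⊗ₜ[K] (d * d)) = e (1 ⊗ₜ[K] d) * e (1 ⊗ₜ[K] d) := by
    rw [← map_mul, Algebra.TensorProduct.tmul_mul_tmul, one_mul]
  rw [h3] at h2
  simp only [map_sub, map_div₀, map_pow, h1, h2, map_ofNat]
  simp [Matrix.trace_fin_two, Matrix.det_fin_two, Matrix.mul_apply]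
  ring

/-- The reduced norm `Nrd : Dˣ → Kˣ`: the determinant after splitting `D`, which lies in `K`. -/
def Nrd [CharZero K] [FiniteDimensional K D]
    (e : L ⊗[K] D ≃ₐ[L] Matrix (Fin 2) (Fin 2) L) : Dˣ →* Kˣ :=
  MonoidHom.toHomUnits
    { toFun := fun g => (exists_reducedNorm e (g : D)).choose
      map_one' := by
        apply (algebraMap K L).injective
        rw [(exists_reducedNorm e _).choose_spec, Units.val_one, map_one,
          ← Algebra.TensorProduct.one_def, map_one, Matrix.det_one]
      map_mul' := fun g h => by
        apply (algebraMap K L).injective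
        rw [map_mul, (exists_reducedNorm e _).choose_spec, (exists_reducedNorm e _).choose_spec,
          (exists_reducedNorm e _).choose_spec, ← Matrix.det_mul, ← map_mul,
          Algebra.TensorProduct.tmul_mul_tmul, one_mul, Units.val_mul] }

theorem algebraMap_Nrd [CharZero K] [FiniteDimensional K D]
    (e : L ⊗[K] D ≃ₐ[L] Matrix (Fin 2) (Fin 2) L) (g : Dˣ) :
    algebraMap K L (Nrd e g : K) = (e (1 ⊗ₜ[K] (g : D))).det :=
  (exists_reducedNorm e (g : D)).choose_spec

end ReducedNorm

/-! ### Unitary representations on finite-dimensional spaces and their decomposition -/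

section Unitary

variable {L G B : Type*} [NormedField L] [Group G] [TopologicalSpace G]
  [NormedAddCommGroup B] [NormedSpace L B]

/-- A unitary representation: the action `G × B → B` is continuous, and there is an open bounded
`G`-invariant lattice, i.e. a `G`-stable open bounded subgroup `Θ` that is a module over the ring
of integers `{a ∈ L : |a| ≤ 1}`. -/
def IsUnitary (ρ : Representation L G B) : Prop :=
  (Continuous fun x : G × B => ρ x.1 x.2) ∧
  ∃ Θ : AddSubgroup B, IsOpen (Θ : Set B) ∧ Bornology.IsBounded (Θ : Set B) ∧
    (∀ a : L, ‖a‖ ≤ 1 → ∀ v ∈ Θ, a • v ∈ Θ) ∧ ∀ g, ∀ v ∈ Θ, ρ g v ∈ Θ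

/-- A unitary character: a continuous character with values in the units of the ring of
integers of `L`. -/
def IsUnitaryChar (χ : G →* Lˣ) : Prop :=
  Continuous χ ∧ ∀ x, ‖(χ x : L)‖ = 1

end Unitary

section Decomposition

variable {p : ℕ} [Fact p.Prime]

/-- A character of `ℚ_pˣ` is locally algebraic if it equals `x ↦ x ^ c`, for an integer `c`, on an
open subgroup. -/
def IsLocallyAlgebraic {L : Type*} [Field L] [Algebra ℚ_[p] L] (ζ : ℚ_[p]ˣ →* Lˣ) : Prop :=
  ∃ c : ℤ, ∃ U : Subgroup ℚ_[p]ˣ, IsOpen (U : Set ℚ_[p]ˣ) ∧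
    ∀ x ∈ U, (ζ x : L) = algebraMap ℚ_[p] L x ^ c

variable {L D : Type*} [NormedField L] [NormedAlgebra ℚ_[p] L] [DivisionRing D]
  [Algebra ℚ_[p] D] [FiniteDimensional ℚ_[p] D]

/-- The character `det ^ b` of `Dˣ ⊆ GL₂(L)`. -/
def detPow (e : L ⊗[ℚ_[p]] D ≃ₐ[L] Matrix (Fin 2) (Fin 2) L) (b : ℤ) : Dˣ →* Lˣ :=
  (zpowGroupHom b).comp ((Units.map (Matrix.detMonoidHom : Matrix (Fin 2) (Fin 2) L →* L)).comp
    (toGL e))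

/-- The representation `Sym^a L² ⊗ det^b ⊗ τ ⊗ (η ∘ Nrd)` of `Dˣ`. -/
def block (e : L ⊗[ℚ_[p]] D ≃ₐ[L] Matrix (Fin 2) (Fin 2) L) (a : ℕ) (b : ℤ)
    {W : Type*} [AddCommGroup W] [Module L W] (τ : Representation L Dˣ W) (η : ℚ_[p]ˣ →* Lˣ) :
    Representation L Dˣ
      (((MvPolynomial.homogeneousSubmodule (Fin 2) L a ⊗[L] L) ⊗[L] W) ⊗[L] L) :=
  Representation.tprod
    (Representation.tprod
      (Representation.tprod (MonoidHom.comp (symPow L a) (toGL e)) (ofChar (detPow e b))) τ)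
    (ofChar (η.comp (Nrd e)))

/-- `ρ` is a finite direct sum of representations `Sym^a L² ⊗ det^b ⊗ τ ⊗ (η ∘ Nrd)` with `τ`
irreducible smooth (on a finite-dimensional space, taken to be some `L^d`) and `η` satisfying
`P`. -/
def IsSumOfBlocks [TopologicalSpace D] (e : L ⊗[ℚ_[p]] D ≃ₐ[L] Matrix (Fin 2) (Fin 2) L)
    {B : Type*} [AddCommGroup B] [Module L B] (ρ : Representation L Dˣ B)
    (P : (ℚ_[p]ˣ →* Lˣ) → Prop) : Prop :=
  ∃ (n : ℕ) (a : Fin n → ℕ) (b : Fin n → ℤ) (d : Fin n → ℕ)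
    (τ : ∀ i, Representation L Dˣ (Fin (d i) → L)) (η : Fin n → ℚ_[p]ˣ →* Lˣ),
    (∀ i, (τ i).IsIrreducible ∧ IsSmooth (τ i) ∧ P (η i)) ∧
    Nonempty (ρ.Equiv (Representation.directSum fun i => block e (a i) (b i) (τ i) (η i)))

end Decomposition

end QuatRep

end

/-! Near 1 a continuous representation of `Dˣ` on a finite-dimensional space V is the exponential of
a ℚ_p-linear map on D (`exists_differential`). Extended L-linearly to L ⊗ D = M₂(L), it becomes a
map of Lie algebras into End V, equivariant under `Dˣ` (`exists_isDifferential`). Its restriction to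
sl₂ is a finite-dimensional module in characteristic 0. Although L is not algebraically closed, the
classical theory holds, because the weights on the kernel of e are natural numbers; V is spanned by
the vectors f^i m with m a highest weight vector (`highestSpan_eq_top`).

Passing between sl₂ and the group costs only two things. A small element of `Dˣ` is the exponential
of a trace zero element times a central element (`eventually_exists_split`), and the centre acts by
scalars. An open subgroup containing the centre has finite index, because `Dˣ` is compact modulo
ℚ_pˣ (`finite_quotient`). So an sl₂-equivariant projection onto a subrepresentation commutes with a
subgroup of finite index, and averaging it gives an equivariant projection. This is semisimplicity.

Let ρ be irreducible with a nonzero highest weight vector of weight a. The sl₂-maps from Sym^a to ρ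
form a nonzero space on which `Dˣ` acts, after division by det^b ⊗ (η ∘ Nrd). If ζ(u) = u^(a+2b)
η(u)² near u = 1, this action is smooth (`eventually_multRep_eq`). For an irreducible τ inside it,
evaluation Sym^a ⊗ τ → ρ is injective (`lift_flip_injective`), hence an isomorphism up to the twist
(`exists_block`).

It remains to solve ζ(u) = u^(a+2b) η(u)² near 1. For p > 2 principal units have square roots, so b
= 0 and η = (ζ x^(-a)) ∘ √ works, and it is unitary because the invariant lattice forces |ζ| = 1. If
ζ(x) = x^c near 1, the parity of c - a decides between η = 1 and η = √(pr(x|x|)). -/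

open scoped TensorProduct

noncomputable section

namespace QuatRep

set_option linter.unusedSectionVars false

/-! ### Convergence of the p-adic exponential -/

section Exp
open Filter Topology NormedSpace
open scoped Nat

variable (p : ℕ) [Fact p.Prime]

/-- Legendre's formula gives v_p(n!) ≤ n, so |1/n!| ≤ p^n and the series converges on a ball of
radius 1/p. -/
theorem expSeries_radius_pos_padic (A : Type*) [NormedRing A] [NormedAlgebra ℚ_[p] A] :
    0 < (expSeries ℚ_[p] A).radius := by
  have hp1 : (1 : ℝ) < p := by exact_mod_cast (Fact.out : p.Prime).one_lt
  have hp0 : (0 : ℝ) < p := by linarith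
  have hfac : ∀ n : ℕ, ‖((n ! : ℕ) : ℚ_[p])⁻¹‖ ≤ (p : ℝ) ^ n := by
    intro n
    have h0 : ((n ! : ℕ) : ℚ_[p]) ≠ 0 := by exact_mod_cast n.factorial_ne_zero
    rw [norm_inv, Padic.norm_eq_zpow_neg_valuation h0, ← zpow_neg, neg_neg,
      Padic.valuation_natCast, zpow_natCast]
    refine pow_le_pow_right₀ hp1.le ?_
    have := sub_one_mul_padicValNat_factorial (p := p) n
    have h2 : padicValNat p n ! ≤ (p - 1) * padicValNat p n ! :=
      Nat.le_mul_of_pos_left _ (by have := (Fact.out : p.Prime).two_le; omega)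
    omega
  refine lt_of_lt_of_le ?_ (FormalMultilinearSeries.le_radius_of_bound (expSeries ℚ_[p] A)
    (C := max 1 ‖(1 : A)‖) (r := (p : NNReal)⁻¹) ?_)
  · exact ENNReal.coe_pos.2 (inv_pos.2 (by exact_mod_cast hp0))
  · intro n
    rw [expSeries_eq_ofScalars, FormalMultilinearSeries.ofScalars_norm_eq_mul,
      NNReal.coe_inv, NNReal.coe_natCast]
    calc _ ≤ ((p : ℝ) ^ n * max 1 ‖(1 : A)‖) * ((p : ℝ)⁻¹) ^ n :=
          mul_le_mul_of_nonneg_right (mul_le_mul (hfac n)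
            ContinuousMultilinearMap.norm_mkPiAlgebraFin_le
            (ContinuousMultilinearMap.opNorm_nonneg _) (by positivity)) (by positivity)
      _ = max 1 ‖(1 : A)‖ := by
          rw [inv_pow]; field_simp

end Exp

/-! ### The local logarithm of a p-adic Banach algebra -/

section Log
open Filter Topology NormedSpace
open scoped Nat


theorem hasStrictFDerivAt_exp_zero_padic (p : ℕ) [Fact p.Prime] (A : Type*) [NormedRing A] [NormedAlgebra ℚ_[p] A]
    [CompleteSpace A] :
    HasStrictFDerivAt (exp : A → A) ((ContinuousLinearEquiv.refl ℚ_[p] A : A ≃L[ℚ_[p]] A) : A →L[ℚ_[p]] A) 0 :=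
  hasStrictFDerivAt_exp_zero_of_radius_pos (expSeries_radius_pos_padic p A)

/-- The local inverse of `exp` at `0`. -/
def expHomeo (p : ℕ) [Fact p.Prime] (A : Type*) [NormedRing A] [NormedAlgebra ℚ_[p] A]
    [CompleteSpace A] : OpenPartialHomeomorph A A :=
  (hasStrictFDerivAt_exp_zero_padic p A).toOpenPartialHomeomorph exp

theorem zero_mem_expHomeo_source (p : ℕ) [Fact p.Prime] (A : Type*) [NormedRing A] [NormedAlgebra ℚ_[p] A]
    [CompleteSpace A] : (0 : A) ∈ (expHomeo p A).source :=
  HasStrictFDerivAt.mem_toOpenPartialHomeomorph_source _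

theorem expHomeo_coe (p : ℕ) [Fact p.Prime] (A : Type*) [NormedRing A] [NormedAlgebra ℚ_[p] A]
    [CompleteSpace A] : (expHomeo p A : A → A) = exp := rfl

/-- The logarithm near `1`. -/
def lg (p : ℕ) [Fact p.Prime] (A : Type*) [NormedRing A] [NormedAlgebra ℚ_[p] A]
    [CompleteSpace A] (x : A) : A := (expHomeo p A).symm x

theorem one_mem_expHomeo_target (p : ℕ) [Fact p.Prime] (A : Type*) [NormedRing A] [NormedAlgebra ℚ_[p] A]
    [CompleteSpace A] : (1 : A) ∈ (expHomeo p A).target := by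
  have := (expHomeo p A).map_source (zero_mem_expHomeo_source p A)
  rwa [expHomeo_coe, exp_zero] at this

theorem eventually_exp_lg (p : ℕ) [Fact p.Prime] (A : Type*) [NormedRing A] [NormedAlgebra ℚ_[p] A]
    [CompleteSpace A] : ∀ᶠ y in 𝓝 (1 : A), exp (lg p A y) = y :=
  (expHomeo p A).eventually_right_inverse (one_mem_expHomeo_target p A)

theorem eventually_lg_exp (p : ℕ) [Fact p.Prime] (A : Type*) [NormedRing A] [NormedAlgebra ℚ_[p] A]
    [CompleteSpace A] : ∀ᶠ x in 𝓝 (0 : A), lg p A (exp x) = x :=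
  (expHomeo p A).eventually_left_inverse (zero_mem_expHomeo_source p A)

theorem eventually_continuousAt_lg (p : ℕ) [Fact p.Prime] (A : Type*) [NormedRing A] [NormedAlgebra ℚ_[p] A]
    [CompleteSpace A] : ∀ᶠ y in 𝓝 (1 : A), ContinuousAt (lg p A) y := by
  filter_upwards [(expHomeo p A).open_target.mem_nhds (one_mem_expHomeo_target p A)] with y hy
  exact (expHomeo p A).symm.continuousAt hy

theorem lg_one (p : ℕ) [Fact p.Prime] (A : Type*) [NormedRing A] [NormedAlgebra ℚ_[p] A]
    [CompleteSpace A] : lg p A 1 = 0 := by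
  have := (eventually_lg_exp p A).self_of_nhds
  rwa [exp_zero] at this

theorem hasFDerivAt_lg_one (p : ℕ) [Fact p.Prime] (A : Type*) [NormedRing A] [NormedAlgebra ℚ_[p] A]
    [CompleteSpace A] : HasFDerivAt (lg p A) (ContinuousLinearMap.id ℚ_[p] A) 1 := by
  have := (hasStrictFDerivAt_exp_zero_padic p A).to_localInverse
  rw [exp_zero] at this
  exact this.hasFDerivAt

theorem eventually_continuousAt_exp (p : ℕ) [Fact p.Prime] (A : Type*) [NormedRing A] [NormedAlgebra ℚ_[p] A]
    [CompleteSpace A] : ∀ᶠ x in 𝓝 (0 : A), ContinuousAt (exp : A → A) x := by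
  have h := continuousOn_exp (𝕂 := ℚ_[p]) (𝔸 := A)
  filter_upwards [Metric.eball_mem_nhds (0 : A) (expSeries_radius_pos_padic p A)] with x hx
  exact h.continuousAt (Metric.isOpen_eball.mem_nhds hx)

theorem continuousAt_exp_zero (p : ℕ) [Fact p.Prime] (A : Type*) [NormedRing A] [NormedAlgebra ℚ_[p] A]
    [CompleteSpace A] : ContinuousAt (exp : A → A) 0 :=
  (eventually_continuousAt_exp p A).self_of_nhds

theorem tendsto_exp_zero (p : ℕ) [Fact p.Prime] (A : Type*) [NormedRing A] [NormedAlgebra ℚ_[p] A]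
    [CompleteSpace A] : Tendsto (exp : A → A) (𝓝 0) (𝓝 1) := by
  have := continuousAt_exp_zero p A
  rwa [ContinuousAt, exp_zero] at this

theorem tendsto_lg_one (p : ℕ) [Fact p.Prime] (A : Type*) [NormedRing A] [NormedAlgebra ℚ_[p] A]
    [CompleteSpace A] : Tendsto (lg p A) (𝓝 1) (𝓝 0) := by
  have := (hasFDerivAt_lg_one p A).continuousAt
  rwa [ContinuousAt, lg_one] at this

theorem exists_exp_ball (p : ℕ) [Fact p.Prime] (A : Type*) [NormedRing A] [NormedAlgebra ℚ_[p] A]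
    [CompleteSpace A] : ∃ r > 0, ∀ x : A, ‖x‖ < r → 
    IsUnit (exp x) ∧ (∀ y : A, ‖y‖ < r → Commute x y → exp (x + y) = exp x * exp y) ∧
    HasSum (fun n : ℕ => ((n ! : ℚ_[p])⁻¹) • x ^ n) (exp x) := by
  obtain ⟨r, hr, h⟩ := Metric.mem_nhds_iff.1
    (Metric.eball_mem_nhds (0 : A) (expSeries_radius_pos_padic p A))
  refine ⟨r, hr, fun x hx => ?_⟩
  have hm : ∀ y : A, ‖y‖ < r → y ∈ Metric.eball (0 : A) (expSeries ℚ_[p] A).radius :=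
    fun y hy => h (by simpa using hy)
  exact ⟨isUnit_exp_of_mem_ball (hm x hx), fun y hy hxy =>
    exp_add_of_commute_of_mem_ball hxy (hm x hx) (hm y hy),
    expSeries_hasSum_exp_of_mem_ball' x (hm x hx)⟩

theorem eventually_isUnit_exp (p : ℕ) [Fact p.Prime] (A : Type*) [NormedRing A] [NormedAlgebra ℚ_[p] A]
    [CompleteSpace A] : ∀ᶠ x in 𝓝 (0 : A), IsUnit (exp x) := by
  obtain ⟨r, hr, h⟩ := exists_exp_ball p A
  filter_upwards [Metric.ball_mem_nhds (0 : A) hr] with x hx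
  exact (h x (by simpa using hx)).1

theorem eventually_exp_nsmul (p : ℕ) [Fact p.Prime] (A : Type*) [NormedRing A] [NormedAlgebra ℚ_[p] A]
    [CompleteSpace A] (n : ℕ) : ∀ᶠ x in 𝓝 (0 : A), exp (n • x) = exp x ^ n := by
  obtain ⟨r, hr, h⟩ := exists_exp_ball p A
  induction n with
  | zero => simp
  | succ n ih =>
    have h1 : Tendsto (fun x : A => n • x) (𝓝 0) (𝓝 0) := by
      have := (continuous_const_smul (T := A) n).tendsto 0
      rwa [smul_zero] at this
    filter_upwards [ih, Metric.ball_mem_nhds (0 : A) hr, h1 (Metric.ball_mem_nhds (0 : A) hr)]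
      with x hx hxr hnr
    rw [succ_nsmul, (h (n • x) (by simpa using hnr)).2.1 x (by simpa using hxr)
      ((Commute.refl x).smul_left n), hx, pow_succ]

end Log

/-! ### The exponential into the unit group, and its derivatives -/

section Lie
open Filter Topology NormedSpace
open scoped Nat

open Classical in
/-- The exponential as a unit, where this makes sense. -/
def expUnit {A : Type*} [NormedRing A] (x : A) : Aˣ :=
  -- The default value 1 is harmless: everything below concerns x close to 0.
  if h : IsUnit (exp x) then h.unit else 1

theorem expUnit_val {A : Type*} [NormedRing A] {x : A} (h : IsUnit (exp x)) :
    (expUnit x : A) = exp x := by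
  rw [expUnit, dif_pos h, IsUnit.unit_spec]


theorem expUnit_zero {A : Type*} [NormedRing A] : expUnit (0 : A) = 1 := by
  apply Units.ext
  rw [expUnit_val (by rw [exp_zero]; exact isUnit_one), exp_zero, Units.val_one]

theorem eventually_expUnit (p : ℕ) [Fact p.Prime] (A : Type*) [NormedRing A] [NormedAlgebra ℚ_[p] A]
    [CompleteSpace A] : ∀ᶠ x in 𝓝 (0 : A), (expUnit x : A) = exp x := by
  filter_upwards [eventually_isUnit_exp p A] with x hx using expUnit_val hx

theorem eventually_continuousAt_expUnit (p : ℕ) [Fact p.Prime] (A : Type*) [NormedRing A] [NormedAlgebra ℚ_[p] A]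
    [CompleteSpace A] : ∀ᶠ x in 𝓝 (0 : A), ContinuousAt (expUnit : A → Aˣ) x := by
  filter_upwards [(eventually_expUnit p A).eventually_nhds, eventually_continuousAt_exp p A]
    with x hx hc
  rw [Units.isOpenEmbedding_val.isEmbedding.isInducing.continuousAt_iff]
  exact hc.congr (hx.mono fun y hy => by simp [hy])

theorem tendsto_expUnit (p : ℕ) [Fact p.Prime] (A : Type*) [NormedRing A] [NormedAlgebra ℚ_[p] A]
    [CompleteSpace A] : Tendsto (expUnit : A → Aˣ) (𝓝 0) (𝓝 1) := by
  have := (eventually_continuousAt_expUnit p A).self_of_nhds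
  rwa [ContinuousAt, expUnit_zero] at this

theorem tendsto_pow_smul (p : ℕ) [Fact p.Prime] {A : Type*} [NormedRing A] [NormedAlgebra ℚ_[p] A] (x : A) : Tendsto (fun k : ℕ => ((p : ℚ_[p]) ^ k) • x) atTop (𝓝 0) := by
  have h : Tendsto (fun k : ℕ => (p : ℚ_[p]) ^ k) atTop (𝓝 0) :=
    tendsto_pow_atTop_nhds_zero_of_norm_lt_one Padic.norm_p_lt_one
  simpa using h.smul_const x

theorem hasDerivAt_exp_smul (p : ℕ) [Fact p.Prime] {A : Type*} [NormedRing A] [NormedAlgebra ℚ_[p] A]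
    [CompleteSpace A] (x : A) : HasDerivAt (fun t : ℚ_[p] => exp (t • x)) x 0 := by
  have h : HasFDerivAt (exp : A → A) (ContinuousLinearMap.id ℚ_[p] A) ((0 : ℚ_[p]) • x) := by
    rw [zero_smul]; exact (hasStrictFDerivAt_exp_zero_padic p A).hasFDerivAt
  have h2 : HasDerivAt (fun t : ℚ_[p] => t • x) x 0 := by
    simpa using (hasDerivAt_id (0 : ℚ_[p])).smul_const x
  exact h.comp_hasDerivAt (0 : ℚ_[p]) h2

/-- The first order term of the Baker-Campbell-Hausdorff formula. -/
theorem hasDerivAt_lg_mul (p : ℕ) [Fact p.Prime] {A : Type*} [NormedRing A] [NormedAlgebra ℚ_[p] A]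
    [CompleteSpace A] (x y : A) :
    HasDerivAt (fun t : ℚ_[p] => lg p A (exp (t • x) * exp (t • y))) (x + y) 0 := by
  have h := (hasDerivAt_exp_smul p x).mul (hasDerivAt_exp_smul p y)
  have h1 : HasFDerivAt (lg p A) (ContinuousLinearMap.id ℚ_[p] A)
      (exp ((0 : ℚ_[p]) • x) * exp ((0 : ℚ_[p]) • y)) := by
    simpa using hasFDerivAt_lg_one p A
  have := h1.comp_hasDerivAt (0 : ℚ_[p]) h
  simp only [zero_smul, exp_zero, mul_one, one_mul, ContinuousLinearMap.id_apply] at this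
  exact this

/-- Derivatives are sampled along t = p^k because the logarithm turns p-th powers in the group into
scaling by p. -/
theorem tendsto_of_hasDerivAt (p : ℕ) [Fact p.Prime] {E : Type*} [NormedAddCommGroup E] [NormedSpace ℚ_[p] E]
    {f : ℚ_[p] → E} {x : E} (h : HasDerivAt f x 0) :
    Tendsto (fun k : ℕ => ((p : ℚ_[p]) ^ k)⁻¹ • (f ((p : ℚ_[p]) ^ k) - f 0)) atTop (𝓝 x) := by
  have hp : (p : ℚ_[p]) ≠ 0 := by exact_mod_cast (Fact.out : p.Prime).ne_zero
  have h1 := h.tendsto_slope_zero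
  have h2 : Tendsto (fun k : ℕ => (p : ℚ_[p]) ^ k) atTop (𝓝[≠] 0) := by
    refine tendsto_nhdsWithin_iff.2 ⟨tendsto_pow_atTop_nhds_zero_of_norm_lt_one
      Padic.norm_p_lt_one, Eventually.of_forall fun k => pow_ne_zero k hp⟩
  simpa [Function.comp_def] using h1.comp h2

end Lie

/-! ### Continuous homomorphisms of unit groups are differentiable -/

section LieHom
open Filter Topology NormedSpace


variable (p : ℕ) [Fact p.Prime] {A A' : Type*} [NormedRing A] [NormedAlgebra ℚ_[p] A]
  [CompleteSpace A] [NormedRing A'] [NormedAlgebra ℚ_[p] A'] [CompleteSpace A']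

/-- The map on Lie algebras induced by `φ`, defined near `0`. -/
def lgMap (φ : Aˣ →* A') (x : A) : A' := lg p A' (φ (expUnit x))

theorem norm_prime_smul_le {E : Type*} [NormedAddCommGroup E] [NormedSpace ℚ_[p] E] (k : ℕ) (x : E) :
    ‖((p : ℚ_[p]) ^ k) • x‖ ≤ ‖x‖ := by
  rw [norm_smul, norm_pow]
  exact mul_le_of_le_one_left (norm_nonneg _) (pow_le_one₀ (norm_nonneg _) Padic.norm_p_lt_one.le)

/-- φ commutes with p-th powers, which are multiplication by p in logarithmic coordinates. A ball is
stable under scaling by p since |p| < 1, so one radius serves for all k. -/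
theorem exists_lgMap_ball (φ : Aˣ →* A') (hφ : Continuous φ) : ∃ r > 0, ∀ x : A, ‖x‖ < r →
    exp (lgMap p φ x) = φ (expUnit x) ∧ ContinuousAt (lgMap p φ) x ∧
    (expUnit x : A) = exp x ∧
    ∀ k : ℕ, lgMap p φ (((p : ℚ_[p]) ^ k) • x) = ((p : ℚ_[p]) ^ k) • lgMap p φ x := by
  have h1 : Tendsto (fun x : A => φ (expUnit x)) (𝓝 0) (𝓝 1) := by
    have := (hφ.tendsto 1).comp (tendsto_expUnit p A)
    rwa [map_one] at this
  have h2 : Tendsto (lgMap p φ) (𝓝 0) (𝓝 0) := (tendsto_lg_one p A').comp h1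
  have hsm : ∀ {E : Type _} [NormedAddCommGroup E] [NormedSpace ℚ_[p] E],
      Tendsto (fun x : E => p • x) (𝓝 0) (𝓝 0) := by
    intro E _ _
    have := (continuous_const_smul (T := E) p).tendsto 0
    rwa [smul_zero] at this
  have h3 : ∀ᶠ x in 𝓝 (0 : A), lgMap p φ (p • x) = p • lgMap p φ x := by
    have hsA' : Tendsto (fun x : A' => p • x) (𝓝 0) (𝓝 0) := by
      have := (continuous_const_smul (T := A') p).tendsto 0
      rwa [smul_zero] at this
    filter_upwards [h1.eventually (eventually_exp_lg p A'), eventually_exp_nsmul p A p,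
      h2.eventually (eventually_exp_nsmul p A' p), eventually_expUnit p A,
      hsm.eventually (eventually_expUnit p A),
      (hsA'.comp h2).eventually (eventually_lg_exp p A')] with x a b c d e g
    have hu : expUnit (p • x) = (expUnit x : Aˣ) ^ p := by
      apply Units.ext
      rw [e, b, Units.val_pow_eq_pow_val, d]
    change lg p A' (φ (expUnit (p • x))) = _
    rw [hu, map_pow, ← a]
    change lg p A' (exp (lgMap p φ x) ^ p) = _
    rw [← c]
    exact g
  have h4 : ∀ᶠ x in 𝓝 (0 : A), exp (lgMap p φ x) = φ (expUnit x) ∧ ContinuousAt (lgMap p φ) x ∧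
      (expUnit x : A) = exp x ∧ lgMap p φ (p • x) = p • lgMap p φ x := by
    filter_upwards [h1.eventually (eventually_exp_lg p A'), eventually_expUnit p A, h3,
      h1.eventually (eventually_continuousAt_lg p A'), eventually_continuousAt_expUnit p A]
      with x a b c d e
    refine ⟨a, ?_, b, c⟩
    exact ContinuousAt.comp (g := lg p A') d (hφ.continuousAt.comp e)
  obtain ⟨r, hr, h⟩ := Metric.eventually_nhds_iff_ball.1 h4
  refine ⟨r, hr, fun x hx => ?_⟩
  have hb : ∀ y : A, ‖y‖ < r → y ∈ Metric.ball (0 : A) r := fun y hy => by simpa using hy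
  refine ⟨(h x (hb x hx)).1, (h x (hb x hx)).2.1, (h x (hb x hx)).2.2.1, fun k => ?_⟩
  induction k with
  | zero => simp
  | succ k ih =>
    have := (h _ (hb _ ((norm_prime_smul_le p k x).trans_lt hx))).2.2.2
    rw [← Nat.cast_smul_eq_nsmul ℚ_[p], ← Nat.cast_smul_eq_nsmul ℚ_[p], smul_smul, ih, smul_smul,
      ← pow_succ'] at this
    exact this

/-- Lie's product formula: x + y is the limit of p^(-k) log(exp(p^k x) exp(p^k y)). The map induced
by φ carries this sequence to the one built from the images of x and y; continuity at x + y then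
gives additivity. -/
theorem exists_lgMap_add_ball (φ : Aˣ →* A') (hφ : Continuous φ) : ∃ r > 0, ∀ x y : A, ‖x‖ < r →
    ‖y‖ < r → lgMap p φ (x + y) = lgMap p φ x + lgMap p φ y := by
  obtain ⟨r, hr, h⟩ := exists_lgMap_ball p φ hφ
  refine ⟨r / 2, by linarith, fun x y hx hy => ?_⟩
  have hp : (p : ℚ_[p]) ≠ 0 := by exact_mod_cast (Fact.out : p.Prime).ne_zero
  have hxy : ‖x + y‖ < r := (norm_add_le _ _).trans_lt (by linarith)
  have hxr : ‖x‖ < r := by linarith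
  have hyr : ‖y‖ < r := by linarith
  set Z : ℕ → A := fun k => ((p : ℚ_[p]) ^ k)⁻¹ •
    lg p A (exp ((p : ℚ_[p]) ^ k • x) * exp ((p : ℚ_[p]) ^ k • y)) with hZ
  have hZt : Tendsto Z atTop (𝓝 (x + y)) := by
    have := tendsto_of_hasDerivAt p (hasDerivAt_lg_mul p x y)
    simpa [lg_one] using this
  have h1 : Tendsto (fun k => lgMap p φ (Z k)) atTop (𝓝 (lgMap p φ (x + y))) :=
    (h _ hxy).2.1.tendsto.comp hZt
  have h2 := tendsto_of_hasDerivAt p (hasDerivAt_lg_mul p (lgMap p φ x) (lgMap p φ y))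
  simp only [zero_smul, exp_zero, mul_one, lg_one, sub_zero] at h2
  refine tendsto_nhds_unique (h1.congr' ?_) h2
  have hsmall : ∀ᶠ k : ℕ in atTop, ‖Z k‖ < r := hZt.norm.eventually_lt_const hxy
  have hlog : Tendsto (fun k : ℕ => exp ((p : ℚ_[p]) ^ k • x) * exp ((p : ℚ_[p]) ^ k • y)) atTop
      (𝓝 1) := by
    have := ((tendsto_exp_zero p A).comp (tendsto_pow_smul p x)).mul
      ((tendsto_exp_zero p A).comp (tendsto_pow_smul p y))
    simpa using this
  filter_upwards [hsmall, hlog.eventually (eventually_exp_lg p A)] with k hk hl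
  have e1 : ((p : ℚ_[p]) ^ k) • Z k =
      lg p A (exp ((p : ℚ_[p]) ^ k • x) * exp ((p : ℚ_[p]) ^ k • y)) := by
    rw [hZ]; simp only; rw [smul_smul, mul_inv_cancel₀ (pow_ne_zero k hp), one_smul]
  have e2 := (h _ hk).2.2.2 k
  have sx := (norm_prime_smul_le p k x).trans_lt hxr
  have sy := (norm_prime_smul_le p k y).trans_lt hyr
  have e3 : expUnit (((p : ℚ_[p]) ^ k) • Z k) =
      (expUnit (((p : ℚ_[p]) ^ k) • x) * expUnit (((p : ℚ_[p]) ^ k) • y) : Aˣ) := by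
    apply Units.ext
    rw [(h _ ((norm_prime_smul_le p k (Z k)).trans_lt hk)).2.2.1, Units.val_mul,
      (h _ sx).2.2.1, (h _ sy).2.2.1, e1, hl]
  have e4 : lgMap p φ (((p : ℚ_[p]) ^ k) • Z k) =
      lg p A' (exp ((p : ℚ_[p]) ^ k • lgMap p φ x) * exp ((p : ℚ_[p]) ^ k • lgMap p φ y)) := by
    unfold lgMap
    rw [e3, map_mul]
    congr 1
    rw [← (h _ sx).1, ← (h _ sy).1, (h _ hxr).2.2.2, (h _ hyr).2.2.2]
    rfl
  rw [← e4, e2, smul_smul, inv_mul_cancel₀ (pow_ne_zero k hp), one_smul]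

theorem exists_pow_smul_small {E : Type*} [NormedAddCommGroup E] [NormedSpace ℚ_[p] E]
    {r : ℝ} (hr : 0 < r) (x : E) : ∃ k : ℕ, ‖((p : ℚ_[p]) ^ k) • x‖ < r := by
  have h : Tendsto (fun k : ℕ => (p : ℚ_[p]) ^ k) atTop (𝓝 0) :=
    tendsto_pow_atTop_nhds_zero_of_norm_lt_one Padic.norm_p_lt_one
  have h2 : Tendsto (fun k : ℕ => ((p : ℚ_[p]) ^ k) • x) atTop (𝓝 0) := by simpa using h.smul_const x
  have := h2.norm
  rw [norm_zero] at this
  exact (this.eventually_lt_const hr).exists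

/-- Continuous homomorphisms of `p`-adic unit groups are differentiable. -/
theorem exists_differential (φ : Aˣ →* A') (hφ : Continuous φ) :
    ∃ δ : A →L[ℚ_[p]] A', ∀ᶠ x in 𝓝 (0 : A), φ (expUnit x) = exp (δ x) := by
  obtain ⟨r₁, hr₁, h⟩ := exists_lgMap_ball p φ hφ
  obtain ⟨r₂, hr₂, hadd⟩ := exists_lgMap_add_ball p φ hφ
  have hp : (p : ℚ_[p]) ≠ 0 := by exact_mod_cast (Fact.out : p.Prime).ne_zero
  set r := min r₁ r₂
  have hr : 0 < r := lt_min hr₁ hr₂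
  -- The differential is extended from the ball to all of A by d(x) = p^(-k) lgMap(p^k x); `hdef`
  -- shows that the choice of k is immaterial.
  choose k hk using fun x : A => exists_pow_smul_small p hr x
  set d : A → A' := fun x => ((p : ℚ_[p]) ^ (k x))⁻¹ • lgMap p φ (((p : ℚ_[p]) ^ (k x)) • x) with hd
  have hdef : ∀ (x : A) (n : ℕ), ‖((p : ℚ_[p]) ^ n) • x‖ < r →
      lgMap p φ (((p : ℚ_[p]) ^ n) • x) = ((p : ℚ_[p]) ^ n) • d x := by
    intro x n hn
    have e1 := (h _ ((hk x).trans_le (min_le_left _ _))).2.2.2 n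
    have e2 := (h _ (hn.trans_le (min_le_left _ _))).2.2.2 (k x)
    rw [smul_smul, mul_comm, ← smul_smul, e2] at e1
    rw [hd]
    simp only
    rw [smul_comm, ← e1, smul_smul, inv_mul_cancel₀ (pow_ne_zero _ hp), one_smul]
  have hdef0 : ∀ x : A, ‖x‖ < r → d x = lgMap p φ x := by
    intro x hx
    have := hdef x 0 (by simpa using hx)
    simpa using this.symm
  have hdadd : ∀ x y, d (x + y) = d x + d y := by
    intro x y
    set n := max (k x) (max (k y) (k (x + y)))
    have aux : ∀ z, k z ≤ n → ‖((p : ℚ_[p]) ^ n) • z‖ < r := by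
      intro z hz
      obtain ⟨m, hm⟩ := Nat.exists_eq_add_of_le' hz
      rw [hm, pow_add, ← smul_smul]
      exact (norm_prime_smul_le p m _).trans_lt (hk z)
    have h1 := aux x (le_max_left _ _)
    have h2 := aux y ((le_max_left _ _).trans (le_max_right _ _))
    have h3 := aux (x + y) ((le_max_right _ _).trans (le_max_right _ _))
    have e := hadd _ _ (h1.trans_le (min_le_right _ _)) (h2.trans_le (min_le_right _ _))
    rw [← smul_add, hdef _ _ h1, hdef _ _ h2, hdef _ _ h3, ← smul_add] at e
    exact smul_right_injective A' (pow_ne_zero n hp) e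
  set D : A →+ A' := AddMonoidHom.mk' d hdadd with hD
  have hcont : Continuous D := by
    refine continuous_of_continuousAt_zero D ?_
    refine (h 0 (by simpa using hr₁)).2.1.congr ?_
    filter_upwards [Metric.ball_mem_nhds (0 : A) hr] with x hx
    exact (hdef0 x (by simpa using hx)).symm
  -- An additive map is ℚ-linear; continuity and the density of ℚ in ℚ_p make it ℚ_p-linear.
  have hrat : ∀ (q : ℚ) (x : A), D ((q : ℚ_[p]) • x) = (q : ℚ_[p]) • D x := by
    intro q x
    exact map_ratCast_smul D ℚ_[p] ℚ_[p] q x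
  have hsmul : ∀ (t : ℚ_[p]) (x : A), D (t • x) = t • D x := by
    intro t x
    have hden : DenseRange (fun q : ℚ => (q : ℚ_[p])) := Padic.denseRange_ratCast p
    refine hden.induction_on (p := fun t : ℚ_[p] => D (t • x) = t • D x) t ?_ fun q => hrat q x
    exact isClosed_eq (hcont.comp (continuous_id.smul continuous_const))
      (continuous_id.smul continuous_const)
  refine ⟨⟨⟨⟨D, map_add D⟩, hsmul⟩, hcont⟩, ?_⟩
  filter_upwards [Metric.ball_mem_nhds (0 : A) hr] with x hx
  have hx' : ‖x‖ < r := by simpa using hx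
  change _ = exp (d x)
  rw [hdef0 x hx', (h x (hx'.trans_le (min_le_left _ _))).1]

end LieHom

/-! ### The differential respects conjugation and brackets -/

section Differential
open Filter Topology NormedSpace
open scoped Nat

theorem eventually_exp_conj (p : ℕ) [Fact p.Prime] {A : Type*} [NormedRing A] [NormedAlgebra ℚ_[p] A]
    [CompleteSpace A] (g : Aˣ) :
    ∀ᶠ x in 𝓝 (0 : A), exp ((g : A) * x * (g⁻¹ : Aˣ)) = g * exp x * (g⁻¹ : Aˣ) := by
  obtain ⟨r, hr, h⟩ := exists_exp_ball p A
  have hc : Tendsto (fun x : A => (g : A) * x * (g⁻¹ : Aˣ)) (𝓝 0) (𝓝 0) := by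
    have : Continuous (fun x : A => (g : A) * x * (g⁻¹ : Aˣ)) := by fun_prop
    simpa using this.tendsto 0
  filter_upwards [Metric.ball_mem_nhds (0 : A) hr, hc (Metric.ball_mem_nhds (0 : A) hr)]
    with x hx hgx
  have h1 := (h _ (by simpa using hgx)).2.2
  have h2 := ((h x (by simpa using hx)).2.2.mul_left (g : A)).mul_right ((g⁻¹ : Aˣ) : A)
  refine h1.unique (h2.congr_fun ?_)
  intro n
  rw [Units.conj_pow, mul_smul_comm, smul_mul_assoc]

variable {p : ℕ} [Fact p.Prime] {A A' : Type*} [NormedRing A] [NormedAlgebra ℚ_[p] A]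
  [CompleteSpace A] [NormedRing A'] [NormedAlgebra ℚ_[p] A'] [CompleteSpace A']
  {F : Aˣ →* A'} {δ : A →L[ℚ_[p]] A'}

theorem tendsto_smul_zero (p : ℕ) [Fact p.Prime] {E : Type*} [NormedAddCommGroup E]
    [NormedSpace ℚ_[p] E] (x : E) :
    Tendsto (fun t : ℚ_[p] => t • x) (𝓝 0) (𝓝 0) := by
  have : Continuous (fun t : ℚ_[p] => t • x) := by fun_prop
  simpa using this.tendsto 0

theorem hasDerivAt_expUnit (hδ : ∀ᶠ x in 𝓝 (0 : A), F (expUnit x) = exp (δ x)) (x : A) :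
    HasDerivAt (fun t : ℚ_[p] => F (expUnit (t • x))) (δ x) 0 := by
  refine (hasDerivAt_exp_smul p (δ x)).congr_of_eventuallyEq ?_
  filter_upwards [(tendsto_smul_zero p x).eventually hδ] with t ht
  rw [ht, map_smul]

/-- Differentiate F(g) F(exp tx) = F(exp(t gxg⁻¹)) F(g) at t = 0. -/
theorem differential_conj (hδ : ∀ᶠ x in 𝓝 (0 : A), F (expUnit x) = exp (δ x)) (g : Aˣ) (x : A) :
    F g * δ x = δ ((g : A) * x * (g⁻¹ : Aˣ)) * F g := by
  have h1 := (hasDerivAt_expUnit hδ x).const_mul (F g)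
  have h2 := (hasDerivAt_expUnit hδ ((g : A) * x * (g⁻¹ : Aˣ))).mul_const (F g)
  refine h1.unique (h2.congr_of_eventuallyEq ?_)
  filter_upwards [(tendsto_smul_zero p x).eventually (eventually_exp_conj p g),
    (tendsto_smul_zero p x).eventually (eventually_expUnit p A),
    (tendsto_smul_zero p ((g : A) * x * (g⁻¹ : Aˣ))).eventually (eventually_expUnit p A)]
    with t ht ht2 ht3
  rw [← map_mul, ← map_mul]
  congr 1
  apply Units.ext
  have : t • ((g : A) * x * (g⁻¹ : Aˣ)) = (g : A) * (t • x) * (g⁻¹ : Aˣ) := by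
    rw [mul_smul_comm, smul_mul_assoc]
  rw [Units.val_mul, Units.val_mul, ht2, ht3, this, ht]
  simp [mul_assoc]

theorem eventually_expUnit_inv (p : ℕ) [Fact p.Prime] (A : Type*) [NormedRing A]
    [NormedAlgebra ℚ_[p] A] [CompleteSpace A] :
    ∀ᶠ x in 𝓝 (0 : A), (((expUnit x)⁻¹ : Aˣ) : A) = exp (-x) := by
  obtain ⟨r, hr, h⟩ := exists_exp_ball p A
  filter_upwards [Metric.ball_mem_nhds (0 : A) hr] with x hx
  have hx' : ‖x‖ < r := by simpa using hx
  have e := (h x hx').2.1 (-x) (by rwa [norm_neg]) (Commute.neg_right (Commute.refl x))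
  rw [add_neg_cancel, exp_zero] at e
  rw [Units.inv_eq_of_mul_eq_one_right]
  rw [expUnit_val (h x hx').1, e]

/-- Apply `differential_conj` with g = exp(tx) and differentiate once more at t = 0. -/
theorem differential_lie (hδ : ∀ᶠ x in 𝓝 (0 : A), F (expUnit x) = exp (δ x)) (x y : A) :
    δ (x * y - y * x) = δ x * δ y - δ y * δ x := by
  have h1 := (hasDerivAt_expUnit hδ x).mul_const (δ y)
  have h2 : HasDerivAt (fun t : ℚ_[p] => exp (t • x) * y * exp (-(t • x))) (x * y - y * x) 0 := by
    have a := ((hasDerivAt_exp_smul p x).mul_const y).mul (hasDerivAt_exp_smul p (-x))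
    simp only [zero_smul, exp_zero, one_mul, smul_neg] at a
    rw [neg_zero, exp_zero, mul_one, mul_neg, ← sub_eq_add_neg] at a
    exact a
  have h3 := (δ.hasFDerivAt.comp_hasDerivAt (0 : ℚ_[p]) h2).mul (hasDerivAt_expUnit hδ x)
  simp only [Function.comp_apply, zero_smul, neg_zero, exp_zero, expUnit_zero, mul_one, one_mul,
    map_one] at h3
  have := h1.unique (h3.congr_of_eventuallyEq ?_)
  · rw [this]; abel
  filter_upwards [(tendsto_smul_zero p x).eventually (eventually_expUnit_inv p A),
    (tendsto_smul_zero p x).eventually (eventually_expUnit p A)] with t ht ht2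
  rw [differential_conj hδ, ht, ht2]
  rfl

end Differential

/-! ### D as a normed algebra inside M₂(L) -/

section Chart
open Filter Topology NormedSpace
open scoped Nat
attribute [local instance] Matrix.linftyOpNormedRing Matrix.linftyOpNormedAlgebra

/-- Matrices with their operator norm. -/
def NMat (n : ℕ) (L : Type*) : Type _ := Matrix (Fin n) (Fin n) L

section NMat
variable (p : ℕ) [Fact p.Prime] (n : ℕ) (L : Type*) [NormedField L] [NormedAlgebra ℚ_[p] L]

instance : NormedRing (NMat n L) := inferInstanceAs (NormedRing (Matrix (Fin n) (Fin n) L))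

instance {K : Type*} [NormedField K] [NormedAlgebra K L] : NormedAlgebra K (NMat n L) :=
  inferInstanceAs (NormedAlgebra K (Matrix (Fin n) (Fin n) L))

instance : IsScalarTower ℚ_[p] L (NMat n L) :=
  inferInstanceAs (IsScalarTower ℚ_[p] L (Matrix (Fin n) (Fin n) L))

theorem finiteDimensional_NMat [FiniteDimensional ℚ_[p] L] : FiniteDimensional ℚ_[p] (NMat n L) :=
  inferInstanceAs (FiniteDimensional ℚ_[p] (Matrix (Fin n) (Fin n) L))

theorem completeSpace_NMat [FiniteDimensional ℚ_[p] L] : CompleteSpace (NMat n L) :=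
  haveI := finiteDimensional_NMat p n L
  FiniteDimensional.complete ℚ_[p] _

variable {n L}

theorem continuous_NMat {X : Type*} [TopologicalSpace X] {f : X → NMat n L}
    (h : ∀ i j, Continuous fun x => (show Matrix (Fin n) (Fin n) L from f x) i j) :
    Continuous f := by
  have : f = fun x => ∑ i, ∑ j, (show Matrix (Fin n) (Fin n) L from f x) i j •
      (show NMat n L from Matrix.single i j (1 : L)) := by
    funext x
    refine (Matrix.matrix_eq_sum_single (f x)).trans ?_
    refine Finset.sum_congr rfl fun i _ => Finset.sum_congr rfl fun j _ => ?_
    change Matrix.single i j (f x i j) = f x i j • Matrix.single i j (1 : L)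
    rw [Matrix.smul_single, smul_eq_mul, mul_one]
  rw [this]
  exact continuous_finsetSum _ fun i _ => continuous_finsetSum _ fun j _ =>
    (h i j).smul continuous_const

end NMat

variable {p : ℕ} [Fact p.Prime] {L D : Type*} [NormedField L] [NormedAlgebra ℚ_[p] L]
  [FiniteDimensional ℚ_[p] L] [DivisionRing D] [Algebra ℚ_[p] D] [FiniteDimensional ℚ_[p] D]
  (e : L ⊗[ℚ_[p]] D ≃ₐ[L] Matrix (Fin 2) (Fin 2) L)

/-- The embedding of `D` in `M₂(L)`. -/
def toMat : D →ₐ[ℚ_[p]] Matrix (Fin 2) (Fin 2) L :=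
  (e.restrictScalars ℚ_[p]).toAlgHom.comp Algebra.TensorProduct.includeRight

theorem toMat_apply (d : D) : toMat e d = e (1 ⊗ₜ d) := rfl

theorem coe_toGL (g : Dˣ) : (toGL e g : Matrix (Fin 2) (Fin 2) L) = toMat e g := rfl

/-- The image of `D` in `M₂(L)`, as a normed algebra. -/
def Img : Type _ := (show D →ₐ[ℚ_[p]] NMat 2 L from toMat e).range

instance : NormedRing (Img e) :=
  inferInstanceAs (NormedRing (show D →ₐ[ℚ_[p]] NMat 2 L from toMat e).range)

instance : NormedAlgebra ℚ_[p] (Img e) :=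
  inferInstanceAs (NormedAlgebra ℚ_[p] (show D →ₐ[ℚ_[p]] NMat 2 L from toMat e).range)

/-- `D` is identified with its image in `M₂(L)`. -/
def matEquiv : D ≃ₐ[ℚ_[p]] Img e :=
  AlgEquiv.ofInjective (toMat e) (toMat e).toRingHom.injective

instance : FiniteDimensional ℚ_[p] (Img e) := (matEquiv e).toLinearEquiv.finiteDimensional

instance : CompleteSpace (Img e) := FiniteDimensional.complete ℚ_[p] _

/-- The exponential map of `D`. -/
def expD (x : D) : Dˣ := Units.map (matEquiv e).symm.toMonoidHom (expUnit (matEquiv e x))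

variable [TopologicalSpace D] [IsModuleTopology ℚ_[p] D]

/-- Together with the next lemma this identifies the module topology of D with the norm topology of
`Img e`, so that the normed calculus above applies to D. -/
theorem continuous_matEquiv : Continuous (matEquiv e) :=
  IsModuleTopology.continuous_of_linearMap (matEquiv e).toLinearMap

theorem continuous_matEquiv_symm : Continuous (matEquiv e).symm := by
  have : IsTopologicalAddGroup D := IsModuleTopology.topologicalAddGroup ℚ_[p] D
  have : ContinuousSMul ℚ_[p] D := IsModuleTopology.toContinuousSMul ℚ_[p] D
  exact LinearMap.continuous_of_finiteDimensional (matEquiv e).symm.toLinearMap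

end Chart

/-! ### The exponential chart of `Dˣ` and the differential of a representation -/

section ChartLemmas
open Filter Topology NormedSpace
open scoped Nat

variable {p : ℕ} [Fact p.Prime] {L D : Type*} [NormedField L] [NormedAlgebra ℚ_[p] L]
  [FiniteDimensional ℚ_[p] L] [DivisionRing D] [Algebra ℚ_[p] D] [FiniteDimensional ℚ_[p] D]
  (e : L ⊗[ℚ_[p]] D ≃ₐ[L] Matrix (Fin 2) (Fin 2) L)

theorem expD_eq_iff {x : D} {u : Dˣ} : expD e x = u ↔ (expUnit (matEquiv e x) : Img e) = matEquiv e u := by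
  rw [← Units.val_inj]
  change (matEquiv e).symm _ = _ ↔ _
  rw [AlgEquiv.symm_apply_eq]

variable [TopologicalSpace D] [IsModuleTopology ℚ_[p] D]

theorem tendsto_matEquiv : Tendsto (matEquiv e) (𝓝 0) (𝓝 0) := by
  simpa using (continuous_matEquiv e).tendsto 0

/-- A neighbourhood of `0` in `D` maps onto a neighbourhood of `1` in `Dˣ`. -/
theorem eventually_mem_expD_image {N : Set D} (hN : N ∈ 𝓝 (0 : D)) :
    ∀ᶠ u in 𝓝 (1 : Dˣ), ∃ x ∈ N, expD e x = u := by
  have h1 : Tendsto (fun u : Dˣ => matEquiv e (u : D)) (𝓝 1) (𝓝 1) := by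
    have : Continuous (fun u : Dˣ => matEquiv e (u : D)) :=
      (continuous_matEquiv e).comp Units.continuous_val
    simpa using this.tendsto 1
  have h2 : Tendsto (fun u : Dˣ => lg p (Img e) (matEquiv e (u : D))) (𝓝 1) (𝓝 0) :=
    (tendsto_lg_one p (Img e)).comp h1
  have h3 : Tendsto (fun u : Dˣ => (matEquiv e).symm (lg p (Img e) (matEquiv e (u : D)))) (𝓝 1)
      (𝓝 0) := by
    have := (continuous_matEquiv_symm e).tendsto 0
    rw [map_zero] at this
    exact this.comp h2
  filter_upwards [h3 hN, h1.eventually (eventually_exp_lg p (Img e)),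
    h2.eventually (eventually_expUnit p (Img e))] with u hu hu2 hu3
  refine ⟨_, hu, ?_⟩
  rw [expD_eq_iff, AlgEquiv.apply_symm_apply, hu3, hu2]

theorem exists_expD_add : ∃ N ∈ 𝓝 (0 : D), ∀ x ∈ N, ∀ y ∈ N, Commute x y →
    expD e (x + y) = expD e x * expD e y := by
  obtain ⟨r, hr, h⟩ := exists_exp_ball p (Img e)
  obtain ⟨s, hs, h'⟩ := Metric.eventually_nhds_iff_ball.1 (eventually_expUnit p (Img e))
  -- Halving s keeps x + y in the ball where `expUnit` is the exponential.
  have hb : Metric.ball (0 : Img e) (min r (s / 2)) ∈ 𝓝 (0 : Img e) :=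
    Metric.ball_mem_nhds _ (by positivity)
  refine ⟨_, tendsto_matEquiv e hb, fun x hx y hy hxy => ?_⟩
  have hx' : ‖matEquiv e x‖ < min r (s / 2) := by simpa using hx
  have hy' : ‖matEquiv e y‖ < min r (s / 2) := by simpa using hy
  have hx1 := hx'.trans_le (min_le_left _ _)
  have hy1 := hy'.trans_le (min_le_left _ _)
  have hx2 := hx'.trans_le (min_le_right _ _)
  have hy2 := hy'.trans_le (min_le_right _ _)
  have hm : ∀ z : Img e, ‖z‖ < s → (expUnit z : Img e) = exp z := fun z hz => h' z (by simpa using hz)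
  rw [expD_eq_iff, Units.val_mul, map_mul, map_add,
    hm _ ((norm_add_le _ _).trans_lt (by linarith)),
    (h _ hx1).2.1 _ hy1 (hxy.map (matEquiv e)), ← hm _ (by linarith), ← hm _ (by linarith)]
  congr 1
  · exact ((expD_eq_iff e).1 rfl)
  · exact ((expD_eq_iff e).1 rfl)

theorem eventually_expD_algebraMap : ∀ᶠ c in 𝓝 (0 : ℚ_[p]),
    expD e (algebraMap ℚ_[p] D c) = Units.map (algebraMap ℚ_[p] D : ℚ_[p] →* D) (expUnit c) := by
  obtain ⟨r, hr, h⟩ := exists_exp_ball p (Img e)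
  obtain ⟨s, hs, h'⟩ := exists_exp_ball p ℚ_[p]
  have hc : Continuous (algebraMap ℚ_[p] (Img e)) := continuous_algebraMap _ _
  have h0 : Tendsto (algebraMap ℚ_[p] (Img e)) (𝓝 0) (𝓝 0) := by simpa using hc.tendsto 0
  filter_upwards [h0 (Metric.ball_mem_nhds (0 : Img e) hr), Metric.ball_mem_nhds (0 : ℚ_[p]) hs]
    with c hc1 hc2
  have e1 := h _ (by simpa using hc1)
  have e2 := h' c (by simpa using hc2)
  rw [expD_eq_iff, AlgEquiv.commutes, expUnit_val e1.1]
  change _ = matEquiv e (algebraMap ℚ_[p] D (expUnit c : ℚ_[p]))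
  rw [AlgEquiv.commutes, expUnit_val e2.1]
  refine e1.2.2.unique (((e2.2.2.map (algebraMap ℚ_[p] (Img e)) hc)).congr_fun ?_)
  intro n
  rw [Function.comp_apply, smul_eq_mul, map_mul, map_pow, Algebra.smul_def]

/-- `Δ` is the differential of the representation `σ` of `Dˣ`, extended to `M₂(L)`. -/
structure IsDifferential {V : Type*} [AddCommGroup V] [Module L V] (σ : Representation L Dˣ V)
    (Δ : Matrix (Fin 2) (Fin 2) L →ₗ[L] Module.End L V) : Prop where
  lie : ∀ M N, Δ (M * N - N * M) = Δ M * Δ N - Δ N * Δ M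
  conj : ∀ (g : Dˣ) M, σ g * Δ M =
    Δ ((toGL e g : Matrix (Fin 2) (Fin 2) L) * M * ((toGL e g)⁻¹ : (Matrix (Fin 2) (Fin 2) L)ˣ)) * σ g
  -- The two analytic conditions are tested against linear functionals, so that V needs no topology.
  tendsto : ∀ (x : D) (v : V) (l : V →ₗ[L] L),
    Tendsto (fun k : ℕ => ((p : ℚ_[p]) ^ k)⁻¹ • (l (σ (expD e ((p : ℚ_[p]) ^ k • x)) v) - l v))
      atTop (𝓝 (l (Δ (toMat e x) v)))
  hasSum : ∀ᶠ x in 𝓝 (0 : D), ∀ (v : V) (l : V →ₗ[L] L),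
    HasSum (fun n : ℕ => ((n ! : ℚ_[p])⁻¹) • l ((Δ (toMat e x) ^ n) v)) (l (σ (expD e x) v))

/-- The image of D spans M₂(L) over L, so L-linear statements about M₂(L) need only be checked on D.
-/
theorem mat_induction {P : Matrix (Fin 2) (Fin 2) L → Prop} (h0 : P 0)
    (h1 : ∀ (a : L) (x : D), P (a • toMat e x)) (h2 : ∀ M N, P M → P N → P (M + N)) (M) : P M := by
  obtain ⟨t, rfl⟩ := e.surjective M
  induction t with
  | zero => simpa using h0
  | tmul a x =>
    have : a ⊗ₜ[ℚ_[p]] x = a • ((1 : L) ⊗ₜ[ℚ_[p]] x) := by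
      rw [TensorProduct.smul_tmul', smul_eq_mul, mul_one]
    rw [this, map_smul]
    exact h1 a x
  | add x y hx hy => rw [map_add]; exact h2 _ _ hx hy

/-- In a basis of V, σ is a continuous homomorphism from `(Img e)ˣ` to matrices, so
`exists_differential` applies. The resulting map on D is extended along M₂(L) = L ⊗ D, and
`mat_induction` carries the bracket and conjugation identities over. -/
theorem exists_isDifferential {V : Type*} [AddCommGroup V] [Module L V] [FiniteDimensional L V]
    (σ : Representation L Dˣ V) (hσ : ∀ (v : V) (l : V →ₗ[L] L), Continuous fun g => l (σ g v)) :
    ∃ Δ, IsDifferential e σ Δ := by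
  set n := Module.finrank L V
  set b : Module.Basis (Fin n) L V := Module.finBasis L V
  set m : Module.End L V ≃ₐ[L] Matrix (Fin n) (Fin n) L := LinearMap.toMatrixAlgEquiv b with hm
  have hmapply : ∀ (f : Module.End L V) i j, m f i j = b.repr (f (b j)) i :=
    fun f i j => LinearMap.toMatrixAlgEquiv_apply b f i j
  have := completeSpace_NMat p n L
  let toN : Matrix (Fin n) (Fin n) L ≃ₐ[L] NMat n L := AlgEquiv.refl
  let F : (Img e)ˣ →* NMat n L :=
    (toN.toMonoidHom.comp m.toMonoidHom).comp
      (σ.comp (Units.map (matEquiv e).symm.toMonoidHom))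
  have hF : Continuous F := by
    refine continuous_NMat fun i j => ?_
    have h1 : Continuous (Units.map (matEquiv e).symm.toMonoidHom) :=
      (continuous_matEquiv_symm e).units_map _
    have h2 := (hσ (b j) (b.coord i)).comp h1
    refine h2.congr fun u => ?_
    change _ = m _ i j
    rw [hmapply]
    rfl
  obtain ⟨δ, hδ⟩ := exists_differential p F hF
  let δ' : D →ₗ[ℚ_[p]] NMat n L := δ.toLinearMap ∘ₗ (matEquiv e).toLinearMap
  let Δ : Matrix (Fin 2) (Fin 2) L →ₗ[L] Module.End L V :=
    (m.symm.toLinearMap ∘ₗ toN.symm.toLinearMap) ∘ₗ (δ'.liftBaseChange L) ∘ₗ e.symm.toLinearMap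
  have hΔ : ∀ x : D, Δ (toMat e x) = m.symm (toN.symm (δ (matEquiv e x))) := by
    intro x
    simp only [Δ, LinearMap.comp_apply, toMat_apply]
    simp [δ']
  have hFg : ∀ g : Dˣ, F (Units.map (matEquiv e).toMonoidHom g) = toN (m (σ g)) := by
    intro g
    change toN (m (σ _)) = _
    congr 3
    apply Units.ext
    exact (matEquiv e).symm_apply_apply _
  have hFe : ∀ x : D, F (expUnit (matEquiv e x)) = toN (m (σ (expD e x))) := fun x => rfl
  -- linear functionals
  have hl : ∀ (v : V) (l : V →ₗ[L] L), ∃ Λ : NMat n L →L[ℚ_[p]] L,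
      ∀ f : Module.End L V, Λ (toN (m f)) = l (f v) := by
    intro v l
    have := finiteDimensional_NMat p n L
    let Λ : NMat n L →ₗ[L] L :=
      l ∘ₗ (LinearMap.applyₗ v) ∘ₗ m.symm.toLinearMap ∘ₗ toN.symm.toLinearMap
    refine ⟨LinearMap.toContinuousLinearMap (Λ.restrictScalars ℚ_[p]), fun f => ?_⟩
    simp [Λ]
  refine ⟨Δ, ?_, ?_, ?_, ?_⟩
  · intro M N
    induction M using mat_induction e with
    | h0 => simp
    | h2 M M' h h' =>
      rw [add_mul, mul_add, add_sub_add_comm, map_add, h, h', map_add, add_mul, mul_add]; abel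
    | h1 a x =>
    induction N using mat_induction e with
    | h0 => simp
    | h2 M M' h h' =>
      rw [add_mul, mul_add, add_sub_add_comm, map_add, h, h', map_add, add_mul, mul_add]; abel
    | h1 c y =>
      have : toMat e x * toMat e y - toMat e y * toMat e x = toMat e (x * y - y * x) := by
        rw [map_sub, map_mul, map_mul]
      simp only [smul_mul_smul_comm, mul_comm c a, ← smul_sub, this, map_smul, hΔ]
      congr 1
      rw [map_sub, map_mul, map_mul, differential_lie hδ]
      simp
  · intro g M
    induction M using mat_induction e with
    | h0 => simp
    | h2 M M' h h' => simp only [mul_add, add_mul, map_add, h, h']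
    | h1 a x =>
      simp only [map_smul, mul_smul_comm, smul_mul_assoc]
      congr 1
      have h1 : (toGL e g : Matrix (Fin 2) (Fin 2) L) * toMat e x *
          ((toGL e g)⁻¹ : (Matrix (Fin 2) (Fin 2) L)ˣ) = toMat e (g * x * (g⁻¹ : Dˣ)) := by
        rw [← map_inv, coe_toGL, coe_toGL, map_mul, map_mul]
      rw [h1, hΔ, hΔ]
      have := differential_conj hδ (Units.map (matEquiv e).toMonoidHom g) (matEquiv e x)
      rw [hFg] at this
      have h2 := congrArg (fun z => m.symm (toN.symm z)) this
      simp only [map_mul, AlgEquiv.symm_apply_apply] at h2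
      rw [h2]
      congr 4
      rw [← map_inv, map_mul, map_mul]
      rfl
  · intro x v l
    obtain ⟨Λ, hΛ⟩ := hl v l
    have h1 := tendsto_of_hasDerivAt p (hasDerivAt_expUnit hδ (matEquiv e x))
    have h2 := (Λ.continuous.tendsto _).comp h1
    have h3 : Λ (δ (matEquiv e x)) = l (Δ (toMat e x) v) := by
      rw [hΔ, ← hΛ]; simp
    rw [h3] at h2
    refine h2.congr fun k => ?_
    simp only [Function.comp_apply, zero_smul, expUnit_zero, map_one, map_smul, map_sub]
    rw [← map_smul, hFe, hΛ]
    have : Λ 1 = l v := by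
      have := hΛ 1
      simpa using this
    rw [this]
  · obtain ⟨r, hr, h⟩ := exists_exp_ball p (NMat n L)
    have h0 : Tendsto (fun x : D => δ (matEquiv e x)) (𝓝 0) (𝓝 0) := by
      have := (δ.continuous.tendsto 0).comp (tendsto_matEquiv e)
      rwa [map_zero] at this
    filter_upwards [(tendsto_matEquiv e).eventually hδ, h0 (Metric.ball_mem_nhds _ hr)]
      with x hx hxr v l
    obtain ⟨Λ, hΛ⟩ := hl v l
    have h1 := (h _ (by simpa using hxr)).2.2.map Λ Λ.continuous
    rw [← hx, hFe, hΛ] at h1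
    refine h1.congr_fun fun k => ?_
    rw [Function.comp_apply, map_smul, hΔ, ← hΛ]
    simp

end ChartLemmas

/-! ### Finite-dimensional sl₂-modules over a field of characteristic 0 -/

section Sl2
open Polynomial
open scoped Nat

variable {K V : Type*} [Field K] [AddCommGroup V] [Module K V]

/-- Endomorphisms satisfying the relations of `sl₂`. -/
structure IsSl2 (e f h : Module.End K V) : Prop where
  he : ∀ v, h (e v) = e (h v) + (2 : K) • e v
  hf : ∀ v, h (f v) = f (h v) - (2 : K) • f v
  ef : ∀ v, e (f v) = f (e v) + h v

/-- Submodules stable under `e`, `f` and `h`. -/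
def IsStable (e f h : Module.End K V) (S : Submodule K V) : Prop :=
  (∀ v ∈ S, e v ∈ S) ∧ (∀ v ∈ S, f v ∈ S) ∧ ∀ v ∈ S, h v ∈ S

theorem isStable_bot (e f h : Module.End K V) : IsStable e f h ⊥ := by
  refine ⟨?_, ?_, ?_⟩ <;> simp

theorem pow_mem_of_stable {S : Submodule K V} {e : Module.End K V} (h : ∀ v ∈ S, e v ∈ S) (n : ℕ) :
    ∀ v ∈ S, (e ^ n) v ∈ S := by
  induction n with
  | zero => simp
  | succ n ih => intro v hv; rw [pow_succ']; exact h _ (ih v hv)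

theorem aeval_mem_of_stable {S : Submodule K V} {e : Module.End K V} (h : ∀ v ∈ S, e v ∈ S)
    (q : K[X]) : ∀ v ∈ S, aeval e q v ∈ S := by
  intro v hv
  induction q using Polynomial.induction_on' with
  | add p q hp hq => rw [map_add]; exact S.add_mem hp hq
  | monomial n a =>
    rw [aeval_monomial, Module.algebraMap_end_eq_smul_id]
    exact S.smul_mem _ (pow_mem_of_stable h n v hv)

theorem aeval_apply_eigenvector {h : Module.End K V} {v : V} {a : K} (hv : h v = a • v) (q : K[X]) :
    aeval h q v = q.eval a • v := by
  have hn : ∀ n : ℕ, (h ^ n) v = a ^ n • v := by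
    intro n
    induction n with
    | zero => simp
    | succ n ih => rw [pow_succ', Module.End.mul_apply, ih, map_smul, hv, smul_smul, pow_succ]
  induction q using Polynomial.induction_on' with
  | add p q hp hq => rw [map_add, LinearMap.add_apply, hp, hq, eval_add, add_smul]
  | monomial n c =>
    rw [aeval_monomial, Module.algebraMap_end_eq_smul_id, eval_monomial, mul_smul, ← hn]
    rfl

variable (K) in
/-- The polynomial `X (X - 1) ⋯ (X - (n - 1))`. -/
def fallPoly (n : ℕ) : K[X] := ∏ i ∈ Finset.range n, (X - C (i : K))

theorem fallPoly_succ (n : ℕ) : fallPoly K (n + 1) = fallPoly K n * (X - C (n : K)) :=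
  Finset.prod_range_succ _ _

theorem eval_fallPoly (n : ℕ) (a : K) :
    (fallPoly K n).eval a = ∏ i ∈ Finset.range n, (a - (i : K)) := by
  simp [fallPoly, eval_prod]

theorem eval_fallPoly_ne_zero [CharZero K] {n a : ℕ} (h : n ≤ a) :
    (fallPoly K n).eval (a : K) ≠ 0 := by
  rw [eval_fallPoly, Finset.prod_ne_zero_iff]
  intro i hi
  rw [Finset.mem_range] at hi
  rw [sub_ne_zero]
  exact_mod_cast (by omega : a ≠ i)

namespace IsSl2

variable {e f h : Module.End K V} (H : IsSl2 e f h)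
include H

theorem h_f_pow (n : ℕ) (v : V) : h ((f ^ n) v) = (f ^ n) (h v) - (2 * n : K) • (f ^ n) v := by
  induction n with
  | zero => simp
  | succ n ih =>
    rw [pow_succ', Module.End.mul_apply, H.hf, ih, map_sub, map_smul, Module.End.mul_apply]
    push_cast
    module

theorem h_e_pow (n : ℕ) (v : V) : h ((e ^ n) v) = (e ^ n) (h v) + (2 * n : K) • (e ^ n) v := by
  induction n with
  | zero => simp
  | succ n ih =>
    rw [pow_succ', Module.End.mul_apply, H.he, ih, map_add, map_smul, Module.End.mul_apply]
    push_cast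
    module

theorem e_f_pow (n : ℕ) (v : V) : e ((f ^ (n + 1)) v) =
    (f ^ (n + 1)) (e v) + ((n : K) + 1) • (f ^ n) (h v - (n : K) • v) := by
  induction n generalizing v with
  | zero => simp [H.ef]
  | succ n ih =>
    have h1 : (f ^ (n + 1 + 1)) v = (f ^ (n + 1)) (f v) := by rw [pow_succ]; rfl
    have h2 : (f ^ (n + 1 + 1)) (e v) = (f ^ (n + 1)) (f (e v)) := by rw [pow_succ]; rfl
    have h3 : ∀ w, (f ^ (n + 1)) w = (f ^ n) (f w) := by intro w; rw [pow_succ]; rfl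
    rw [h1, h2, ih, H.ef, H.hf]
    simp only [map_add, map_sub, map_smul, h3]
    push_cast
    module

/-- On vectors killed by e, e^n f^n acts as n! h(h-1)⋯(h-n+1). The identity is proved modulo a
stable S since it is needed both for S = 0 and for the span of the highest weight vectors. -/
theorem e_pow_f_pow_sub_mem {S : Submodule K V} (hS : IsStable e f h S) (n : ℕ) {v : V}
    (hv : e v ∈ S) : (e ^ n) ((f ^ n) v) - (n ! : K) • aeval h (fallPoly K n) v ∈ S := by
  induction n generalizing v with
  | zero => simp [fallPoly]
  | succ n ih =>
    have hv' : e (h v - (n : K) • v) ∈ S := by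
      have := H.he v
      rw [map_sub, map_smul, ← sub_eq_iff_eq_add.2 this]
      exact S.sub_mem (S.sub_mem (hS.2.2 _ hv) (S.smul_mem _ hv)) (S.smul_mem _ hv)
    have h1 := ih hv'
    have h2 : (e ^ n) ((f ^ (n + 1)) (e v)) ∈ S :=
      pow_mem_of_stable hS.1 _ _ (pow_mem_of_stable hS.2.1 _ _ hv)
    have h3 : (e ^ (n + 1)) ((f ^ (n + 1)) v) = (e ^ n) ((f ^ (n + 1)) (e v)) +
        ((n : K) + 1) • (e ^ n) ((f ^ n) (h v - (n : K) • v)) := by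
      rw [pow_succ e n, Module.End.mul_apply, H.e_f_pow, map_add, map_smul]
    have h4 : aeval h (fallPoly K (n + 1)) v = aeval h (fallPoly K n) (h v - (n : K) • v) := by
      rw [fallPoly_succ, map_mul, Module.End.mul_apply]
      simp [Nat.cast_smul_eq_nsmul]
    rw [h3, h4, Nat.factorial_succ, add_sub_assoc]
    refine S.add_mem h2 ?_
    have := S.smul_mem ((n : K) + 1) h1
    rw [smul_sub, smul_smul] at this
    exact_mod_cast this

/-- Nilpotence of f makes the left side of the previous identity vanish, so on the kernel of e
modulo S the operator h satisfies a polynomial with distinct roots 0, …, N - 1. This replaces any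
appeal to an algebraic closure. -/
theorem aeval_fallPoly_mem [CharZero K] {S : Submodule K V} (hS : IsStable e f h S) {N : ℕ}
    (hN : f ^ N = 0) {v : V} (hv : e v ∈ S) : aeval h (fallPoly K N) v ∈ S := by
  have := H.e_pow_f_pow_sub_mem hS N hv
  rw [hN, LinearMap.zero_apply, map_zero, zero_sub, S.neg_mem_iff] at this
  exact (S.smul_mem_iff (by exact_mod_cast N.factorial_ne_zero)).1 this

/-- The powers e^n are eigenvectors of ad h with distinct eigenvalues 2n; were all of them nonzero,
End V would be infinite-dimensional. -/
theorem isNilpotent_e [CharZero K] [FiniteDimensional K V] : ∃ n, e ^ n = 0 := by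
  by_contra! hn
  have h1 := Module.End.eigenvectors_linearIndependent'
    (LinearMap.mulLeft K h - LinearMap.mulRight K h) (fun n : ℕ => (2 * n : K))
    (fun a b hab => by simpa using hab) (fun n : ℕ => e ^ n) (fun n => by
      refine ⟨Module.End.mem_eigenspace_iff.2 ?_, hn n⟩
      ext v
      simp [H.h_e_pow])
  exact not_finite_iff_infinite.2 inferInstance h1.finite_of_isNoetherian

theorem symm : IsSl2 f e (-h) where
  he v := by simp [H.hf]; module
  hf v := by simp [H.he]; module
  ef v := by simp [H.ef]

theorem isNilpotent_f [CharZero K] [FiniteDimensional K V] : ∃ n, f ^ n = 0 := H.symm.isNilpotent_e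

end IsSl2

/-- `v` is killed by `e` and has weight `a`. -/
def IsHighest (e h : Module.End K V) (a : ℕ) (v : V) : Prop := e v = 0 ∧ h v = (a : K) • v

/-- The submodule generated by the highest weight vectors. -/
def highestSpan (e f h : Module.End K V) : Submodule K V :=
  Submodule.span K {x | ∃ (i a : ℕ) (m : V), IsHighest e h a m ∧ x = (f ^ i) m}

namespace IsSl2
variable {e f h : Module.End K V}

theorem e_f_pow_highest (H : IsSl2 e f h) {a : ℕ} {m : V} (hm : IsHighest e h a m) (n : ℕ) :
    e ((f ^ (n + 1)) m) = (((n : K) + 1) * ((a : K) - n)) • (f ^ n) m := by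
  rw [H.e_f_pow, hm.1, hm.2, map_zero, zero_add, ← sub_smul, map_smul, smul_smul]

theorem h_f_pow_highest (H : IsSl2 e f h) {a : ℕ} {m : V} (hm : IsHighest e h a m) (n : ℕ) :
    h ((f ^ n) m) = ((a : K) - 2 * n) • (f ^ n) m := by
  rw [H.h_f_pow, hm.2, map_smul, sub_smul]

theorem e_pow_f_pow_highest (H : IsSl2 e f h) {a : ℕ} {m : V} (hm : IsHighest e h a m) (n : ℕ) :
    (e ^ n) ((f ^ n) m) = ((n ! : K) * (fallPoly K n).eval (a : K)) • m := by
  have := H.e_pow_f_pow_sub_mem (isStable_bot e f h) n (v := m) (by rw [hm.1]; simp)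
  rw [Submodule.mem_bot, sub_eq_zero, aeval_apply_eigenvector hm.2, smul_smul] at this
  exact this

theorem e_pow_f_pow_highest_of_lt (H : IsSl2 e f h) {a : ℕ} {m : V} (hm : IsHighest e h a m)
    {i j : ℕ} (hij : i < j) : (e ^ j) ((f ^ i) m) = 0 := by
  obtain ⟨k, rfl⟩ := Nat.exists_eq_add_of_lt hij
  have : i + k + 1 = k + 1 + i := by ring
  rw [this, pow_add, Module.End.mul_apply, H.e_pow_f_pow_highest hm, map_smul, pow_succ,
    Module.End.mul_apply, hm.1, map_zero, smul_zero]

/-- The vector is killed by e and has weight -a - 2, whereas only natural numbers occur as weights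
on the kernel of e. -/
theorem f_pow_highest_eq_zero [CharZero K] [FiniteDimensional K V] (H : IsSl2 e f h) {a : ℕ} {m : V}
    (hm : IsHighest e h a m) : (f ^ (a + 1)) m = 0 := by
  obtain ⟨N, hN⟩ := H.isNilpotent_f
  have h1 : e ((f ^ (a + 1)) m) ∈ (⊥ : Submodule K V) := by
    rw [H.e_f_pow_highest hm, sub_self, mul_zero, zero_smul]; simp
  have h2 := H.aeval_fallPoly_mem (isStable_bot e f h) hN h1
  rw [Submodule.mem_bot, aeval_apply_eigenvector (H.h_f_pow_highest hm _)] at h2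
  refine (smul_eq_zero.1 h2).resolve_left ?_
  rw [eval_fallPoly]
  refine Finset.prod_ne_zero_iff.2 fun i _ => ?_
  have : ((a : K) - 2 * ((a + 1 : ℕ) : K) - i) = -((a + 2 + i : ℕ) : K) := by push_cast; ring
  rw [this, neg_ne_zero]
  exact_mod_cast (by omega : a + 2 + i ≠ 0)

theorem isStable_highestSpan (H : IsSl2 e f h) : IsStable e f h (highestSpan e f h) := by
  have gen : ∀ {i a : ℕ} {m : V}, IsHighest e h a m → (f ^ i) m ∈ highestSpan e f h :=
    fun {i a m} hm => Submodule.subset_span ⟨i, a, m, hm, rfl⟩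
  have key : ∀ g : Module.End K V, (∀ (i a : ℕ) (m : V), IsHighest e h a m →
      g ((f ^ i) m) ∈ highestSpan e f h) → ∀ v ∈ highestSpan e f h, g v ∈ highestSpan e f h := by
    intro g hg v hv
    have : highestSpan e f h ≤ (highestSpan e f h).comap g := by
      refine Submodule.span_le.2 ?_
      rintro x ⟨i, a, m, hm, rfl⟩
      exact hg i a m hm
    exact this hv
  refine ⟨key e ?_, key f ?_, key h ?_⟩
  · rintro (_ | i) a m hm
    · simp [hm.1]
    · rw [H.e_f_pow_highest hm]
      exact Submodule.smul_mem _ _ (gen hm)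
  · intro i a m hm
    have : f ((f ^ i) m) = (f ^ (i + 1)) m := by rw [pow_succ']; rfl
    rw [this]; exact gen hm
  · intro i a m hm
    rw [H.h_f_pow_highest hm]
    exact Submodule.smul_mem _ _ (gen hm)

/-- The weights are peeled off one at a time: applying the first n factors to u gives a highest
weight vector w of weight n, and subtracting a suitable multiple of w from u removes the last
factor. -/
theorem mem_highestSpan_of_e_eq_zero [CharZero K] (H : IsSl2 e f h) (n : ℕ) {u : V} (hu : e u = 0)
    (hu2 : aeval h (fallPoly K n) u = 0) : u ∈ highestSpan e f h := by
  induction n generalizing u with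
  | zero =>
    have : u = 0 := by simpa [fallPoly] using hu2
    rw [this]; exact Submodule.zero_mem _
  | succ n ih =>
    set w := aeval h (fallPoly K n) u with hw
    have hcomm : ∀ (q : K[X]) (v : V), e v = 0 → e (aeval h q v) = 0 := by
      intro q v hv
      have := aeval_mem_of_stable (S := LinearMap.ker e) (e := h) (fun v hv => by
        rw [LinearMap.mem_ker] at hv ⊢
        have := H.he v
        rw [hv, map_zero, smul_zero, add_zero] at this
        exact this.symm) q v hv
      exact this
    have hwh : IsHighest e h n w := by
      refine ⟨hcomm _ _ hu, ?_⟩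
      rw [fallPoly_succ, mul_comm, map_mul, Module.End.mul_apply, ← hw] at hu2
      simpa [Nat.cast_smul_eq_nsmul, sub_eq_zero] using hu2
    have hc := eval_fallPoly_ne_zero (K := K) (le_refl n)
    have h1 : u - ((fallPoly K n).eval (n : K))⁻¹ • w ∈ highestSpan e f h := by
      refine ih ?_ ?_
      · rw [map_sub, map_smul, hu, hwh.1, smul_zero, sub_zero]
      · rw [map_sub, map_smul, aeval_apply_eigenvector hwh.2, smul_smul, inv_mul_cancel₀ hc,
          one_smul, ← hw, sub_self]
    have h2 : w ∈ highestSpan e f h := Submodule.subset_span ⟨0, n, w, hwh, by simp⟩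
    have := Submodule.add_mem _ h1 (Submodule.smul_mem _ ((fallPoly K n).eval (n : K))⁻¹ h2)
    simpa using this

/-- Without highest weight vectors e would be injective, since its kernel decomposes into such
vectors; but e is nilpotent. -/
theorem exists_isHighest [CharZero K] [FiniteDimensional K V] [Nontrivial V] (H : IsSl2 e f h) :
    ∃ (a : ℕ) (m : V), m ≠ 0 ∧ IsHighest e h a m := by
  by_contra! hcon
  have hbot : highestSpan e f h = ⊥ := by
    refine Submodule.span_eq_bot.2 ?_
    rintro x ⟨i, a, m, hm, rfl⟩
    have : m = 0 := by
      by_contra h0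
      exact hcon a m h0 hm
    rw [this, map_zero]
  obtain ⟨N, hN⟩ := H.isNilpotent_f
  obtain ⟨n, hn⟩ := H.isNilpotent_e
  have hinj : ∀ v, e v = 0 → v = 0 := by
    intro v hv
    have h1 := H.aeval_fallPoly_mem (isStable_bot e f h) hN (v := v) (by simp [hv])
    have := H.mem_highestSpan_of_e_eq_zero N hv h1
    rwa [hbot] at this
  obtain ⟨v, hv⟩ := exists_ne (0 : V)
  have hpow : ∀ k, (e ^ k) v ≠ 0 := by
    intro k
    induction k with
    | zero => simpa
    | succ k ih => rw [pow_succ']; exact fun h0 => ih (hinj _ h0)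
  exact hpow n (by rw [hn]; rfl)

/-- The heart of complete reducibility. It suffices that e v lies in e S, for then v differs from an
element of S by an element of the kernel of e. Modulo e S, the vector e v is annihilated by P(h),
with roots 2, …, N + 1, and, lying in S, also by Q(h), with roots 0, -1, …, 1 - N. These polynomials
are coprime. -/
theorem mem_highestSpan_of_e_mem [CharZero K] [FiniteDimensional K V] (H : IsSl2 e f h) {v : V}
    (hv : e v ∈ highestSpan e f h) : v ∈ highestSpan e f h := by
  set S := highestSpan e f h with hS
  have hst : IsStable e f h S := H.isStable_highestSpan
  obtain ⟨N, hN⟩ := H.isNilpotent_f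
  -- the polynomial vanishing on `S / e S`
  set Q : K[X] := ∏ b ∈ Finset.range N, (X - C (-(b : K))) with hQ
  -- The shift by 2 comes from e raising weights by 2.
  set P : K[X] := ∏ i ∈ Finset.range N, (X - C ((i : K) + 2)) with hP
  have hcop : IsCoprime P Q := by
    refine IsCoprime.prod_left fun i _ => IsCoprime.prod_right fun j _ => ?_
    refine isCoprime_X_sub_C_of_isUnit_sub (IsUnit.mk0 _ ?_)
    have : (i : K) + 2 - -(j : K) = ((i + 2 + j : ℕ) : K) := by push_cast; ring
    rw [this]
    exact_mod_cast (by omega : i + 2 + j ≠ 0)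
  have heS : ∀ w ∈ S.map e, h w ∈ S.map e := by
    rintro _ ⟨s, hs, rfl⟩
    refine ⟨h s + (2 : K) • s, S.add_mem (hst.2.2 s hs) (S.smul_mem _ hs), ?_⟩
    rw [H.he, map_add, map_smul]
  have hPe : ∀ w, aeval h P (e w) = e (aeval h (fallPoly K N) w) := by
    intro w
    have hfac : ∀ (c : K) (w : V), aeval h (X - C (c + 2)) (e w) = e (aeval h (X - C c) w) := by
      intro c w
      simp [Module.algebraMap_end_eq_smul_id, H.he]
    rw [hP, fallPoly]
    generalize N = n
    induction n generalizing w with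
    | zero => simp
    | succ n ih =>
      rw [Finset.prod_range_succ, Finset.prod_range_succ, map_mul, map_mul, Module.End.mul_apply,
        Module.End.mul_apply, hfac, ih]
  have hQS : ∀ s ∈ S, aeval h Q s ∈ S.map e := by
    intro s hs
    have : S ≤ (S.map e).comap (aeval h Q) := by
      rw [hS]
      refine Submodule.span_le.2 ?_
      rintro x ⟨i, a, m, hm, rfl⟩
      change aeval h Q ((f ^ i) m) ∈ S.map e
      -- Only the lowest vectors f^a m, of weight -a, can fail to lie in e S; every other f^i m is a
      -- multiple of e f^(i+1) m.
      by_cases hia : i = a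
      · subst hia
        rw [aeval_apply_eigenvector (H.h_f_pow_highest hm i)]
        by_cases hiN : i < N
        · have : Q.eval ((i : K) - 2 * i) = 0 := by
            rw [hQ, eval_prod, Finset.prod_eq_zero_iff]
            exact ⟨i, Finset.mem_range.2 hiN, by simp; ring⟩
          rw [this, zero_smul]; exact Submodule.zero_mem _
        · obtain ⟨k, rfl⟩ := Nat.exists_eq_add_of_le (not_lt.1 hiN)
          rw [pow_add, hN, zero_mul, LinearMap.zero_apply, smul_zero]
          exact Submodule.zero_mem _
      · refine aeval_mem_of_stable heS Q _ ?_
        have hne : (((i : K) + 1) * ((a : K) - i)) ≠ 0 := by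
          refine mul_ne_zero (by exact_mod_cast i.succ_ne_zero) (sub_ne_zero.2 ?_)
          exact_mod_cast (Ne.symm hia)
        refine ⟨(((i : K) + 1) * ((a : K) - i))⁻¹ • (f ^ (i + 1)) m, S.smul_mem _ 
          (Submodule.subset_span ⟨i + 1, a, m, hm, rfl⟩), ?_⟩
        rw [map_smul, H.e_f_pow_highest hm, smul_smul, inv_mul_cancel₀ hne, one_smul]
    exact this hs
  obtain ⟨A, B, hAB⟩ := hcop
  have hmem : e v ∈ S.map e := by
    have h1 : e v = aeval h A (aeval h P (e v)) + aeval h B (aeval h Q (e v)) := by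
      have := congrArg (fun q => aeval h q (e v)) hAB
      simpa using this.symm
    rw [h1]
    refine Submodule.add_mem _ (aeval_mem_of_stable heS _ _ ?_)
      (aeval_mem_of_stable heS _ _ (hQS _ hv))
    rw [hPe]
    exact ⟨_, H.aeval_fallPoly_mem hst hN hv, rfl⟩
  obtain ⟨s, hs, hse⟩ := hmem
  have h0 : e (v - s) = 0 := by rw [map_sub, hse, sub_self]
  have h1 := H.aeval_fallPoly_mem (isStable_bot e f h) hN (v := v - s) (by rw [h0]; simp)
  have h2 := H.mem_highestSpan_of_e_eq_zero N h0 h1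
  have := S.add_mem h2 hs
  rwa [sub_add_cancel] at this

theorem highestSpan_eq_top [CharZero K] [FiniteDimensional K V] (H : IsSl2 e f h) :
    highestSpan e f h = ⊤ := by
  obtain ⟨n, hn⟩ := H.isNilpotent_e
  have : ∀ k (v : V), (e ^ k) v ∈ highestSpan e f h → v ∈ highestSpan e f h := by
    intro k
    induction k with
    | zero => simp
    | succ k ih =>
      intro v hv
      rw [pow_succ'] at hv
      exact ih v (H.mem_highestSpan_of_e_mem hv)
  refine Submodule.eq_top_iff'.2 fun v => this n v ?_
  rw [hn]; exact Submodule.zero_mem _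

end IsSl2

end Sl2

/-! ### Complete reducibility for sl₂ -/

section Sl2Semisimple
open Polynomial
open scoped Nat

variable {K V : Type*} [Field K] [AddCommGroup V] [Module K V]

/-- The algebra of endomorphisms generated by `e`, `f`, `h`. -/
abbrev slAlg (e f h : Module.End K V) : Subalgebra K (Module.End K V) := Algebra.adjoin K {e, f, h}

theorem IsStable.smul_mem {e f h : Module.End K V} {S : Submodule K V} (hS : IsStable e f h S)
    (r : slAlg e f h) : ∀ v ∈ S, r • v ∈ S := by
  obtain ⟨r, hr⟩ := r
  change ∀ v ∈ S, r v ∈ S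
  induction hr using Algebra.adjoin_induction with
  | mem x hx =>
    rcases hx with rfl | rfl | rfl
    exacts [hS.1, hS.2.1, hS.2.2]
  | algebraMap c => intro v hv; exact S.smul_mem c hv
  | add x y _ _ hx hy => intro v hv; exact S.add_mem (hx v hv) (hy v hv)
  | mul x y _ _ hx hy => intro v hv; exact hx _ (hy v hv)

/-- A stable submodule as a module over the algebra generated by `e`, `f`, `h`. -/
def IsStable.toSubmodule {e f h : Module.End K V} {S : Submodule K V} (hS : IsStable e f h S) :
    Submodule (slAlg e f h) V where
  __ := S
  smul_mem' r v hv := hS.smul_mem r v hv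

namespace IsSl2
variable {e f h : Module.End K V}

/-- The module is spanned by the f^i m with i ≤ a. If j is the top index occurring in x ≠ 0, then
e^j x is a nonzero multiple of m, so x generates everything. -/
theorem isSimpleModule_span [CharZero K] [FiniteDimensional K V] (H : IsSl2 e f h) {a : ℕ} {m : V}
    (hm : IsHighest e h a m) (hm0 : m ≠ 0) :
    IsSimpleModule (slAlg e f h) (Submodule.span (slAlg e f h) {m}) := by
  have hf0 := H.f_pow_highest_eq_zero hm
  set U : Submodule K V := Submodule.span K (Set.range fun i : Fin (a + 1) => (f ^ (i : ℕ)) m)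
    with hU
  have gen : ∀ i : ℕ, (f ^ i) m ∈ U := by
    intro i
    by_cases hi : i < a + 1
    · exact Submodule.subset_span ⟨⟨i, hi⟩, rfl⟩
    · obtain ⟨k, rfl⟩ := Nat.exists_eq_add_of_le' (not_lt.1 hi)
      rw [pow_add, Module.End.mul_apply, hf0, map_zero]
      exact U.zero_mem
  have key : ∀ g : Module.End K V, (∀ i : ℕ, g ((f ^ i) m) ∈ U) → ∀ v ∈ U, g v ∈ U := by
    intro g hg v hv
    have : U ≤ U.comap g := by
      refine Submodule.span_le.2 ?_
      rintro x ⟨i, rfl⟩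
      exact hg i
    exact this hv
  have hUst : IsStable e f h U := by
    refine ⟨key e ?_, key f ?_, key h ?_⟩
    · rintro (_ | i)
      · simp [hm.1]
      · rw [H.e_f_pow_highest hm]
        exact U.smul_mem _ (gen i)
    · intro i
      have : f ((f ^ i) m) = (f ^ (i + 1)) m := by rw [pow_succ']; rfl
      rw [this]; exact gen _
    · intro i
      rw [H.h_f_pow_highest hm]
      exact U.smul_mem _ (gen i)
  have hle : Submodule.span (slAlg e f h) {m} ≤ hUst.toSubmodule := by
    rw [Submodule.span_singleton_le_iff_mem]
    exact gen 0
  have main : ∀ x ∈ Submodule.span (slAlg e f h) {m}, x ≠ 0 →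
      m ∈ Submodule.span (slAlg e f h) {x} := by
    intro x hx hx0
    have hxU : x ∈ U := hle hx
    obtain ⟨c, hc⟩ := (Submodule.mem_span_range_iff_exists_fun K).1 hxU
    classical
    have hex : ∃ j : Fin (a + 1), c j ≠ 0 ∧ ∀ i : Fin (a + 1), j < i → c i = 0 := by
      have hne : (Finset.univ.filter fun j : Fin (a + 1) => c j ≠ 0).Nonempty := by
        by_contra hcon
        rw [Finset.not_nonempty_iff_eq_empty, Finset.filter_eq_empty_iff] at hcon
        refine hx0 (hc ▸ Finset.sum_eq_zero fun i _ => ?_)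
        have := hcon (Finset.mem_univ i)
        rw [not_not] at this
        rw [this, zero_smul]
      refine ⟨_, (Finset.mem_filter.1 (Finset.max'_mem _ hne)).2, fun i hi => ?_⟩
      by_contra hci
      exact absurd (Finset.le_max' _ i (Finset.mem_filter.2 ⟨Finset.mem_univ i, hci⟩)) (not_le.2 hi)
    obtain ⟨j, hj, hj'⟩ := hex
    -- The scalar by which e^j f^j acts on m; it is nonzero because j ≤ a.
    set κ : K := ((j : ℕ) ! : K) * (fallPoly K j).eval (a : K)
    have hκ : κ ≠ 0 := mul_ne_zero (by exact_mod_cast Nat.factorial_ne_zero _)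
      (eval_fallPoly_ne_zero (by omega))
    have hej : (e ^ (j : ℕ)) x = (c j * κ) • m := by
      rw [← hc, map_sum, Finset.sum_eq_single j]
      · rw [map_smul, H.e_pow_f_pow_highest hm, smul_smul]
      · intro i _ hij
        rcases lt_or_gt_of_ne hij with h1 | h1
        · rw [map_smul, H.e_pow_f_pow_highest_of_lt hm h1, smul_zero]
        · rw [hj' i h1, zero_smul, map_zero]
      · simp
    have hmem : ((c j * κ)⁻¹ • e ^ (j : ℕ) : Module.End K V) ∈ slAlg e f h :=
      Subalgebra.smul_mem _ (pow_mem (Algebra.subset_adjoin (by simp)) _) _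
    rw [Submodule.mem_span_singleton]
    refine ⟨⟨_, hmem⟩, ?_⟩
    change (c j * κ)⁻¹ • (e ^ (j : ℕ)) x = m
    rw [hej, smul_smul, inv_mul_cancel₀ (mul_ne_zero hj hκ), one_smul]
  rw [isSimpleModule_iff_toSpanSingleton_surjective]
  refine ⟨⟨⟨⟨m, Submodule.mem_span_singleton_self m⟩, 0, ?_⟩⟩, ?_⟩
  · intro h0; exact hm0 (congrArg Subtype.val h0)
  · rintro ⟨x, hx⟩ hx0
    have hmx := main x hx (fun h0 => hx0 (Subtype.ext h0))
    rw [← LinearMap.range_eq_top, eq_top_iff]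
    rintro ⟨y, hy⟩ -
    obtain ⟨r, hr⟩ := Submodule.mem_span_singleton.1 
      ((Submodule.span_singleton_le_iff_mem _ _).2 hmx hy)
    exact ⟨r, Subtype.ext hr⟩

theorem isSemisimpleModule [CharZero K] [FiniteDimensional K V] (H : IsSl2 e f h) :
    IsSemisimpleModule (slAlg e f h) V := by
  refine IsSemisimpleModule.of_sSup_simples_eq_top ?_
  set T := sSup {m : Submodule (slAlg e f h) V | IsSimpleModule (slAlg e f h) m}
  have hT : ∀ (a : ℕ) (m : V), IsHighest e h a m → m ∈ T := by
    intro a m hm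
    by_cases hm0 : m = 0
    · rw [hm0]; exact T.zero_mem
    · exact (le_sSup (a := Submodule.span (slAlg e f h) {m}) (H.isSimpleModule_span hm hm0))
        (Submodule.mem_span_singleton_self m)
  have hle : highestSpan e f h ≤ T.restrictScalars K := by
    refine Submodule.span_le.2 ?_
    rintro x ⟨i, a, m, hm, rfl⟩
    exact T.smul_mem (⟨f ^ i, pow_mem (Algebra.subset_adjoin (by simp)) _⟩ : slAlg e f h) (hT a m hm)
  rw [H.highestSpan_eq_top] at hle
  exact eq_top_iff.2 fun v _ => hle (Submodule.mem_top)

/-- Stable submodules are direct summands. -/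
theorem exists_projection [CharZero K] [FiniteDimensional K V] (H : IsSl2 e f h)
    {S : Submodule K V} (hS : IsStable e f h S) :
    ∃ π : Module.End K V, (Commute e π ∧ Commute f π ∧ Commute h π) ∧ (∀ v, π v ∈ S) ∧
      ∀ v ∈ S, π v = v := by
  have := H.isSemisimpleModule
  obtain ⟨q, hq⟩ := exists_isCompl hS.toSubmodule
  set π : V →ₗ[slAlg e f h] V := hS.toSubmodule.subtype ∘ₗ hS.toSubmodule.projectionOnto q hq
  have hcomm : ∀ g ∈ ({e, f, h} : Set (Module.End K V)),
      Commute g ((π.restrictScalars K : V →ₗ[K] V) : Module.End K V) := by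
    intro g hg
    ext v
    exact (π.map_smul (⟨g, Algebra.subset_adjoin hg⟩ : slAlg e f h) v).symm
  refine ⟨π.restrictScalars K, ⟨hcomm e (by simp), hcomm f (by simp), hcomm h (by simp)⟩, ?_, ?_⟩
  · intro v
    exact (hS.toSubmodule.projectionOnto q hq v).2
  · intro v hv
    have := Submodule.projectionOnto_apply_left hq ⟨v, hv⟩
    exact congrArg Subtype.val this

end IsSl2
end Sl2Semisimple

/-! ### Derivatives along the sequence p^k -/

section SeqDeriv
open Filter Topology NormedSpace

variable {p : ℕ} [Fact p.Prime] {L : Type*} [NormedField L] [NormedAlgebra ℚ_[p] L]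

variable (p) in
/-- `u` has derivative `d` at `u₀` along the sequence `p ^ k`. -/
def SeqDeriv (u : ℕ → L) (u₀ d : L) : Prop :=
  Tendsto (fun k : ℕ => ((p : ℚ_[p]) ^ k)⁻¹ • (u k - u₀)) atTop (𝓝 d)

theorem SeqDeriv.tendsto {u : ℕ → L} {u₀ d : L} (h : SeqDeriv p u u₀ d) :
    Tendsto u atTop (𝓝 u₀) := by
  have hp : (p : ℚ_[p]) ≠ 0 := by exact_mod_cast (Fact.out : p.Prime).ne_zero
  have h1 : Tendsto (fun k : ℕ => (p : ℚ_[p]) ^ k) atTop (𝓝 0) :=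
    tendsto_pow_atTop_nhds_zero_of_norm_lt_one Padic.norm_p_lt_one
  have h2 := (h1.smul h).add_const u₀
  rw [zero_smul, zero_add] at h2
  refine h2.congr fun k => ?_
  rw [smul_smul, mul_inv_cancel₀ (pow_ne_zero k hp), one_smul, sub_add_cancel]

theorem SeqDeriv.const (c : L) : SeqDeriv p (fun _ => c) c 0 := by
  simp [SeqDeriv]

theorem SeqDeriv.add {u v : ℕ → L} {u₀ v₀ d d' : L} (h : SeqDeriv p u u₀ d)
    (h' : SeqDeriv p v v₀ d') : SeqDeriv p (fun k => u k + v k) (u₀ + v₀) (d + d') := by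
  refine (Tendsto.add h h').congr fun k => ?_
  rw [← smul_add]; congr 1; ring

theorem SeqDeriv.sub {u v : ℕ → L} {u₀ v₀ d d' : L} (h : SeqDeriv p u u₀ d)
    (h' : SeqDeriv p v v₀ d') : SeqDeriv p (fun k => u k - v k) (u₀ - v₀) (d - d') := by
  refine (Tendsto.sub h h').congr fun k => ?_
  rw [← smul_sub]; congr 1; ring

theorem SeqDeriv.mul {u v : ℕ → L} {u₀ v₀ d d' : L} (h : SeqDeriv p u u₀ d)
    (h' : SeqDeriv p v v₀ d') : SeqDeriv p (fun k => u k * v k) (u₀ * v₀) (d * v₀ + u₀ * d') := by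
  refine ((Tendsto.mul h h'.tendsto).add (Tendsto.const_mul u₀ h')).congr fun k => ?_
  rw [smul_mul_assoc, mul_smul_comm, ← smul_add]; congr 1; ring

theorem SeqDeriv.congr {u : ℕ → L} {u₀ d u₀' d' : L} (h : SeqDeriv p u u₀ d) (h1 : u₀ = u₀')
    (h2 : d = d') : SeqDeriv p u u₀' d' := h1 ▸ h2 ▸ h

theorem SeqDeriv.unique {u : ℕ → L} {u₀ d d' : L} (h : SeqDeriv p u u₀ d)
    (h' : SeqDeriv p u u₀ d') : d = d' := tendsto_nhds_unique h h'

/-- The chain rule for polynomials. -/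
theorem SeqDeriv.eval {y : ℕ → Fin 2 → L} {y₀ d : Fin 2 → L}
    (h : ∀ j, SeqDeriv p (fun k => y k j) (y₀ j) (d j)) (f : MvPolynomial (Fin 2) L) :
    SeqDeriv p (fun k => MvPolynomial.eval (y k) f) (MvPolynomial.eval y₀ f)
      (∑ j, d j * MvPolynomial.eval y₀ (MvPolynomial.pderiv j f)) := by
  induction f using MvPolynomial.induction_on with
  | C a => simpa using SeqDeriv.const a
  | add f g hf hg =>
    simp only [map_add, mul_add, Finset.sum_add_distrib]
    exact hf.add hg
  | mul_X f i hf =>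
    simp only [map_mul, MvPolynomial.eval_X]
    refine (hf.mul (h i)).congr rfl ?_
    simp only [Derivation.leibniz, MvPolynomial.pderiv_X, smul_eq_mul, map_add, map_mul,
      MvPolynomial.eval_X, mul_add, Finset.sum_add_distrib]
    rw [add_comm, Finset.sum_mul]
    congr 1
    · rw [Finset.sum_eq_single i]
      · simp; ring
      · intro j _ hj
        simp [hj.symm]
      · simp
    · exact Finset.sum_congr rfl fun j _ => by ring

end SeqDeriv

/-! ### The differential of Sym^a -/

section Sym
open Filter Topology NormedSpace
open scoped Nat

variable {p : ℕ} [Fact p.Prime] {L D : Type*} [NormedField L] [NormedAlgebra ℚ_[p] L]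
  [FiniteDimensional ℚ_[p] L] [DivisionRing D] [Algebra ℚ_[p] D] [FiniteDimensional ℚ_[p] D]
  (e : L ⊗[ℚ_[p]] D ≃ₐ[L] Matrix (Fin 2) (Fin 2) L)

theorem seqDeriv_toMat (x : D) (i j : Fin 2) :
    SeqDeriv p (fun k : ℕ => toMat e (expD e ((p : ℚ_[p]) ^ k • x) : Dˣ) i j)
      ((1 : Matrix (Fin 2) (Fin 2) L) i j) (toMat e x i j) := by
  let Λ₀ : Img e →ₗ[ℚ_[p]] L :=
    { toFun := fun z => (show Matrix (Fin 2) (Fin 2) L from z.1) i j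
      map_add' := fun _ _ => rfl
      map_smul' := fun _ _ => rfl }
  let Λ : Img e →L[ℚ_[p]] L := LinearMap.toContinuousLinearMap Λ₀
  have hΛ : ∀ d : D, Λ (matEquiv e d) = toMat e d i j := fun d => rfl
  have h1 := hasDerivAt_expUnit (p := p) (F := Units.coeHom (Img e)) (δ := ContinuousLinearMap.id _ _)
    (eventually_expUnit p (Img e)) (matEquiv e x)
  have h2 := (Λ.continuous.tendsto _).comp (tendsto_of_hasDerivAt p h1)
  unfold SeqDeriv
  rw [← hΛ]
  refine h2.congr fun k => ?_
  simp only [Function.comp_apply, map_smul, map_sub, zero_smul, expUnit_zero, map_one]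
  congr 2
  rw [← hΛ]
  congr 1
  rw [← map_smul, Units.coeHom_apply]
  exact (expD_eq_iff e).1 rfl

/-- `Sym^a` as a representation of `Dˣ`. -/
abbrev symRep (a : ℕ) : Representation L Dˣ (MvPolynomial.homogeneousSubmodule (Fin 2) L a) :=
  MonoidHom.comp (symPow L a) (toGL e)

theorem coe_symRep (a : ℕ) (g : Dˣ) (f : MvPolynomial.homogeneousSubmodule (Fin 2) L a) :
    ((symRep e a g f : MvPolynomial.homogeneousSubmodule (Fin 2) L a) : MvPolynomial (Fin 2) L) =
      subst L (toMat e g) f := rfl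

theorem eval_subst {K : Type*} [Field K] (M : Matrix (Fin 2) (Fin 2) K) (x : Fin 2 → K)
    (f : MvPolynomial (Fin 2) K) :
    MvPolynomial.eval x (subst K M f) = MvPolynomial.eval (fun j => ∑ i, M i j * x i) f := by
  induction f using MvPolynomial.induction_on with
  | C a => simp [subst]
  | add f g hf hg => simp [hf, hg]
  | mul_X f i hf => rw [map_mul, map_mul, hf]; simp [subst]

/-- Monomials of degree `a`. -/
def expSet (a : ℕ) : Finset (Fin 2 →₀ ℕ) := Finset.finsuppAntidiag Finset.univ a

theorem mem_expSet {a : ℕ} {s : Fin 2 →₀ ℕ} : s ∈ expSet a ↔ s 0 + s 1 = a := by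
  simp [expSet, Finset.mem_finsuppAntidiag, Fin.sum_univ_two]

theorem sum_expSet {K : Type*} [Field K] {a : ℕ} {f : MvPolynomial (Fin 2) K}
    (hf : f ∈ MvPolynomial.homogeneousSubmodule (Fin 2) K a) :
    f = ∑ s ∈ expSet a, MvPolynomial.monomial s (MvPolynomial.coeff s f) := by
  conv_lhs => rw [f.as_sum]
  refine Finset.sum_subset ?_ ?_
  · intro s hs
    have := (MvPolynomial.mem_homogeneousSubmodule _ _).1 hf (MvPolynomial.mem_support_iff.1 hs)
    rw [mem_expSet, ← this]
    simp [Finsupp.weight_apply, Finsupp.sum_fintype, Fin.sum_univ_two]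
  · intro s _ hs
    rw [MvPolynomial.notMem_support_iff.1 hs, map_zero]

instance finite_sym {K : Type*} [Field K] (a : ℕ) :
    FiniteDimensional K (MvPolynomial.homogeneousSubmodule (Fin 2) K a) := by
  exact Module.Finite.of_fg (MvPolynomial.homogeneousSubmodule_fg _ _ a)

theorem continuous_coeff_subst {X : Type*} [TopologicalSpace X]
    {M : X → Matrix (Fin 2) (Fin 2) L} (hM : ∀ i j, Continuous fun x => M x i j)
    (f : MvPolynomial (Fin 2) L) (s : Fin 2 →₀ ℕ) :
    Continuous fun x => MvPolynomial.coeff s (subst L (M x) f) := by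
  induction f using MvPolynomial.induction_on generalizing s with
  | C a => simpa [subst] using continuous_const
  | add f g hf hg =>
    simp only [map_add, MvPolynomial.coeff_add]
    exact (hf s).add (hg s)
  | mul_X f j hf =>
    simp only [map_mul, MvPolynomial.coeff_mul]
    refine continuous_finsetSum _ fun q _ => (hf q.1).mul ?_
    simp only [subst, MvPolynomial.aeval_X, MvPolynomial.coeff_sum, MvPolynomial.coeff_C_mul]
    exact continuous_finsetSum _ fun i _ => (hM i j).mul continuous_const

variable [TopologicalSpace D] [IsModuleTopology ℚ_[p] D]

theorem continuous_toMat (i j : Fin 2) : Continuous fun g : Dˣ => toMat e (g : D) i j := by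
  let Λ : D →ₗ[ℚ_[p]] L :=
    { toFun := fun z => toMat e z i j
      map_add' := fun x y => by rw [map_add]; rfl
      map_smul' := fun c x => by rw [map_smul]; rfl }
  have h : Continuous Λ := IsModuleTopology.continuous_of_linearMap Λ
  exact h.comp Units.continuous_val

theorem continuous_symRep (a : ℕ) (f : MvPolynomial.homogeneousSubmodule (Fin 2) L a)
    (l : MvPolynomial.homogeneousSubmodule (Fin 2) L a →ₗ[L] L) :
    Continuous fun g : Dˣ => l (symRep e a g f) := by
  obtain ⟨l', hl'⟩ := l.exists_extend
  have h1 : ∀ g, l (symRep e a g f) = ∑ s ∈ expSet a,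
      MvPolynomial.coeff s (subst L (toMat e (g : D)) (f : MvPolynomial (Fin 2) L)) *
        l' (MvPolynomial.monomial s (1 : L)) := by
    intro g
    rw [← hl', LinearMap.comp_apply, Submodule.subtype_apply, sum_expSet (symRep e a g f).2,
      map_sum]
    refine Finset.sum_congr rfl fun s _ => ?_
    rw [← smul_eq_mul, ← map_smul, MvPolynomial.smul_monomial, smul_eq_mul, mul_one, coe_symRep]
  simp only [h1]
  exact continuous_finsetSum _ fun s _ =>
    (continuous_coeff_subst (continuous_toMat e) _ s).mul continuous_const

/-- Over the infinite field L polynomials may be compared at points z. Evaluating Sym(g) f at z is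
evaluating f at a point depending linearly on g, so the chain rule gives the derivation for M in the
image of D; L-linearity gives the rest. -/
theorem differential_sym {a : ℕ}
    {Δ : Matrix (Fin 2) (Fin 2) L →ₗ[L] Module.End L (MvPolynomial.homogeneousSubmodule (Fin 2) L a)}
    (hΔ : IsDifferential e (symRep e a) Δ) (M : Matrix (Fin 2) (Fin 2) L)
    (f : MvPolynomial.homogeneousSubmodule (Fin 2) L a) :
    (Δ M f : MvPolynomial (Fin 2) L) =
      ∑ j, (∑ i, M i j • MvPolynomial.X i) * MvPolynomial.pderiv j (f : MvPolynomial (Fin 2) L) := by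
  have : Infinite L := Infinite.of_injective _ (algebraMap ℚ_[p] L).injective
  induction M using mat_induction e with
  | h0 => simp
  | h2 M N hM hN =>
    rw [map_add, LinearMap.add_apply, Submodule.coe_add, hM, hN, ← Finset.sum_add_distrib]
    refine Finset.sum_congr rfl fun j _ => ?_
    rw [← add_mul, ← Finset.sum_add_distrib]
    simp [add_smul]
  | h1 c x =>
    rw [map_smul, LinearMap.smul_apply, Submodule.coe_smul]
    have key : (Δ (toMat e x) f : MvPolynomial (Fin 2) L) = ∑ j,
        (∑ i, toMat e x i j • MvPolynomial.X i) * MvPolynomial.pderiv j (f : MvPolynomial (Fin 2) L) := by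
      refine MvPolynomial.funext fun z => ?_
      let l : MvPolynomial.homogeneousSubmodule (Fin 2) L a →ₗ[L] L :=
        (MvPolynomial.aeval z).toLinearMap ∘ₗ Submodule.subtype _
      have hl : ∀ w : MvPolynomial.homogeneousSubmodule (Fin 2) L a,
          l w = MvPolynomial.eval z (w : MvPolynomial (Fin 2) L) := fun w => by
        simp [l, MvPolynomial.aeval_eq_eval]
      have h1 : SeqDeriv p (fun k : ℕ => l (symRep e a (expD e ((p : ℚ_[p]) ^ k • x)) f)) (l f)
        (l (Δ (toMat e x) f)) := hΔ.tendsto x f l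
      have h2 : ∀ j, SeqDeriv p
          (fun k : ℕ => ∑ i, toMat e (expD e ((p : ℚ_[p]) ^ k • x) : Dˣ) i j * z i) (z j)
          (∑ i, toMat e x i j * z i) := by
        intro j
        simp only [Fin.sum_univ_two]
        refine (((seqDeriv_toMat e x 0 j).mul (SeqDeriv.const (z 0))).add
          ((seqDeriv_toMat e x 1 j).mul (SeqDeriv.const (z 1)))).congr ?_ ?_
        · fin_cases j <;> simp [Matrix.one_apply]
        · simp
      have h3 := SeqDeriv.eval h2 (f : MvPolynomial (Fin 2) L)
      simp only [hl, coe_symRep, eval_subst] at h1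
      rw [h1.unique h3]
      simp [MvPolynomial.smul_eval]
    rw [key, Finset.smul_sum]
    refine Finset.sum_congr rfl fun j _ => ?_
    rw [← smul_mul_assoc, Finset.smul_sum]
    simp [smul_smul]

end Sym

/-! ### The map from Sym^a defined by a highest weight vector -/

section HighestMap
open scoped Nat

variable {K V : Type*} [Field K] [AddCommGroup V] [Module K V]

variable (K) in
/-- The standard basis of `sl₂`. -/
def matE : Matrix (Fin 2) (Fin 2) K := !![0, 1; 0, 0]

variable (K) in
/-- The standard basis of `sl₂`. -/
def matF : Matrix (Fin 2) (Fin 2) K := !![0, 0; 1, 0]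

variable (K) in
/-- The standard basis of `sl₂`. -/
def matH : Matrix (Fin 2) (Fin 2) K := !![1, 0; 0, -1]

theorem eq_of_trace_eq_zero {M : Matrix (Fin 2) (Fin 2) K} (hM : M.trace = 0) :
    M = M 0 1 • matE K + M 1 0 • matF K + M 0 0 • matH K := by
  rw [Matrix.trace_fin_two] at hM
  have h : M 1 1 = - M 0 0 := by linear_combination hM
  ext i j
  fin_cases i <;> fin_cases j <;> simp [matE, matF, matH, h]

theorem isSl2_of_lie {Δ : Matrix (Fin 2) (Fin 2) K →ₗ[K] Module.End K V}
    (h : ∀ M N, Δ (M * N - N * M) = Δ M * Δ N - Δ N * Δ M) :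
    IsSl2 (Δ (matE K)) (Δ (matF K)) (Δ (matH K)) := by
  have h1 : matH K * matE K - matE K * matH K = (2 : K) • matE K := by
    ext i j; fin_cases i <;> fin_cases j <;> simp [matE, matH]; norm_num
  have h2 : matH K * matF K - matF K * matH K = -(2 : K) • matF K := by
    ext i j; fin_cases i <;> fin_cases j <;> simp [matF, matH]; norm_num
  have h3 : matE K * matF K - matF K * matE K = matH K := by
    ext i j; fin_cases i <;> fin_cases j <;> simp [matE, matF, matH]
  have e1 := h (matH K) (matE K)
  have e2 := h (matH K) (matF K)
  have e3 := h (matE K) (matF K)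
  rw [h1, map_smul] at e1
  rw [h2, map_smul] at e2
  rw [h3] at e3
  refine ⟨fun v => ?_, fun v => ?_, fun v => ?_⟩
  · have := congrArg (fun T : Module.End K V => T v) e1
    simp only [LinearMap.smul_apply, LinearMap.sub_apply, Module.End.mul_apply] at this
    rw [this]; abel
  · have := congrArg (fun T : Module.End K V => T v) e2
    simp only [LinearMap.smul_apply, LinearMap.sub_apply, Module.End.mul_apply, neg_smul,
      LinearMap.neg_apply] at this
    rw [sub_eq_add_neg, this]; abel
  · have := congrArg (fun T : Module.End K V => T v) e3
    simp only [LinearMap.sub_apply, Module.End.mul_apply] at this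
    rw [this]; abel

/-- The linear map on polynomials attached to a vector `v`. -/
def monoMap (f : Module.End K V) (v : V) : MvPolynomial (Fin 2) K →ₗ[K] V :=
  -- For f = X₁ ∂₀ one has f^j X₀^a = (a!/i!) X₀^i X₁^j with i + j = a. Hence an equivariant map
  -- with X₀^a ↦ a! v must send X₀^i X₁^j to i! f^j v.
  (MvPolynomial.basisMonomials (Fin 2) K).constr K fun s => ((s 0) ! : K) • (f ^ (s 1)) v

theorem monoMap_monomial (f : Module.End K V) (v : V) (s : Fin 2 →₀ ℕ) (c : K) :
    monoMap f v (MvPolynomial.monomial s c) = (c * ((s 0) ! : K)) • (f ^ (s 1)) v := by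
  have h : MvPolynomial.monomial s c = c • MvPolynomial.basisMonomials (Fin 2) K s := by
    rw [MvPolynomial.coe_basisMonomials, MvPolynomial.smul_monomial, smul_eq_mul, mul_one]
  rw [h, map_smul, monoMap, Module.Basis.constr_basis, smul_smul]

theorem X_mul_pderiv_monomial (i j : Fin 2) (s : Fin 2 →₀ ℕ) (c : K) :
    MvPolynomial.X i * MvPolynomial.pderiv j (MvPolynomial.monomial s c) =
      MvPolynomial.monomial (Finsupp.single i 1 + (s - Finsupp.single j 1)) (c * s j) := by
  rw [MvPolynomial.pderiv_monomial, MvPolynomial.X, MvPolynomial.monomial_mul, one_mul]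

/-- The action of `M₂` on polynomials by derivations. -/
def polyDeriv (M : Matrix (Fin 2) (Fin 2) K) (q : MvPolynomial (Fin 2) K) : MvPolynomial (Fin 2) K :=
  ∑ j, (∑ i, M i j • MvPolynomial.X i) * MvPolynomial.pderiv j q

theorem polyDeriv_sum {ι : Type*} (M : Matrix (Fin 2) (Fin 2) K) (t : Finset ι)
    (q : ι → MvPolynomial (Fin 2) K) :
    polyDeriv M (∑ s ∈ t, q s) = ∑ s ∈ t, polyDeriv M (q s) := by
  unfold polyDeriv
  rw [Finset.sum_comm]
  simp only [map_sum, Finset.mul_sum]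

theorem polyDeriv_matE (q : MvPolynomial (Fin 2) K) :
    polyDeriv (matE K) q = MvPolynomial.X 0 * MvPolynomial.pderiv 1 q := by
  simp [polyDeriv, matE]

theorem polyDeriv_matF (q : MvPolynomial (Fin 2) K) :
    polyDeriv (matF K) q = MvPolynomial.X 1 * MvPolynomial.pderiv 0 q := by
  simp [polyDeriv, matF]

theorem polyDeriv_matH (q : MvPolynomial (Fin 2) K) :
    polyDeriv (matH K) q = MvPolynomial.X 0 * MvPolynomial.pderiv 0 q -
      MvPolynomial.X 1 * MvPolynomial.pderiv 1 q := by
  simp [polyDeriv, matH, sub_eq_add_neg]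

variable [CharZero K] [FiniteDimensional K V] {e f h : Module.End K V}

theorem monoMap_intertwines (H : IsSl2 e f h) {a : ℕ} {v : V} (hv : IsHighest e h a v)
    {q : MvPolynomial (Fin 2) K} (hq : q ∈ MvPolynomial.homogeneousSubmodule (Fin 2) K a) :
    monoMap f v (polyDeriv (matE K) q) = e (monoMap f v q) ∧
    monoMap f v (polyDeriv (matF K) q) = f (monoMap f v q) ∧
    monoMap f v (polyDeriv (matH K) q) = h (monoMap f v q) := by
  have key : ∀ (M : Matrix (Fin 2) (Fin 2) K) (T : Module.End K V),
      (∀ s ∈ expSet a, ∀ c, monoMap f v (polyDeriv M (MvPolynomial.monomial s c)) =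
        T (monoMap f v (MvPolynomial.monomial s c))) →
      monoMap f v (polyDeriv M q) = T (monoMap f v q) := by
    intro M T hT
    rw [sum_expSet hq, polyDeriv_sum, map_sum, map_sum, map_sum]
    exact Finset.sum_congr rfl fun s hs => hT s hs _
  refine ⟨key _ _ ?_, key _ _ ?_, key _ _ ?_⟩
  · intro s hs c
    rw [mem_expSet] at hs
    rw [polyDeriv_matE, X_mul_pderiv_monomial, monoMap_monomial, monoMap_monomial, map_smul]
    rcases Nat.eq_zero_or_pos (s 1) with h0 | h0
    · simp [h0, hv.1]
    · obtain ⟨k, hk⟩ := Nat.exists_eq_add_of_le' h0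
      rw [hk, H.e_f_pow_highest hv, smul_smul]
      have hs0 : (a : K) = s 0 + (k + 1) := by rw [← hs, hk]; push_cast; ring
      simp only [Finsupp.add_apply, Finsupp.tsub_apply, Finsupp.single_apply, hk]
      simp only [if_true, one_ne_zero, zero_ne_one, if_false, tsub_zero, add_tsub_cancel_right,
        zero_add]
      rw [add_comm 1 (s 0), Nat.factorial_succ, hs0]
      congr 1
      push_cast
      ring
  · intro s hs c
    rw [mem_expSet] at hs
    rw [polyDeriv_matF, X_mul_pderiv_monomial, monoMap_monomial, monoMap_monomial, map_smul]
    have hf1 : f ((f ^ (s 1)) v) = (f ^ (s 1 + 1)) v := by rw [pow_succ']; rfl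
    rw [hf1]
    rcases Nat.eq_zero_or_pos (s 0) with h0 | h0
    -- On X₁^a the derivation vanishes; the matching fact is f^(a+1) v = 0.
    · have h1 : s 1 = a := by omega
      rw [h1, H.f_pow_highest_eq_zero hv, h0]
      simp
    · obtain ⟨k, hk⟩ := Nat.exists_eq_add_of_le' h0
      simp only [Finsupp.add_apply, Finsupp.tsub_apply, Finsupp.single_apply, hk]
      simp only [if_true, one_ne_zero, zero_ne_one, if_false, tsub_zero, add_tsub_cancel_right,
        zero_add]
      rw [add_comm 1 (s 1), Nat.factorial_succ]
      congr 1
      push_cast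
      ring
  · intro s hs c
    rw [mem_expSet] at hs
    have hid : ∀ i : Fin 2, MvPolynomial.X i * MvPolynomial.pderiv i (MvPolynomial.monomial s c) =
        MvPolynomial.monomial s (c * s i) := by
      intro i
      rw [X_mul_pderiv_monomial]
      rcases Nat.eq_zero_or_pos (s i) with h0 | h0
      · simp [h0]
      · rw [add_tsub_cancel_of_le (Finsupp.single_le_iff.2 h0)]
    rw [polyDeriv_matH, hid, hid, map_sub, monoMap_monomial, monoMap_monomial, monoMap_monomial,
      map_smul, H.h_f_pow_highest hv, smul_smul, ← sub_smul]
    congr 1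
    rw [← hs]
    push_cast
    ring

end HighestMap

/-! ### Averaging projections over finitely many cosets -/

section Average

variable {K G V : Type*} [Field K] [CharZero K] [Group G] [AddCommGroup V] [Module K V]

/-- Averaging a projection over a finite set of cosets. -/
theorem exists_equivariant_projection (ρ : Representation K G V) (N : Subgroup G) [Finite (G ⧸ N)]
    {W : Submodule K V} (hW : ∀ g, ∀ v ∈ W, ρ g v ∈ W) {π : Module.End K V}
    (hN : ∀ n ∈ N, ρ n * π = π * ρ n) (h1 : ∀ v, π v ∈ W) (h2 : ∀ v ∈ W, π v = v) :
    ∃ π' : Module.End K V, (∀ g, ρ g * π' = π' * ρ g) ∧ (∀ v, π' v ∈ W) ∧ ∀ v ∈ W, π' v = v := by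
  have := Fintype.ofFinite (G ⧸ N)
  set T : G → Module.End K V := fun g => ρ g * π * ρ g⁻¹ with hT
  have hTN : ∀ g, ∀ n ∈ N, T (g * n) = T g := by
    intro g n hn
    simp only [hT, map_mul, mul_inv_rev]
    have : ρ n * π * ρ n⁻¹ = π := by
      rw [hN n hn, mul_assoc, ← map_mul, mul_inv_cancel, map_one, mul_one]
    calc ρ g * ρ n * π * (ρ n⁻¹ * ρ g⁻¹) = ρ g * (ρ n * π * ρ n⁻¹) * ρ g⁻¹ := by noncomm_ring
      _ = _ := by rw [this]
  have hTout : ∀ g : G, T ((g : G ⧸ N).out) = T g := by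
    intro g
    obtain ⟨n, hn⟩ := QuotientGroup.mk_out_eq_mul N g
    rw [hn, hTN g n n.2]
  have hcard : (Fintype.card (G ⧸ N) : K) ≠ 0 := by exact_mod_cast Fintype.card_ne_zero
  set S : Module.End K V := ∑ q : G ⧸ N, T q.out with hS
  have hTW : ∀ g v, T g v ∈ W := fun g v => hW g _ (h1 _)
  have hTW2 : ∀ g, ∀ v ∈ W, T g v = v := by
    intro g v hv
    change ρ g (π (ρ g⁻¹ v)) = v
    rw [h2 _ (hW _ _ hv), ← Module.End.mul_apply, ← map_mul, mul_inv_cancel, map_one]; rfl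
  refine ⟨(Fintype.card (G ⧸ N) : K)⁻¹ • S, ?_, ?_, ?_⟩
  · intro g
    -- Conjugation by g permutes the summands, which depend only on the coset.
    have hconj : ρ g * S * ρ g⁻¹ = S := by
      rw [hS, Finset.mul_sum, Finset.sum_mul]
      refine Fintype.sum_equiv (MulAction.toPerm g) _ _ fun q => ?_
      have e1 : ρ g * T q.out * ρ g⁻¹ = T (g * q.out) := by
        simp only [hT, map_mul, mul_inv_rev]; noncomm_ring
      rw [e1, ← hTout]
      congr 2
      rw [← smul_eq_mul, ← MulAction.Quotient.smul_mk, QuotientGroup.out_eq']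
      rfl
    have : ρ g * S = S * ρ g := by
      conv_rhs => rw [← hconj]
      rw [mul_assoc, ← map_mul, inv_mul_cancel, map_one, mul_one]
    rw [mul_smul_comm, smul_mul_assoc, this]
  · intro v
    rw [LinearMap.smul_apply, hS, LinearMap.sum_apply]
    exact W.smul_mem _ (W.sum_mem fun q _ => hTW _ _)
  · intro v hv
    rw [LinearMap.smul_apply, hS, LinearMap.sum_apply, Finset.sum_congr rfl fun q _ => hTW2 _ v hv,
      Finset.sum_const, Finset.card_univ, ← Nat.cast_smul_eq_nsmul K, smul_smul,
      inv_mul_cancel₀ hcard, one_smul]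

theorem isSemisimpleRepresentation_of_projections (ρ : Representation K G V)
    (h : ∀ W : Subrepresentation ρ, ∃ π : Module.End K V, (∀ g, ρ g * π = π * ρ g) ∧
      (∀ v, π v ∈ W.toSubmodule) ∧ ∀ v ∈ W.toSubmodule, π v = v) :
    ρ.IsSemisimpleRepresentation := by
  refine ⟨fun W => ?_⟩
  obtain ⟨π, h1, h2, h3⟩ := h W
  let C : Subrepresentation ρ := ⟨LinearMap.ker π, fun g v hv => by
    rw [LinearMap.mem_ker] at hv ⊢
    have := congrArg (fun T : Module.End K V => T v) (h1 g)
    simp only [Module.End.mul_apply] at this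
    rw [← this, hv, map_zero]⟩
  refine ⟨C, ⟨?_, ?_⟩⟩
  · rw [disjoint_iff]
    apply Subrepresentation.toSubmodule_injective
    change W.toSubmodule ⊓ LinearMap.ker π = ⊥
    rw [eq_bot_iff]
    rintro v ⟨hv1, hv2⟩
    rw [Submodule.mem_bot, ← h3 v hv1]
    exact hv2
  · rw [codisjoint_iff]
    apply Subrepresentation.toSubmodule_injective
    change W.toSubmodule ⊔ LinearMap.ker π = ⊤
    refine Submodule.eq_top_iff'.2 fun v => ?_
    refine Submodule.mem_sup.2 ⟨π v, h2 v, v - π v, ?_, by abel⟩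
    rw [LinearMap.mem_ker, map_sub, h3 _ (h2 v), sub_self]

end Average

/-! ### Semisimplicity of representations of `Dˣ` with a central character -/

section Semisimple
open Filter Topology NormedSpace

variable {p : ℕ} [Fact p.Prime] {L D : Type*} [NormedField L] [NormedAlgebra ℚ_[p] L]
  [FiniteDimensional ℚ_[p] L] [DivisionRing D] [Algebra ℚ_[p] D] [FiniteDimensional ℚ_[p] D]
  (e : L ⊗[ℚ_[p]] D ≃ₐ[L] Matrix (Fin 2) (Fin 2) L)
  [TopologicalSpace D] [IsModuleTopology ℚ_[p] D]

/-- The inclusion `ℚ_pˣ → Dˣ`. -/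
abbrev centerMap (p : ℕ) [Fact p.Prime] (D : Type*) [DivisionRing D] [Algebra ℚ_[p] D] :
    ℚ_[p]ˣ →* Dˣ := Units.map (algebraMap ℚ_[p] D : ℚ_[p] →* D)

include e in
-- Units are open in the complete normed ring `Img e`, and this is carried over to D.
theorem image_val_mem_nhds {g : Dˣ} {U : Set Dˣ} (hU : U ∈ 𝓝 g) :
    {d : D | ∃ u ∈ U, (u : D) = d} ∈ 𝓝 (g : D) := by
  set g' : (Img e)ˣ := Units.map (matEquiv e).toMonoidHom g
  set ψ : (Img e)ˣ →* Dˣ := Units.map (matEquiv e).symm.toMonoidHom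
  have hψ : Continuous ψ := (continuous_matEquiv_symm e).units_map _
  have hψg : ψ g' = g := by
    apply Units.ext
    exact (matEquiv e).symm_apply_apply _
  have h1 : ψ ⁻¹' U ∈ 𝓝 g' := hψ.continuousAt.preimage_mem_nhds (by rwa [hψg])
  have h2 := Units.isOpenEmbedding_val.isOpenMap.image_mem_nhds h1
  have h3 := (continuous_matEquiv e).continuousAt.preimage_mem_nhds (x := (g : D)) h2
  refine mem_of_superset h3 ?_
  rintro d ⟨u, hu, hud⟩
  refine ⟨ψ u, hu, ?_⟩
  change (matEquiv e).symm (u : Img e) = d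
  rw [hud, AlgEquiv.symm_apply_apply]

include e in
/-- An open subgroup of `Dˣ` containing the centre has finite index. -/
theorem finite_quotient {N : Subgroup Dˣ} (hN : (N : Set Dˣ) ∈ 𝓝 1)
    (hc : ∀ x, centerMap p D x ∈ N) : Finite (Dˣ ⧸ N) := by
  have : IsTopologicalAddGroup D := IsModuleTopology.topologicalAddGroup ℚ_[p] D
  have : ContinuousSMul ℚ_[p] D := IsModuleTopology.toContinuousSMul ℚ_[p] D
  set n := Module.finrank ℚ_[p] D
  set c : D ≃ₗ[ℚ_[p]] (Fin n → ℚ_[p]) := (Module.finBasis ℚ_[p] D).equivFun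
  have hcs : Continuous c.symm := LinearMap.continuous_of_finiteDimensional c.symm.toLinearMap
  have hne : ∀ y ∈ Metric.sphere (0 : Fin n → ℚ_[p]) 1, c.symm y ≠ 0 := by
    intro y hy h0
    rw [LinearEquiv.map_eq_zero_iff] at h0
    rw [h0] at hy
    simp at hy
  have : IsTopologicalRing D := IsModuleTopology.isTopologicalRing ℚ_[p] D
  classical
  set gy : (Fin n → ℚ_[p]) → Dˣ := fun y => if h : c.symm y = 0 then 1 else Units.mk0 _ h
  have hgy : ∀ y ∈ Metric.sphere (0 : Fin n → ℚ_[p]) 1, (gy y : D) = c.symm y := by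
    intro y hy
    simp only [gy, dif_neg (hne y hy), Units.val_mk0]
  -- Each point of the compact unit sphere of D ≅ ℚ_p^n has a neighbourhood contained in one coset
  -- of N, so finitely many cosets cover the sphere.
  obtain ⟨t, ht, hcov⟩ := (isCompact_sphere (0 : Fin n → ℚ_[p]) 1).elim_nhds_subcover
    (fun y => c.symm ⁻¹' {d : D | ∃ u : Dˣ, (gy y)⁻¹ * u ∈ N ∧ (u : D) = d}) (by
      intro y hy
      refine hcs.continuousAt.preimage_mem_nhds ?_
      rw [← hgy y hy]
      refine image_val_mem_nhds e (U := {u : Dˣ | (gy y)⁻¹ * u ∈ N}) ?_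
      have hcont : Continuous fun u : Dˣ => (gy y)⁻¹ * u := continuous_const.mul continuous_id
      refine hcont.continuousAt.preimage_mem_nhds ?_
      rw [inv_mul_cancel]
      exact hN)
  have hsurj : Function.Surjective (fun y : t => (QuotientGroup.mk (gy y.1) : Dˣ ⧸ N)) := by
    intro q
    obtain ⟨g, rfl⟩ := QuotientGroup.mk_surjective q
    have hg0 : c (g : D) ≠ 0 := by
      rw [Ne, LinearEquiv.map_eq_zero_iff]; exact g.ne_zero
    have hne' : Nonempty (Fin n) := by
      by_contra hcon
      rw [not_nonempty_iff] at hcon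
      exact hg0 (Subsingleton.elim _ _)
    obtain ⟨i, -, hi⟩ := Finset.exists_max_image Finset.univ (fun i => ‖c (g : D) i‖)
      Finset.univ_nonempty
    have hnorm : ‖c (g : D)‖ = ‖c (g : D) i‖ :=
      le_antisymm ((pi_norm_le_iff_of_nonneg (norm_nonneg _)).2 fun j => hi j (Finset.mem_univ j))
        (norm_le_pi_norm _ i)
    have hl0 : c (g : D) i ≠ 0 := by
      rw [← norm_ne_zero_iff, ← hnorm, norm_ne_zero_iff]; exact hg0
    set l : ℚ_[p]ˣ := Units.mk0 _ hl0
    -- Dividing by a coordinate of largest norm, a central scalar, moves g to the sphere without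
    -- changing its coset.
    have hy : ((l⁻¹ : ℚ_[p]ˣ) : ℚ_[p]) • c (g : D) ∈ Metric.sphere (0 : Fin n → ℚ_[p]) 1 := by
      rw [mem_sphere_zero_iff_norm, norm_smul, hnorm, Units.val_inv_eq_inv_val, norm_inv]
      exact inv_mul_cancel₀ (norm_ne_zero_iff.2 hl0)
    have hmem := hcov hy
    simp only [Set.mem_iUnion] at hmem
    obtain ⟨x, hx, u, hu, hux⟩ := hmem
    refine ⟨⟨x, hx⟩, ?_⟩
    rw [QuotientGroup.eq]
    have hug : u = centerMap p D l⁻¹ * g := by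
      apply Units.ext
      rw [hux, map_smul, LinearEquiv.symm_apply_apply, Units.val_mul, Algebra.smul_def]
      rfl
    have hcomm : g = u * centerMap p D l := by
      rw [hug]
      apply Units.ext
      have hcm : ((centerMap p D l⁻¹ : Dˣ) : D) * g = g * (centerMap p D l⁻¹ : Dˣ) :=
        Algebra.commutes _ _
      rw [Units.val_mul, Units.val_mul, hcm, mul_assoc, ← Units.val_mul, ← map_mul, inv_mul_cancel,
        map_one, Units.val_one, mul_one]
    rw [hcomm, ← mul_assoc]
    exact N.mul_mem hu (hc l)
  exact Finite.of_surjective _ hsurj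

/-- Near `1`, an element of `Dˣ` is the product of the exponential of an element of trace zero and a
central element. -/
theorem eventually_exists_split {N₀ : Set D} (h₀ : N₀ ∈ 𝓝 0) {N₁ : Set ℚ_[p]ˣ} (h₁ : N₁ ∈ 𝓝 1) :
    ∀ᶠ u in 𝓝 (1 : Dˣ), ∃ x ∈ N₀, ∃ w ∈ N₁, (toMat e x).trace = 0 ∧
      u = expD e x * centerMap p D w := by
  have : IsTopologicalAddGroup D := IsModuleTopology.topologicalAddGroup ℚ_[p] D
  have : ContinuousSMul ℚ_[p] D := IsModuleTopology.toContinuousSMul ℚ_[p] D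
  have : CharZero L := charZero_of_injective_algebraMap (algebraMap ℚ_[p] L).injective
  obtain ⟨N, hN, hadd⟩ := exists_expD_add e
  -- The trace of left multiplication on D is twice the reduced trace, so τ is half the reduced
  -- trace and x - τ(x) has trace zero.
  let τ : D →ₗ[ℚ_[p]] ℚ_[p] := (4⁻¹ : ℚ_[p]) • (LinearMap.trace ℚ_[p] D ∘ₗ LinearMap.mul ℚ_[p] D)
  have hτ : ∀ x, algebraMap ℚ_[p] L (τ x) = 2⁻¹ * (toMat e x).trace := by
    intro x
    have h := trace_split e x
    have h' : τ x = 4⁻¹ * LinearMap.trace ℚ_[p] D (LinearMap.mulLeft ℚ_[p] x) := rfl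
    rw [h', map_mul, h, map_inv₀, map_ofNat, toMat_apply]
    ring
  have hτc : Continuous τ := IsModuleTopology.continuous_of_linearMap τ
  have t1 : Tendsto τ (𝓝 0) (𝓝 0) := by simpa using hτc.tendsto 0
  have halg : Continuous (algebraMap ℚ_[p] D) := continuous_algebraMap ℚ_[p] D
  have t2 : Tendsto (fun x => algebraMap ℚ_[p] D (τ x)) (𝓝 0) (𝓝 0) := by
    have := (halg.tendsto 0).comp t1
    rwa [map_zero] at this
  have t3 : Tendsto (fun x => x - algebraMap ℚ_[p] D (τ x)) (𝓝 0) (𝓝 0) := by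
    simpa using tendsto_id.sub t2
  have hX : ∀ᶠ x in 𝓝 (0 : D), x - algebraMap ℚ_[p] D (τ x) ∈ N₀ ∧
      x - algebraMap ℚ_[p] D (τ x) ∈ N ∧ algebraMap ℚ_[p] D (τ x) ∈ N ∧
      expUnit (τ x) ∈ N₁ ∧ expD e (algebraMap ℚ_[p] D (τ x)) = centerMap p D (expUnit (τ x)) := by
    filter_upwards [t3 h₀, t3 hN, t2 hN, t1 (tendsto_expUnit p ℚ_[p] h₁),
      t1.eventually (eventually_expD_algebraMap e)] with x a b c d f
    exact ⟨a, b, c, d, f⟩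
  filter_upwards [eventually_mem_expD_image e hX] with u hu
  obtain ⟨x, ⟨a, b, c, d, f⟩, rfl⟩ := hu
  refine ⟨_, a, _, d, ?_, ?_⟩
  · rw [map_sub, Matrix.trace_sub, AlgHom.commutes, Matrix.algebraMap_eq_diagonal,
      Matrix.trace_diagonal]
    simp [hτ]
  · rw [← f, ← hadd _ b _ c (Algebra.commutes _ _).symm, sub_add_cancel]

theorem eq_of_forall_dual {K V : Type*} [Field K] [AddCommGroup V] [Module K V] {v w : V}
    (h : ∀ l : V →ₗ[K] K, l v = l w) : v = w := by
  rw [← sub_eq_zero, ← Module.forall_dual_apply_eq_zero_iff K]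
  intro l
  rw [map_sub, h, sub_self]

variable {e} {V V' : Type*} [AddCommGroup V] [Module L V] [AddCommGroup V'] [Module L V']
  {σ : Representation L Dˣ V} {σ' : Representation L Dˣ V'}
  {Δ : Matrix (Fin 2) (Fin 2) L →ₗ[L] Module.End L V}
  {Δ' : Matrix (Fin 2) (Fin 2) L →ₗ[L] Module.End L V'}

/-- A linear map intertwining the actions of `sl₂` intertwines the actions of small elements of
reduced norm `1`. -/
theorem IsDifferential.intertwines (hΔ : IsDifferential e σ Δ) (hΔ' : IsDifferential e σ' Δ') :
    ∀ᶠ x in 𝓝 (0 : D), (toMat e x).trace = 0 → ∀ φ : V →ₗ[L] V',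
      (∀ M, M.trace = 0 → ∀ v, φ (Δ M v) = Δ' M (φ v)) →
      ∀ v, φ (σ (expD e x) v) = σ' (expD e x) (φ v) := by
  filter_upwards [hΔ.hasSum, hΔ'.hasSum] with x hx hx' htr φ hφ v
  refine eq_of_forall_dual (K := L) fun l => ?_
  have h1 := hx v (l ∘ₗ φ)
  have h2 := hx' (φ v) l
  -- Both sides are exponential series, and φ matches them term by term.
  refine h1.unique (h2.congr_fun fun n => ?_)
  rw [LinearMap.comp_apply]
  congr 2
  induction n with
  | zero => simp
  | succ n ih => rw [pow_succ', pow_succ', Module.End.mul_apply, Module.End.mul_apply, hφ _ htr, ih]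

theorem IsDifferential.isSl2 (hΔ : IsDifferential e σ Δ) :
    IsSl2 (Δ (matE L)) (Δ (matF L)) (Δ (matH L)) := isSl2_of_lie hΔ.lie

/-- Subrepresentations are stable under the differential. -/
theorem IsDifferential.stable (hΔ : IsDifferential e σ Δ) {W : Submodule L V}
    (hW : ∀ g, ∀ v ∈ W, σ g v ∈ W) (M : Matrix (Fin 2) (Fin 2) L) : ∀ v ∈ W, Δ M v ∈ W := by
  intro v hv
  induction M using mat_induction e with
  | h0 => simp
  | h2 M N hM hN => rw [map_add]; exact W.add_mem hM hN
  | h1 a x =>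
    rw [map_smul]
    refine W.smul_mem _ ?_
    by_contra hcon
    -- A functional vanishing on W kills all the difference quotients, hence also their limit.
    obtain ⟨l, hl, hlW⟩ := Submodule.exists_le_ker_of_notMem hcon
    have h1 := hΔ.tendsto x v l
    have h2 : ∀ w ∈ W, l w = 0 := fun w hw => hlW hw
    refine hl (tendsto_nhds_unique h1 ?_)
    simp [h2 v hv, h2 _ (hW _ v hv)]

variable (e) in
include e in
-- A subrepresentation is sl₂-stable, so it has an sl₂-equivariant projection π. The averaging lemma
-- turns π into a `Dˣ`-equivariant one.
theorem isSemisimpleRepresentation_of_continuous [FiniteDimensional L V]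
    (hσ : ∀ (v : V) (l : V →ₗ[L] L), Continuous fun g => l (σ g v))
    (hζ : ∀ x : ℚ_[p]ˣ, ∃ c : L, ∀ v, σ (centerMap p D x) v = c • v) :
    σ.IsSemisimpleRepresentation := by
  have : CharZero L := charZero_of_injective_algebraMap (algebraMap ℚ_[p] L).injective
  obtain ⟨Δ, hΔ⟩ := exists_isDifferential e σ hσ
  refine isSemisimpleRepresentation_of_projections σ fun W => ?_
  have hW : ∀ g, ∀ v ∈ W.toSubmodule, σ g v ∈ W.toSubmodule :=
    fun g v hv => W.apply_mem_toSubmodule g hv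
  have hst : IsStable (Δ (matE L)) (Δ (matF L)) (Δ (matH L)) W.toSubmodule :=
    ⟨hΔ.stable hW _, hΔ.stable hW _, hΔ.stable hW _⟩
  obtain ⟨π, ⟨hE, hF, hH⟩, h1, h2⟩ := hΔ.isSl2.exists_projection hst
  -- The commutant of π contains the centre, which acts by scalars, and the exponentials of small
  -- trace zero elements; hence it is a neighbourhood of 1 and has finite index.
  let N : Subgroup Dˣ :=
    { carrier := {g | σ g * π = π * σ g}
      mul_mem' := by
        intro g g' hg hg'
        simp only [Set.mem_ofPred_eq, map_mul] at hg hg' ⊢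
        rw [mul_assoc, hg', ← mul_assoc, hg, mul_assoc]
      one_mem' := by simp
      inv_mem' := by
        intro g hg
        simp only [Set.mem_ofPred_eq] at hg ⊢
        have h : σ g⁻¹ * σ g = 1 := by rw [← map_mul, inv_mul_cancel, map_one]
        have h' : σ g * σ g⁻¹ = 1 := by rw [← map_mul, mul_inv_cancel, map_one]
        calc σ g⁻¹ * π = σ g⁻¹ * π * (σ g * σ g⁻¹) := by rw [h', mul_one]
          _ = σ g⁻¹ * (π * σ g) * σ g⁻¹ := by noncomm_ring
          _ = (σ g⁻¹ * σ g) * π * σ g⁻¹ := by rw [← hg]; noncomm_ring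
          _ = π * σ g⁻¹ := by rw [h, one_mul] }
  have hcen : ∀ x, centerMap p D x ∈ N := by
    intro x
    obtain ⟨c, hc⟩ := hζ x
    change σ (centerMap p D x) * π = π * σ (centerMap p D x)
    ext v
    simp only [Module.End.mul_apply, hc, map_smul]
  have hNn : (N : Set Dˣ) ∈ 𝓝 1 := by
    have hint := hΔ.intertwines hΔ
    filter_upwards [eventually_exists_split e hint (univ_mem : Set.univ ∈ 𝓝 (1 : ℚ_[p]ˣ))]
      with u hu
    obtain ⟨x, hx, w, -, htr, rfl⟩ := hu
    refine N.mul_mem ?_ (hcen w)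
    change σ _ * π = π * σ _
    ext v
    refine (hx htr π ?_ v).symm
    intro M hM v
    rw [eq_of_trace_eq_zero hM]
    have e1 := fun v => congrArg (fun T : Module.End L V => T v) hE.eq
    have e2 := fun v => congrArg (fun T : Module.End L V => T v) hF.eq
    have e3 := fun v => congrArg (fun T : Module.End L V => T v) hH.eq
    simp only [Module.End.mul_apply] at e1 e2 e3
    simp only [map_add, map_smul, LinearMap.add_apply, LinearMap.smul_apply, e1, e2, e3]
  have := finite_quotient e hNn hcen
  exact exists_equivariant_projection σ N hW (fun n hn => hn) h1 h2

end Semisimple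

/-! ### Irreducible subrepresentations and finite direct sums -/

section IrreducibleSub

variable {K G V : Type*} [Field K] [Group G] [AddCommGroup V] [Module K V]

/-- A representation that is isomorphic to an atom among the subrepresentations of `σ` is
irreducible. -/
theorem isIrreducible_of_isAtom {W : Type*} [AddCommGroup W] [Module K W]
    {σ : Representation K G V} {τ : Representation K G W} {S : Subrepresentation σ} (hS : IsAtom S)
    {ι : W →ₗ[K] V} (hι : Function.Injective ι) (hτ : ∀ g w, ι (τ g w) = σ g (ι w))
    (hrange : LinearMap.range ι = S.toSubmodule) : τ.IsIrreducible := by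
  let push : Subrepresentation τ → Subrepresentation σ := fun T =>
    ⟨T.toSubmodule.map ι, by
      rintro g _ ⟨w, hw, rfl⟩
      exact ⟨τ g w, T.apply_mem_toSubmodule g hw, hτ g w⟩⟩
  have hle : ∀ T, push T ≤ S := fun T =>
    (LinearMap.map_le_range : T.toSubmodule.map ι ≤ _).trans hrange.le
  refine { exists_pair_ne := ⟨⊥, ⊤, fun h => hS.1 ?_⟩, eq_bot_or_eq_top := fun T => ?_ }
  · apply Subrepresentation.toSubmodule_injective
    rw [← hrange]
    have h' : (⊥ : Submodule K _) = ⊤ := congrArg Subrepresentation.toSubmodule h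
    rw [LinearMap.range_eq_map, ← h', Submodule.map_bot]
    rfl
  · rcases hS.le_iff.1 (hle T) with h | h
    · left
      apply Subrepresentation.toSubmodule_injective
      apply Submodule.map_injective_of_injective hι
      rw [show (⊥ : Subrepresentation τ).toSubmodule = ⊥ from rfl, Submodule.map_bot]
      exact congrArg Subrepresentation.toSubmodule h
    · right
      apply Subrepresentation.toSubmodule_injective
      apply Submodule.map_injective_of_injective hι
      rw [show (⊤ : Subrepresentation τ).toSubmodule = ⊤ from rfl, Submodule.map_top, hrange]
      exact congrArg Subrepresentation.toSubmodule h

/-- A nonzero finite-dimensional representation contains an irreducible one. -/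
theorem exists_irreducible_sub [FiniteDimensional K V] [Nontrivial V] (σ : Representation K G V) :
    ∃ (d : ℕ) (τ : Representation K G (Fin d → K)) (ι : (Fin d → K) →ₗ[K] V),
      τ.IsIrreducible ∧ Function.Injective ι ∧ ∀ g w, ι (τ g w) = σ g (ι w) := by
  have hmono : StrictMono (Subrepresentation.toSubmodule : Subrepresentation σ → Submodule K V) :=
    fun _ _ h => h
  have : WellFoundedLT (Subrepresentation σ) := hmono.wellFoundedLT
  have hne : (⊤ : Subrepresentation σ) ≠ ⊥ := fun h =>
    top_ne_bot (α := Submodule K V) (congrArg Subrepresentation.toSubmodule h)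
  obtain ⟨S, hS, -⟩ := (eq_bot_or_exists_atom_le (⊤ : Subrepresentation σ)).resolve_left hne
  let c : S.toSubmodule ≃ₗ[K] (Fin (Module.finrank K S.toSubmodule) → K) :=
    (Module.finBasis K S.toSubmodule).equivFun
  let τ : Representation K G (Fin (Module.finrank K S.toSubmodule) → K) :=
    { toFun := fun g => c.toLinearMap ∘ₗ S.toRepresentation g ∘ₗ c.symm.toLinearMap
      map_one' := by ext; simp
      map_mul' := fun g h => by ext; simp }
  let ι := S.toSubmodule.subtype ∘ₗ c.symm.toLinearMap
  have hι : Function.Injective ι := Subtype.val_injective.comp c.symm.injective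
  have hτ : ∀ g w, ι (τ g w) = σ g (ι w) := by
    intro g w
    change ((c.symm (c (S.toRepresentation g (c.symm w))) : S.toSubmodule) : V) = _
    rw [LinearEquiv.symm_apply_apply]
    rfl
  refine ⟨_, τ, ι, isIrreducible_of_isAtom hS hι hτ ?_, hι, hτ⟩
  rw [LinearMap.range_comp, LinearEquiv.range, Submodule.map_top, Submodule.range_subtype]

/-- A finite-dimensional semisimple representation is a finite direct sum of irreducible ones. -/
theorem exists_directSum_irreducible [FiniteDimensional K V] (σ : Representation K G V)
    (hσ : σ.IsSemisimpleRepresentation) :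
    ∃ (n : ℕ) (S : Fin n → Subrepresentation σ), (∀ i, (S i).toRepresentation.IsIrreducible) ∧
      Nonempty (σ.Equiv (Representation.directSum fun i => (S i).toRepresentation)) := by
  have := σ.isSemisimpleRepresentation_iff_isSemisimpleModule_asModule.1 hσ
  have : Module.Finite K σ.asModule := inferInstanceAs (Module.Finite K V)
  have : Module.Finite (MonoidAlgebra K G) σ.asModule := Module.Finite.of_restrictScalars_finite K _ _
  obtain ⟨n, S, E, hS⟩ :=
    IsSemisimpleModule.exists_linearEquiv_fin_dfinsupp (MonoidAlgebra K G) σ.asModule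
  -- Linearity over `single g t` records scalars and group elements together: g = 1 gives
  -- K-linearity, t = 1 equivariance.
  have hE : ∀ (g : G) (t : K) (v : σ.asModule) (i : Fin n),
      ((E (t • σ g v : V) i : σ.asModule) : V) = t • σ g (E v i : σ.asModule) := by
    intro g t v i
    have h1 := E.map_smul (MonoidAlgebra.single g t) v
    rw [σ.single_smul] at h1
    refine (congrArg (fun x : Π₀ i : Fin n, S i => ((x i : σ.asModule) : V)) h1).trans ?_
    exact σ.single_smul t g (E v i : σ.asModule)
  refine ⟨n, fun i => Subrepresentation.ofSubmodule' (S i), fun i => ?_, ⟨?_⟩⟩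
  · have hat : IsAtom (Subrepresentation.ofSubmodule' (S i)) :=
      (OrderIso.isAtom_iff Subrepresentation.subrepresentationSubmoduleOrderIso.symm _).2
        (isSimpleModule_iff_isAtom.1 (hS i))
    exact isIrreducible_of_isAtom hat (Submodule.subtype_injective _) (fun g w => rfl)
      (Submodule.range_subtype _)
  · let F : V →ₗ[K] DirectSum (Fin n) fun i => (Subrepresentation.ofSubmodule' (S i)).toSubmodule :=
      { toFun := fun v => (E v : Π₀ i : Fin n, S i)
        map_add' := fun v w => E.map_add v w
        map_smul' := fun c v => by
          refine DFinsupp.ext fun i => Subtype.ext ?_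
          have := hE 1 c v i
          rw [map_one] at this
          exact this }
    refine Representation.IntertwiningMap.ofBijective (f := ⟨F, fun g => LinearMap.ext fun v => ?_⟩)
      E.bijective
    refine DFinsupp.ext fun i => Subtype.ext ?_
    have := hE g 1 v i
    rw [one_smul, one_smul] at this
    exact this

end IrreducibleSub

/-! ### Injectivity of evaluation on a multiplicity space -/

section Multiplicity

variable {K V W B : Type*} [Field K] [CharZero K] [AddCommGroup V] [Module K V]
  [AddCommGroup W] [Module K W] [AddCommGroup B] [Module K B]
  {e f h : Module.End K V} {e' f' : Module.End K B}

/-- Evaluation is injective on `V ⊗ W`, when `W` consists of `sl₂`-maps from `V`, and `V` is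
irreducible. -/
theorem lift_flip_injective (H : IsSl2 e f h) {a : ℕ} {m : V} (hm : IsHighest e h a m)
    (hspan : ⊤ ≤ Submodule.span K (Set.range fun i : Fin (a + 1) => (f ^ (i : ℕ)) m))
    {ι : W →ₗ[K] V →ₗ[K] B} (hι : Function.Injective ι)
    (he : ∀ w v, ι w (e v) = e' (ι w v)) (hf : ∀ w v, ι w (f v) = f' (ι w v)) :
    Function.Injective (TensorProduct.lift ι.flip) := by
  have hen : ∀ n w v, ι w ((e ^ n) v) = (e' ^ n) (ι w v) := by
    intro n w v
    induction n with
    | zero => rfl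
    | succ n ih => rw [pow_succ', pow_succ', Module.End.mul_apply, Module.End.mul_apply, he, ih]
  have hfn : ∀ n w v, ι w ((f ^ n) v) = (f' ^ n) (ι w v) := by
    intro n w v
    induction n with
    | zero => rfl
    | succ n ih => rw [pow_succ', pow_succ', Module.End.mul_apply, Module.End.mul_apply, hf, ih]
  have hzero : ∀ w, ι w m = 0 → w = 0 := by
    intro w hw
    refine hι ?_
    rw [map_zero]
    refine LinearMap.ext_on (top_le_iff.1 hspan) ?_
    rintro _ ⟨i, rfl⟩
    simp only [hfn, hw, map_zero, LinearMap.zero_apply]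
  have key : ∀ n ≤ a + 1, ∀ w : ℕ → W,
      TensorProduct.lift ι.flip (∑ i ∈ Finset.range n, (f ^ i) m ⊗ₜ[K] w i) = 0 →
      ∀ i < n, w i = 0 := by
    intro n
    induction n with
    | zero => intro _ _ _ i hi; omega
    | succ n ih =>
      intro hn w hw
      have hwn : w n = 0 := by
        apply hzero
        -- e^n kills f^i m for i < n and sends f^n m to a nonzero multiple of m, so only the top
        -- coefficient survives.
        have h1 := congrArg (e' ^ n) hw
        simp only [map_sum, TensorProduct.lift.tmul, LinearMap.flip_apply, ← hen, map_zero] at h1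
        rw [Finset.sum_range_succ, Finset.sum_eq_zero, zero_add, H.e_pow_f_pow_highest hm,
          map_smul, smul_eq_zero] at h1
        · refine h1.resolve_left (mul_ne_zero ?_ (eval_fallPoly_ne_zero (by omega)))
          exact_mod_cast n.factorial_ne_zero
        · intro i hi
          rw [H.e_pow_f_pow_highest_of_lt hm (Finset.mem_range.1 hi), map_zero]
      rw [Finset.sum_range_succ, hwn, TensorProduct.tmul_zero, add_zero] at hw
      intro i hi
      rcases Nat.lt_succ_iff_lt_or_eq.1 hi with h | rfl
      · exact ih (by omega) w hw i h
      · exact hwn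
  have hform : ∀ t : V ⊗[K] W, ∃ w : ℕ → W,
      t = ∑ i ∈ Finset.range (a + 1), (f ^ i) m ⊗ₜ[K] w i := by
    intro t
    induction t with
    | zero => exact ⟨0, by simp⟩
    | add x y hx hy =>
      obtain ⟨w, rfl⟩ := hx
      obtain ⟨w', rfl⟩ := hy
      exact ⟨w + w', by simp [TensorProduct.tmul_add, Finset.sum_add_distrib]⟩
    | tmul v w =>
      obtain ⟨c, rfl⟩ := (Submodule.mem_span_range_iff_exists_fun K).1 (hspan (Submodule.mem_top : v ∈ ⊤))
      refine ⟨fun i => (if hi : i < a + 1 then c ⟨i, hi⟩ else 0) • w, ?_⟩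
      rw [TensorProduct.sum_tmul, Finset.sum_range]
      refine Finset.sum_congr rfl fun i _ => ?_
      simp only [dif_pos i.2, Fin.eta, TensorProduct.smul_tmul]
  rw [← LinearMap.ker_eq_bot, eq_bot_iff]
  intro t ht
  obtain ⟨w, rfl⟩ := hform t
  have := key _ le_rfl w ht
  rw [Submodule.mem_bot]
  refine Finset.sum_eq_zero fun i hi => ?_
  rw [this i (Finset.mem_range.1 hi), TensorProduct.tmul_zero]

end Multiplicity

/-! ### Sym^a is generated by its highest weight vector X₀^a -/

section SymHighest

variable {p : ℕ} [Fact p.Prime] {L D : Type*} [NormedField L] [NormedAlgebra ℚ_[p] L]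
  [FiniteDimensional ℚ_[p] L] [DivisionRing D] [Algebra ℚ_[p] D] [FiniteDimensional ℚ_[p] D]
  {e : L ⊗[ℚ_[p]] D ≃ₐ[L] Matrix (Fin 2) (Fin 2) L}
  [TopologicalSpace D] [IsModuleTopology ℚ_[p] D]

/-- The monomial `X₀ ^ i X₁ ^ j` of degree `a = i + j`. -/
def symMono (K : Type*) [Field K] {a : ℕ} (i j : ℕ) (h : i + j = a) :
    MvPolynomial.homogeneousSubmodule (Fin 2) K a :=
  ⟨MvPolynomial.monomial (Finsupp.single 0 i + Finsupp.single 1 j) 1, by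
    subst h
    refine MvPolynomial.isHomogeneous_monomial _ ?_
    simp [Finsupp.degree_eq_sum, Fin.sum_univ_two]⟩

theorem span_symMono (K : Type*) [Field K] (a : ℕ) :
    ⊤ ≤ Submodule.span K {x | ∃ i j, ∃ h : i + j = a, symMono K i j h = x} := by
  rintro q -
  have h1 : q = ∑ s ∈ (expSet a).attach, MvPolynomial.coeff s.1 (q : MvPolynomial (Fin 2) K) •
      symMono K (s.1 0) (s.1 1) (mem_expSet.1 s.2) := by
    apply Subtype.ext
    conv_lhs => rw [sum_expSet q.2, ← Finset.sum_attach]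
    rw [Submodule.coe_sum]
    refine Finset.sum_congr rfl fun s _ => ?_
    rw [Submodule.coe_smul, symMono, MvPolynomial.smul_monomial, smul_eq_mul, mul_one]
    have hs : Finsupp.single 0 (s.1 0) + Finsupp.single 1 (s.1 1) = s.1 := by
      ext i
      fin_cases i <;> simp
    rw [hs]
  rw [h1]
  exact Submodule.sum_mem _ fun s _ => Submodule.smul_mem _ _ (Submodule.subset_span ⟨_, _, _, rfl⟩)

variable {a : ℕ}
  {Δ : Matrix (Fin 2) (Fin 2) L →ₗ[L] Module.End L (MvPolynomial.homogeneousSubmodule (Fin 2) L a)}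

theorem isHighest_symMono (hΔ : IsDifferential e (symRep e a) Δ) :
    IsHighest (Δ (matE L)) (Δ (matH L)) a (symMono L a 0 rfl) := by
  constructor
  · apply Subtype.ext
    rw [differential_sym e hΔ]
    change polyDeriv (matE L) _ = 0
    rw [polyDeriv_matE]
    simp [symMono]
  · apply Subtype.ext
    rw [differential_sym e hΔ]
    change polyDeriv (matH L) _ = _
    rw [polyDeriv_matH, Submodule.coe_smul]
    simp only [symMono, X_mul_pderiv_monomial, MvPolynomial.smul_monomial]
    rcases Nat.eq_zero_or_pos a with rfl | ha
    · simp
    · simp [← Finsupp.single_add, ← Finsupp.single_tsub, add_tsub_cancel_of_le (Nat.succ_le_of_lt ha)]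

theorem differential_matF_symMono (hΔ : IsDifferential e (symRep e a) Δ) {i j : ℕ}
    (h : i + 1 + j = a) :
    Δ (matF L) (symMono L (i + 1) j h) =
      ((i : L) + 1) • symMono L i (j + 1) (by omega) := by
  apply Subtype.ext
  rw [differential_sym e hΔ]
  change polyDeriv (matF L) _ = _
  rw [polyDeriv_matF, Submodule.coe_smul]
  simp only [symMono, X_mul_pderiv_monomial, MvPolynomial.smul_monomial]
  have hs : Finsupp.single (1 : Fin 2) 1 +
      (Finsupp.single 0 (i + 1) + Finsupp.single 1 j - Finsupp.single 0 1) =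
      Finsupp.single 0 i + Finsupp.single 1 (j + 1) := by
    ext k
    fin_cases k <;> simp [add_comm]
  rw [hs]
  simp

theorem exists_pow_matF_symMono (hΔ : IsDifferential e (symRep e a) Δ) {i j : ℕ} (h : i + j = a) :
    ∃ c : L, c ≠ 0 ∧ (Δ (matF L) ^ j) (symMono L a 0 rfl) = c • symMono L i j h := by
  have : CharZero L := charZero_of_injective_algebraMap (algebraMap ℚ_[p] L).injective
  induction j generalizing i with
  | zero =>
    subst h
    exact ⟨1, one_ne_zero, by simp⟩
  | succ j ih =>
    obtain ⟨c, hc, h'⟩ := ih (i := i + 1) (by omega)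
    refine ⟨c * (i + 1), mul_ne_zero hc (by exact_mod_cast i.succ_ne_zero), ?_⟩
    rw [pow_succ', Module.End.mul_apply, h', map_smul, differential_matF_symMono hΔ, smul_smul]

theorem span_pow_matF (hΔ : IsDifferential e (symRep e a) Δ) :
    ⊤ ≤ Submodule.span L (Set.range fun i : Fin (a + 1) =>
      (Δ (matF L) ^ (i : ℕ)) (symMono L a 0 rfl)) := by
  refine (span_symMono L a).trans (Submodule.span_le.2 ?_)
  rintro _ ⟨i, j, h, rfl⟩
  obtain ⟨c, hc, h'⟩ := exists_pow_matF_symMono hΔ h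
  rw [SetLike.mem_coe, ← Submodule.smul_mem_iff _ hc, ← h']
  exact Submodule.subset_span ⟨⟨j, by omega⟩, rfl⟩

end SymHighest

/-! ### The determinant of an exponential -/

section Det
open Filter Topology

variable {p : ℕ} [Fact p.Prime] {L D : Type*} [NormedField L] [NormedAlgebra ℚ_[p] L]
  [FiniteDimensional ℚ_[p] L] [DivisionRing D] [Algebra ℚ_[p] D] [FiniteDimensional ℚ_[p] D]
  (e : L ⊗[ℚ_[p]] D ≃ₐ[L] Matrix (Fin 2) (Fin 2) L)
  [TopologicalSpace D] [IsModuleTopology ℚ_[p] D]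

theorem coe_detPow (b : ℤ) (g : Dˣ) : (detPow e b g : L) = (toMat e g).det ^ b := by
  simp [detPow, coe_toGL]

/-- Exponentials of elements of trace zero have determinant `1`. -/
theorem eventually_det_expD : ∀ᶠ x in 𝓝 (0 : D), (toMat e x).trace = 0 →
    (toMat e (expD e x : Dˣ)).det = 1 := by
  have hdet : ∀ g : Dˣ, (detPow e 1 g : L) = (toMat e g).det := fun g => by
    rw [coe_detPow, zpow_one]
  have happ : ∀ (g : Dˣ) (c : L), ofChar (detPow e 1) g c = (toMat e g).det * c := fun g c => by
    rw [← hdet]; rfl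
  obtain ⟨Δ, hΔ⟩ := exists_isDifferential e (ofChar (detPow e 1)) (fun v l => by
    have h1 : ∀ g, l (ofChar (detPow e 1) g v) = (toMat e (g : D)).det * l v := fun g => by
      rw [happ, ← smul_eq_mul, map_smul, smul_eq_mul]
    simp only [h1, Matrix.det_fin_two]
    exact (((continuous_toMat e 0 0).mul (continuous_toMat e 1 1)).sub
      ((continuous_toMat e 0 1).mul (continuous_toMat e 1 0))).mul continuous_const)
  -- The differential of the one-dimensional representation det is the trace; if the trace is zero,
  -- only the constant term of the exponential series remains.
  have htr : ∀ x, Δ (toMat e x) 1 = (toMat e x).trace := by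
    intro x
    have h1 : SeqDeriv p (fun k : ℕ => (toMat e (expD e ((p : ℚ_[p]) ^ k • x) : Dˣ)).det) 1
        (Δ (toMat e x) 1) := by
      have := hΔ.tendsto x 1 LinearMap.id
      simp only [happ, LinearMap.id_apply, mul_one] at this
      exact this
    have s := seqDeriv_toMat e x
    have h2 := ((s 0 0).mul (s 1 1)).sub ((s 0 1).mul (s 1 0))
    simp only [← Matrix.det_fin_two] at h2
    refine h1.unique (h2.congr ?_ ?_)
    · simp
    · simp [Matrix.trace_fin_two]
  filter_upwards [hΔ.hasSum] with x hx h0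
  have h1 := hx 1 LinearMap.id
  simp only [happ, LinearMap.id_apply, mul_one] at h1
  refine h1.unique ?_
  have h2 : ∀ n : ℕ, n ≠ 0 → (((n.factorial : ℚ_[p])⁻¹) • (Δ (toMat e x) ^ n) 1 : L) = 0 := by
    intro n hn
    obtain ⟨k, rfl⟩ := Nat.exists_eq_succ_of_ne_zero hn
    rw [pow_succ, Module.End.mul_apply, htr, h0, map_zero, smul_zero]
  convert hasSum_single 0 h2
  simp

end Det

theorem nontrivial_of_isIrreducible {K G V : Type*} [Field K] [Group G] [AddCommGroup V]
    [Module K V] {ρ : Representation K G V} (h : ρ.IsIrreducible) : Nontrivial V := by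
  by_contra hV
  rw [not_nontrivial_iff_subsingleton] at hV
  exact bot_ne_top (α := Subrepresentation ρ)
    (Subrepresentation.toSubmodule_injective (Subsingleton.elim _ _))

theorem subst_smul_one {K : Type*} [Field K] (c : K) {a : ℕ} {f : MvPolynomial (Fin 2) K}
    (hf : f ∈ MvPolynomial.homogeneousSubmodule (Fin 2) K a) :
    subst K (algebraMap K _ c) f = c ^ a • f := by
  rw [sum_expSet hf, map_sum, Finset.smul_sum]
  refine Finset.sum_congr rfl fun s hs => ?_
  rw [mem_expSet] at hs
  rw [subst, MvPolynomial.aeval_monomial, Finsupp.prod_fintype _ _ (by simp), Fin.prod_univ_two,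
    MvPolynomial.monomial_eq, Finsupp.prod_fintype _ _ (by simp), Fin.prod_univ_two, ← hs]
  simp [Matrix.algebraMap_matrix_apply, MvPolynomial.smul_eq_C_mul, MvPolynomial.algebraMap_eq]
  ring

/-! ### Irreducible representations as blocks -/

section Block
open Filter Topology

variable {p : ℕ} [Fact p.Prime] {L D : Type*} [NormedField L] [NormedAlgebra ℚ_[p] L]
  [FiniteDimensional ℚ_[p] L] [DivisionRing D] [Algebra ℚ_[p] D] [FiniteDimensional ℚ_[p] D]
  (e : L ⊗[ℚ_[p]] D ≃ₐ[L] Matrix (Fin 2) (Fin 2) L)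
  [TopologicalSpace D] [IsModuleTopology ℚ_[p] D]

theorem toMat_centerMap (w : ℚ_[p]ˣ) :
    toMat e (centerMap p D w : Dˣ) = algebraMap L _ (algebraMap ℚ_[p] L w) := by
  change toMat e (algebraMap ℚ_[p] D w) = _
  rw [AlgHom.commutes, ← IsScalarTower.algebraMap_apply]

theorem det_toMat_centerMap (w : ℚ_[p]ˣ) :
    (toMat e (centerMap p D w : Dˣ)).det = algebraMap ℚ_[p] L w ^ 2 := by
  rw [toMat_centerMap, Matrix.algebraMap_eq_diagonal, Matrix.det_diagonal]
  simp

theorem algebraMap_Nrd_eq_det (g : Dˣ) :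
    algebraMap ℚ_[p] L (Nrd e g : ℚ_[p]) = (toMat e (g : D)).det := algebraMap_Nrd e g

theorem Nrd_centerMap (w : ℚ_[p]ˣ) : Nrd e (centerMap p D w) = w ^ 2 := by
  apply Units.ext
  apply (algebraMap ℚ_[p] L).injective
  rw [algebraMap_Nrd_eq_det, det_toMat_centerMap, Units.val_pow_eq_pow_val, map_pow]

theorem symRep_centerMap (a : ℕ) (w : ℚ_[p]ˣ) (q) :
    symRep e a (centerMap p D w) q = algebraMap ℚ_[p] L w ^ a • q := by
  apply Subtype.ext
  rw [coe_symRep, toMat_centerMap, subst_smul_one _ q.2]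
  rfl

/-- The character `det ^ b ⊗ (η ∘ Nrd)` of `Dˣ`. -/
def twist (b : ℤ) (η : ℚ_[p]ˣ →* Lˣ) : Dˣ →* Lˣ := detPow e b * η.comp (Nrd e)

theorem coe_twist (b : ℤ) (η : ℚ_[p]ˣ →* Lˣ) (g : Dˣ) :
    (twist e b η g : L) = detPow e b g * η (Nrd e g) := rfl

theorem twist_centerMap (b : ℤ) (η : ℚ_[p]ˣ →* Lˣ) (w : ℚ_[p]ˣ) :
    (twist e b η (centerMap p D w) : L) = algebraMap ℚ_[p] L w ^ (2 * b) * (η w : L) ^ 2 := by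
  rw [coe_twist, coe_detPow, det_toMat_centerMap, Nrd_centerMap, map_pow, zpow_mul]
  simp

theorem eventually_twist_expD (b : ℤ) (η : ℚ_[p]ˣ →* Lˣ) : ∀ᶠ x in 𝓝 (0 : D),
    (toMat e x).trace = 0 → (twist e b η (expD e x) : L) = 1 := by
  filter_upwards [eventually_det_expD e] with x hx htr
  have h1 : Nrd e (expD e x) = 1 := by
    apply Units.ext
    apply (algebraMap ℚ_[p] L).injective
    rw [algebraMap_Nrd_eq_det, hx htr, Units.val_one, map_one]
  rw [coe_twist, coe_detPow, hx htr, h1]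
  simp

variable {V : Type*} [AddCommGroup V] [Module L V]

/-- The action of `Dˣ` on the linear maps from `Sym^a ⊗ ψ` to `V`. -/
def multRep (a : ℕ) (ψ : Dˣ →* Lˣ) (ρ : Representation L Dˣ V) :
    Representation L Dˣ (MvPolynomial.homogeneousSubmodule (Fin 2) L a →ₗ[L] V) where
  toFun g := ((ψ g : L)⁻¹) • Representation.linHom (symRep e a) ρ g
  map_one' := by simp
  map_mul' g h := by
    rw [map_mul, map_mul, smul_mul_smul_comm, Units.val_mul, mul_inv]

theorem multRep_apply (a : ℕ) (ψ : Dˣ →* Lˣ) (ρ : Representation L Dˣ V) (g : Dˣ) (T) (q) :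
    multRep e a ψ ρ g T q = (ψ g : L)⁻¹ • ρ g (T (symRep e a g⁻¹ q)) := rfl

variable {e} {ρ : Representation L Dˣ V} {a : ℕ}
  {Δ : Matrix (Fin 2) (Fin 2) L →ₗ[L] Module.End L V}
  {Δ' : Matrix (Fin 2) (Fin 2) L →ₗ[L] Module.End L (MvPolynomial.homogeneousSubmodule (Fin 2) L a)}

/-- The linear maps from `Sym^a` to `V` that intertwine the actions of `sl₂`. -/
def sl2Maps (hΔ : IsDifferential e ρ Δ) (hΔ' : IsDifferential e (symRep e a) Δ') (ψ : Dˣ →* Lˣ) :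
    Subrepresentation (multRep e a ψ ρ) where
  toSubmodule :=
    { carrier := {T | ∀ M : Matrix (Fin 2) (Fin 2) L, M.trace = 0 →
        ∀ q, T (Δ' M q) = Δ M (T q)}
      add_mem' := fun {S T} hS hT M hM q => by
        rw [LinearMap.add_apply, LinearMap.add_apply, hS M hM, hT M hM, map_add]
      zero_mem' := fun M _ q => by simp
      smul_mem' := fun c T hT M hM q => by
        rw [LinearMap.smul_apply, LinearMap.smul_apply, hT M hM, map_smul] }
  apply_mem_toSubmodule := by
    intro g T hT M hM q
    set A : Matrix (Fin 2) (Fin 2) L := (toGL e g : Matrix (Fin 2) (Fin 2) L) with hA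
    set A' : Matrix (Fin 2) (Fin 2) L :=
      (((toGL e g)⁻¹ : (Matrix (Fin 2) (Fin 2) L)ˣ) : Matrix (Fin 2) (Fin 2) L) with hA'
    have hAA' : A * A' = 1 := Units.mul_inv _
    have c1 := congrArg (fun S : Module.End L _ => S q) (hΔ'.conj g⁻¹ M)
    simp only [Module.End.mul_apply, map_inv, inv_inv] at c1
    -- Moving g past the differentials replaces M by a conjugate, and trace zero is conjugation
    -- invariant.
    have htr : (A' * M * A).trace = 0 := by
      rw [Matrix.trace_mul_cycle, hAA', one_mul, hM]
    have c2 := congrArg (fun S : Module.End L V => S (T (symRep e a g⁻¹ q)))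
      (hΔ.conj g (A' * M * A))
    simp only [Module.End.mul_apply] at c2
    have hback : A * (A' * M * A) * A' = M := by
      rw [mul_assoc, mul_assoc, mul_assoc, hAA', mul_one, ← mul_assoc, hAA', one_mul]
    rw [hback] at c2
    rw [multRep_apply, multRep_apply, c1, hT _ htr, c2, map_smul]

/-- This is the source of smoothness. Near 1 write u = exp(x) w with x of trace zero and w central.
The factor exp(x) fixes T because T is an sl₂-map and the twist is 1 there; w acts by ζ(w) w^(-a-2b)
η(w)^(-2), which is 1 by hypothesis. -/
theorem eventually_multRep_eq (hΔ : IsDifferential e ρ Δ)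
    (hΔ' : IsDifferential e (symRep e a) Δ') {ζ : ℚ_[p]ˣ →* Lˣ}
    (hζ : ∀ x v, ρ (centerMap p D x) v = (ζ x : L) • v) {b : ℤ} {η : ℚ_[p]ˣ →* Lˣ}
    (h : ∀ᶠ u in 𝓝 (1 : ℚ_[p]ˣ),
      (ζ u : L) = algebraMap ℚ_[p] L u ^ ((a : ℤ) + 2 * b) * (η u : L) ^ 2) :
    ∀ᶠ u in 𝓝 (1 : Dˣ), ∀ T ∈ sl2Maps hΔ hΔ' (twist e b η),
      multRep e a (twist e b η) ρ u T = T := by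
  filter_upwards [eventually_exists_split e
    ((hΔ'.intertwines hΔ).and (eventually_twist_expD e b η)) h] with u hu T hT
  obtain ⟨x, ⟨hx, hx'⟩, w, hw, htr, rfl⟩ := hu
  have h1 : multRep e a (twist e b η) ρ (centerMap p D w) T = T := by
    ext q : 1
    rw [multRep_apply, ← map_inv, symRep_centerMap, map_smul, hζ, smul_smul, smul_smul,
      twist_centerMap, Units.val_inv_eq_inv_val, map_inv₀]
    have hw0 : algebraMap ℚ_[p] L w ≠ 0 := by
      rw [Ne, map_eq_zero]; exact w.ne_zero
    have hw' : (ζ w : L) = algebraMap ℚ_[p] L w ^ ((a : ℤ) + 2 * b) * (η w : L) ^ 2 := hw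
    have hη := (η w).ne_zero
    have hz : algebraMap ℚ_[p] L w ^ (2 * b) ≠ 0 := zpow_ne_zero _ hw0
    rw [hw', zpow_add₀ hw0, zpow_natCast]
    convert one_smul L (T q) using 2
    field_simp
    rw [← mul_pow, mul_one_div_cancel hw0, one_pow]
  rw [map_mul, Module.End.mul_apply, h1]
  ext q : 1
  rw [multRep_apply, hx' htr, ← hx htr T hT, ← Module.End.mul_apply (symRep e a _), ← map_mul,
    mul_inv_cancel, map_one, inv_one, one_smul]
  rfl

/-- The map `monoMap` attached to v is such a map; it sends X₀^a to a! v ≠ 0. -/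
theorem exists_ne_zero_mem_sl2Maps [FiniteDimensional L V] (hΔ : IsDifferential e ρ Δ)
    (hΔ' : IsDifferential e (symRep e a) Δ') {v : V} (hv0 : v ≠ 0)
    (hv : IsHighest (Δ (matE L)) (Δ (matH L)) a v) (ψ : Dˣ →* Lˣ) :
    ∃ T ∈ sl2Maps hΔ hΔ' ψ, T ≠ 0 := by
  have : CharZero L := charZero_of_injective_algebraMap (algebraMap ℚ_[p] L).injective
  refine ⟨monoMap (Δ (matF L)) v ∘ₗ Submodule.subtype _, ?_, fun h0 => ?_⟩
  · intro M hM q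
    obtain ⟨h1, h2, h3⟩ := monoMap_intertwines hΔ.isSl2 hv q.2
    have hd : ∀ N, ((Δ' N q : MvPolynomial.homogeneousSubmodule (Fin 2) L a) :
        MvPolynomial (Fin 2) L) = polyDeriv N q := fun N => differential_sym e hΔ' N q
    rw [eq_of_trace_eq_zero hM]
    simp only [map_add, map_smul, LinearMap.add_apply, LinearMap.smul_apply, LinearMap.comp_apply,
      Submodule.subtype_apply, hd, h1, h2, h3]
  · have h1 := congrArg (fun S => S (symMono L a 0 rfl)) h0
    simp only [LinearMap.comp_apply, Submodule.subtype_apply, symMono, monoMap_monomial] at h1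
    simp [Nat.factorial_ne_zero, hv0] at h1

variable (e) in
/-- An irreducible representation with a central character is the product of some `Sym^a`, a
smooth irreducible representation and a character. -/
theorem exists_block [FiniteDimensional L V] (hirr : ρ.IsIrreducible)
    (hρ : ∀ (v : V) (l : V →ₗ[L] L), Continuous fun g => l (ρ g v))
    {ζ : ℚ_[p]ˣ →* Lˣ} (hζ : ∀ x v, ρ (centerMap p D x) v = (ζ x : L) • v) :
    ∃ a : ℕ, ∀ (b : ℤ) (η : ℚ_[p]ˣ →* Lˣ),
      (∀ᶠ u in 𝓝 (1 : ℚ_[p]ˣ),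
        (ζ u : L) = algebraMap ℚ_[p] L u ^ ((a : ℤ) + 2 * b) * (η u : L) ^ 2) →
      ∃ (d : ℕ) (τ : Representation L Dˣ (Fin d → L)),
        τ.IsIrreducible ∧ IsSmooth τ ∧ Nonempty (ρ.Equiv (block e a b τ η)) := by
  have : CharZero L := charZero_of_injective_algebraMap (algebraMap ℚ_[p] L).injective
  have : IsTopologicalRing D := IsModuleTopology.isTopologicalRing ℚ_[p] D
  have := nontrivial_of_isIrreducible hirr
  obtain ⟨Δ, hΔ⟩ := exists_isDifferential e ρ hρ
  obtain ⟨a, v, hv0, hv⟩ := hΔ.isSl2.exists_isHighest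
  -- The weight a is fixed by ρ alone, so b and η may be chosen afterwards, depending on a.
  refine ⟨a, fun b η hη => ?_⟩
  obtain ⟨Δ', hΔ'⟩ := exists_isDifferential e (symRep e a) (continuous_symRep e a)
  set N := sl2Maps hΔ hΔ' (twist e b η) with hN
  have hfix := eventually_multRep_eq hΔ hΔ' hζ hη
  have : Nontrivial N.toSubmodule := by
    obtain ⟨T, hT, hT0⟩ := exists_ne_zero_mem_sl2Maps hΔ hΔ' hv0 hv (twist e b η)
    exact ⟨⟨⟨T, hT⟩, 0, fun h => hT0 (congrArg Subtype.val h)⟩⟩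
  obtain ⟨d, τ, ι₀, hτ, hι₀, hτι₀⟩ := exists_irreducible_sub N.toRepresentation
  let ι := N.toSubmodule.subtype ∘ₗ ι₀
  have hι : Function.Injective ι := Subtype.val_injective.comp hι₀
  have hιN : ∀ w, ι w ∈ N := fun w => (ι₀ w).2
  have hτι : ∀ g w, ι (τ g w) = multRep e a (twist e b η) ρ g (ι w) := fun g w =>
    congrArg Subtype.val (hτι₀ g w)
  refine ⟨d, τ, hτ, fun w => ?_, ?_⟩
  · let S : Subgroup Dˣ :=
      { carrier := {g | τ g w = w}
        one_mem' := by simp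
        mul_mem' := fun {g h} hg hh => by
          change τ (g * h) w = w
          rw [map_mul, Module.End.mul_apply, show τ h w = w from hh, show τ g w = w from hg]
        inv_mem' := fun {g} hg => by
          change τ g⁻¹ w = w
          conv_lhs => rw [← show τ g w = w from hg]
          rw [← Module.End.mul_apply, ← map_mul, inv_mul_cancel, map_one, Module.End.one_apply] }
    refine ⟨S, S.isOpen_of_mem_nhds (g := 1) ?_, fun g hg => hg⟩
    filter_upwards [hfix] with u hu
    apply hι
    rw [hτι, hu _ (hιN w)]
  -- Evaluation embeds Sym^a ⊗ τ in V; up to the twist it is equivariant and nonzero, so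
  -- irreducibility of ρ makes it onto.
  · have hT : Function.Injective (TensorProduct.lift ι.flip) :=
      lift_flip_injective hΔ'.isSl2 (isHighest_symMono hΔ') (span_pow_matF hΔ') hι
        (fun w => hιN w (matE L) (by simp [matE, Matrix.trace_fin_two]))
        (fun w => hιN w (matF L) (by simp [matF, Matrix.trace_fin_two]))
    -- R strips the two one-dimensional factors L from the block.
    let R := TensorProduct.rid L ((MvPolynomial.homogeneousSubmodule (Fin 2) L a ⊗[L] L) ⊗[L]
        (Fin d → L)) ≪≫ₗ TensorProduct.congr
        (TensorProduct.rid L (MvPolynomial.homogeneousSubmodule (Fin 2) L a))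
        (LinearEquiv.refl L (Fin d → L))
    let F : (block e a b τ η).IntertwiningMap ρ :=
      ⟨TensorProduct.lift ι.flip ∘ₗ R.toLinearMap, fun g => by
        refine TensorProduct.ext (TensorProduct.ext (TensorProduct.ext (LinearMap.ext fun q =>
          LinearMap.ext fun c => LinearMap.ext fun w => LinearMap.ext fun c' => ?_)))
        change TensorProduct.lift ι.flip (R (((symRep e a g q ⊗ₜ[L] ((detPow e b g : L) * c)) ⊗ₜ[L]
          τ g w) ⊗ₜ[L] ((η (Nrd e g) : L) * c'))) =
          ρ g (TensorProduct.lift ι.flip (R (((q ⊗ₜ[L] c) ⊗ₜ[L] w) ⊗ₜ[L] c')))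
        have hq : symRep e a g⁻¹ (symRep e a g q) = q := by
          rw [← Module.End.mul_apply, ← map_mul, inv_mul_cancel, map_one, Module.End.one_apply]
        have hψ : (detPow e b g : L) * η (Nrd e g) ≠ 0 := (twist e b η g).ne_zero
        simp only [R, LinearEquiv.trans_apply, TensorProduct.rid_tmul, TensorProduct.congr_tmul,
          map_smul, LinearEquiv.refl_apply, TensorProduct.lift.tmul, LinearMap.flip_apply,
          LinearMap.smul_apply, hτι, multRep_apply, hq, coe_twist, smul_smul]
        congr 1
        field_simp⟩
    have hF : Function.Injective F := hT.comp R.injective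
    have hF0 : F ≠ 0 := by
      intro h0
      have := nontrivial_of_isIrreducible hτ
      obtain ⟨w, hw⟩ := exists_ne (0 : Fin d → L)
      refine hw (hι ?_)
      rw [map_zero]
      ext q : 1
      have := congrArg (fun S : (block e a b τ η).IntertwiningMap ρ =>
        S (((q ⊗ₜ[L] 1) ⊗ₜ[L] w) ⊗ₜ[L] 1)) h0
      simpa [F, R] using this
    have := hirr
    have hs : Function.Surjective F := by
      refine LinearMap.range_eq_top.1 (congrArg Subrepresentation.toSubmodule
        ((eq_bot_or_eq_top F.range).resolve_left fun h => hF0 ?_) :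
        LinearMap.range F.toLinearMap = ⊤)
      refine Representation.IntertwiningMap.ext (LinearMap.ext fun t => ?_)
      exact (Submodule.mem_bot L).1 ((congrArg Subrepresentation.toSubmodule h).le ⟨t, rfl⟩)
    exact ⟨(F.ofBijective ⟨hF, hs⟩).symm⟩

end Block

/-! ### The character x ↦ √(pr(x|x|)) near 1 -/

section SquareRoot
open Filter Topology

variable {p : ℕ} [Fact p.Prime]

theorem eventually_norm_sub_one_lt : ∀ᶠ u : ℚ_[p]ˣ in 𝓝 1, ‖(u : ℚ_[p]) - 1‖ < 1 := by
  have h : Continuous fun u : ℚ_[p]ˣ => ‖(u : ℚ_[p]) - 1‖ :=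
    (Units.continuous_val.sub continuous_const).norm
  refine h.continuousAt.eventually_lt continuousAt_const ?_
  simp

theorem pr_coe (w : principalUnits p) : pr p w = w := by
  apply (pow_bijective p (not_dvd_sub_one p)).1
  refine (principalRoot_pow p (not_dvd_sub_one p) _).trans ?_
  rfl

/-- A principal unit u has |u| = 1, so u|u| = u, and `pr` fixes it. -/
theorem sqrtPr_sq {L : Type*} [Field L] [Algebra ℚ_[p] L] (hp : 2 < p) {u : ℚ_[p]ˣ}
    (hu : ‖(u : ℚ_[p]) - 1‖ < 1) : (sqrtPr p L hp u : L) ^ 2 = algebraMap ℚ_[p] L u := by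
  have hn : ‖(u : ℚ_[p])‖ = 1 := by
    have h := IsUltrametricDist.norm_add_eq_max_of_norm_ne_norm
      (x := (u : ℚ_[p]) - 1) (y := 1) (by rw [norm_one]; exact hu.ne)
    rwa [sub_add_cancel, norm_one, max_eq_right hu.le] at h
  have hv : (u : ℚ_[p]).valuation = 0 := by
    have h := Padic.norm_eq_zpow_neg_valuation u.ne_zero
    rw [hn] at h
    have hp1 : (1 : ℝ) < p := by exact_mod_cast (Fact.out : p.Prime).one_lt
    have := (zpow_eq_one_iff_right₀ (by linarith) hp1.ne').1 h.symm
    omega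
  have hval : ((mulAbs p u : ℤ_[p]) : ℚ_[p]) = u := by
    change (u : ℚ_[p]) * (p : ℚ_[p]) ^ (-(u : ℚ_[p]).valuation) = u
    rw [hv, neg_zero, zpow_zero, mul_one]
  have hmem : mulAbs p u ∈ principalUnits p := by
    rw [mem_principalUnits, PadicInt.norm_def, PadicInt.coe_sub, hval]
    exact hu
  have hpr : pr p (mulAbs p u) = ⟨mulAbs p u, hmem⟩ := pr_coe ⟨_, hmem⟩
  have h2 := principalRoot_pow p (not_dvd_two p hp) ⟨mulAbs p u, hmem⟩
  have h3 : (((principalRoot p (not_dvd_two p hp) ⟨mulAbs p u, hmem⟩ : principalUnits p) :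
      ℤ_[p]ˣ) : ℤ_[p]) ^ 2 = mulAbs p u := by
    rw [← Units.val_pow_eq_pow_val, ← Subgroup.coe_pow, h2]
  change (algebraMap ℚ_[p] L (algebraMap ℤ_[p] ℚ_[p] ((principalRoot p (not_dvd_two p hp)
    (pr p (mulAbs p u)) : ℤ_[p]ˣ) : ℤ_[p]))) ^ 2 = _
  rw [hpr, ← map_pow, ← map_pow, h3]
  exact congrArg _ hval

theorem norm_sqrtPr_sub_one_lt (hp : 2 < p) (u : ℚ_[p]ˣ) :
    ‖(sqrtPr p ℚ_[p] hp u : ℚ_[p]) - 1‖ < 1 := by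
  have h := (mem_principalUnits p).1 (principalRoot p (not_dvd_two p hp) (pr p (mulAbs p u))).2
  rwa [PadicInt.norm_def, PadicInt.coe_sub] at h

theorem norm_sqrtPr (hp : 2 < p) (u : ℚ_[p]ˣ) : ‖(sqrtPr p ℚ_[p] hp u : ℚ_[p])‖ = 1 :=
  PadicInt.norm_units (principalRoot p (not_dvd_two p hp) (pr p (mulAbs p u)) : ℤ_[p]ˣ)

/-- For s² = u with s a principal unit, |u - 1| = |s - 1| |s + 1|, and |s + 1| = |2| = 1 as p is
odd. So the square root is isometric at 1. -/
theorem continuous_sqrtPr (hp : 2 < p) : Continuous (sqrtPr p ℚ_[p] hp) := by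
  refine continuous_of_continuousAt_one _ ?_
  rw [ContinuousAt, map_one, Units.isEmbedding_val₀.tendsto_nhds_iff, tendsto_iff_norm_sub_tendsto_zero]
  have h1 : Tendsto (fun u : ℚ_[p]ˣ => ‖(u : ℚ_[p]) - 1‖) (𝓝 1) (𝓝 0) := by
    have h : Continuous fun u : ℚ_[p]ˣ => ‖(u : ℚ_[p]) - 1‖ :=
      (Units.continuous_val.sub continuous_const).norm
    simpa using h.tendsto 1
  refine h1.congr' ?_
  filter_upwards [eventually_norm_sub_one_lt] with u hu
  have hs := norm_sqrtPr_sub_one_lt hp u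
  set s := (sqrtPr p ℚ_[p] hp u : ℚ_[p])
  have hsq : s ^ 2 = u := sqrtPr_sq hp hu
  have h2 : ‖(2 : ℚ_[p])‖ = 1 := by
    have h := Padic.norm_natCast_eq_one_iff (p := p) (n := 2)
    exact h.2 ((Nat.Prime.coprime_iff_not_dvd Fact.out).2 (not_dvd_two p hp))
  have h3 : ‖s + 1‖ = 1 := by
    have h := IsUltrametricDist.norm_add_eq_max_of_norm_ne_norm
      (x := s - 1) (y := 2) (by rw [h2]; exact hs.ne)
    rw [h2, max_eq_right hs.le] at h
    rw [← h]; congr 1; ring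
  rw [← hsq, show s ^ 2 - 1 = (s - 1) * (s + 1) by ring, norm_mul, h3, mul_one]
  rfl

end SquareRoot

/-! ### The central character and the assembly of the blocks -/

section Final
open Filter Topology

variable {p : ℕ} [Fact p.Prime] {L D : Type*} [NormedField L] [NormedAlgebra ℚ_[p] L]
  [FiniteDimensional ℚ_[p] L] [DivisionRing D] [Algebra ℚ_[p] D] [FiniteDimensional ℚ_[p] D]
  (e : L ⊗[ℚ_[p]] D ≃ₐ[L] Matrix (Fin 2) (Fin 2) L)
  [TopologicalSpace D] [IsModuleTopology ℚ_[p] D]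

/-- B is finite-dimensional over the complete field ℚ_p, where linear maps are automatically
continuous. -/
theorem continuous_linearFunctional (p : ℕ) [Fact p.Prime] {L B : Type*} [NormedField L]
    [NormedAlgebra ℚ_[p] L] [FiniteDimensional ℚ_[p] L] [NormedAddCommGroup B] [NormedSpace L B]
    [FiniteDimensional L B] (l : B →ₗ[L] L) : Continuous l := by
  let _ : NormedSpace ℚ_[p] B := NormedSpace.restrictScalars ℚ_[p] L B
  have : IsScalarTower ℚ_[p] L B := RestrictScalars.isScalarTower ℚ_[p] L B
  have : FiniteDimensional ℚ_[p] B := FiniteDimensional.trans ℚ_[p] L B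
  exact (l.restrictScalars ℚ_[p]).continuous_of_finiteDimensional

/-- The condition P is left open so that both decompositions follow; only ζ = x^(a+2b) η² near 1 has
to be solved for each a. `Nontrivial B` is made available because ζ is unconstrained when B = 0. -/
theorem isSumOfBlocks_of_forall {B : Type*} [AddCommGroup B] [Module L B] [FiniteDimensional L B]
    {ρ : Representation L Dˣ B} (hρ : ∀ (v : B) (l : B →ₗ[L] L), Continuous fun g => l (ρ g v))
    {ζ : ℚ_[p]ˣ →* Lˣ} (hζ : ∀ x v, ρ (centerMap p D x) v = (ζ x : L) • v)
    (hss : ρ.IsSemisimpleRepresentation) {P : (ℚ_[p]ˣ →* Lˣ) → Prop}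
    (hP : Nontrivial B → ∀ a : ℕ, ∃ (b : ℤ) (η : ℚ_[p]ˣ →* Lˣ), P η ∧
      ∀ᶠ u in 𝓝 (1 : ℚ_[p]ˣ),
        (ζ u : L) = algebraMap ℚ_[p] L u ^ ((a : ℤ) + 2 * b) * (η u : L) ^ 2) :
    IsSumOfBlocks e ρ P := by
  obtain ⟨n, S, hS, ⟨E⟩⟩ := exists_directSum_irreducible ρ hss
  have key : ∀ i, ∃ (a : ℕ) (b : ℤ) (η : ℚ_[p]ˣ →* Lˣ) (d : ℕ)
      (τ : Representation L Dˣ (Fin d → L)), (τ.IsIrreducible ∧ IsSmooth τ ∧ P η) ∧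
        Nonempty ((S i).toRepresentation.Equiv (block e a b τ η)) := by
    intro i
    obtain ⟨a, ha⟩ := exists_block e (hS i) (fun v l => by
      obtain ⟨l', rfl⟩ := l.exists_extend
      exact hρ v l') (ζ := ζ) (fun x v => Subtype.ext (hζ x v))
    have := nontrivial_of_isIrreducible (hS i)
    obtain ⟨b, η, hη, h⟩ := hP (Function.Injective.nontrivial (S i).toSubmodule.subtype_injective) a
    obtain ⟨d, τ, h1, h2, h3⟩ := ha b η h
    exact ⟨a, b, η, d, τ, ⟨h1, h2, hη⟩, h3⟩
  choose a b η d τ h hE using key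
  refine ⟨n, a, b, d, τ, η, h, ⟨E.trans ?_⟩⟩
  refine Representation.Equiv.mk
    (DFinsupp.mapRange.linearEquiv fun i => (hE i).some.toLinearEquiv) fun g => ?_
  refine LinearMap.ext fun v => DFinsupp.ext fun i => ?_
  exact congrArg (fun F => F (v i)) ((hE i).some.toIntertwiningMap.isIntertwining' g)

/-- If |ζ(y)| > 1, the vectors ζ(y)^m v with 0 ≠ v ∈ Θ would leave the bounded lattice Θ; the
inverse of x gives the other inequality. -/
theorem norm_centralChar {B : Type*} [NormedAddCommGroup B] [NormedSpace L B] [Nontrivial B]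
    {ρ : Representation L Dˣ B} (hρ : IsUnitary ρ)
    {ζ : ℚ_[p]ˣ →* Lˣ} (hζ : ∀ x v, ρ (centerMap p D x) v = (ζ x : L) • v) (x : ℚ_[p]ˣ) :
    ‖(ζ x : L)‖ = 1 := by
  obtain ⟨-, Θ, hopen, hbdd, -, hΘ⟩ := hρ
  obtain ⟨v₀, hv₀⟩ := exists_ne (0 : B)
  have h1 : Tendsto (fun k : ℕ => (algebraMap ℚ_[p] L p) ^ k • v₀) atTop (𝓝 0) := by
    have : Tendsto (fun k : ℕ => (algebraMap ℚ_[p] L p) ^ k) atTop (𝓝 0) := by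
      refine tendsto_pow_atTop_nhds_zero_of_norm_lt_one ?_
      rw [norm_algebraMap']
      exact Padic.norm_p_lt_one
    simpa using this.smul_const v₀
  obtain ⟨k, hk⟩ := (h1.eventually (hopen.mem_nhds Θ.zero_mem)).exists
  set v := (algebraMap ℚ_[p] L p) ^ k • v₀ with hv
  have hv0 : v ≠ 0 := by
    refine smul_ne_zero (pow_ne_zero _ ?_) hv₀
    rw [Ne, map_eq_zero]
    exact_mod_cast (Fact.out : p.Prime).ne_zero
  obtain ⟨C, hC⟩ := hbdd.exists_norm_le
  have hle : ∀ y : ℚ_[p]ˣ, ‖(ζ y : L)‖ ≤ 1 := by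
    intro y
    by_contra! hlt
    obtain ⟨m, hm⟩ := pow_unbounded_of_one_lt (C / ‖v‖) hlt
    have h2 := hC _ (hΘ (centerMap p D (y ^ m)) v hk)
    rw [hζ, norm_smul, map_pow, Units.val_pow_eq_pow_val, norm_pow] at h2
    rw [div_lt_iff₀ (norm_pos_iff.2 hv0)] at hm
    linarith
  refine le_antisymm (hle x) ?_
  have h3 := hle x⁻¹
  rw [map_inv, Units.val_inv_eq_inv_val, norm_inv] at h3
  exact (inv_le_one₀ (norm_pos_iff.2 (ζ x).ne_zero)).1 h3

theorem continuous_centralChar {B : Type*} [AddCommGroup B] [Module L B] [Nontrivial B]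
    {ρ : Representation L Dˣ B} (hρ : ∀ (v : B) (l : B →ₗ[L] L), Continuous fun g => l (ρ g v))
    {ζ : ℚ_[p]ˣ →* Lˣ} (hζ : ∀ x v, ρ (centerMap p D x) v = (ζ x : L) • v) : Continuous ζ := by
  have : IsTopologicalRing D := IsModuleTopology.isTopologicalRing ℚ_[p] D
  have : ContinuousSMul ℚ_[p] D := IsModuleTopology.toContinuousSMul ℚ_[p] D
  rw [Units.isEmbedding_val₀.continuous_iff]
  obtain ⟨v, hv⟩ := exists_ne (0 : B)
  obtain ⟨l, hl⟩ : ∃ l : B →ₗ[L] L, l v ≠ 0 := by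
    by_contra! h
    exact hv ((Module.forall_dual_apply_eq_zero_iff L v).1 h)
  have hc : Continuous (centerMap p D) := (continuous_algebraMap ℚ_[p] D).units_map _
  refine (((hρ v l).comp hc).div_const (l v)).congr fun x => ?_
  simp [hζ, hl]

/-- A twist of a square root of the central character. -/
def rootChar (hp : 2 < p) (ζ : ℚ_[p]ˣ →* Lˣ) (a : ℕ) : ℚ_[p]ˣ →* Lˣ :=
  (ζ / (powMonoidHom a).comp (Units.map (algebraMap ℚ_[p] L : ℚ_[p] →* L))).comp
    (sqrtPr p ℚ_[p] hp)

theorem coe_rootChar (hp : 2 < p) (ζ : ℚ_[p]ˣ →* Lˣ) (a : ℕ) (x : ℚ_[p]ˣ) :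
    (rootChar hp ζ a x : L) =
      ζ (sqrtPr p ℚ_[p] hp x) / algebraMap ℚ_[p] L (sqrtPr p ℚ_[p] hp x : ℚ_[p]) ^ a := by
  simp [rootChar]

/-- The root is taken in the source ℚ_pˣ, before ζ is applied, so no square root in L is needed. -/
theorem rootChar_sq (hp : 2 < p) (ζ : ℚ_[p]ˣ →* Lˣ) (a : ℕ) {u : ℚ_[p]ˣ}
    (hu : ‖(u : ℚ_[p]) - 1‖ < 1) :
    (ζ u : L) = algebraMap ℚ_[p] L u ^ a * (rootChar hp ζ a u : L) ^ 2 := by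
  have h1 : sqrtPr p ℚ_[p] hp u ^ 2 = u := Units.ext (sqrtPr_sq hp hu)
  have h2 : algebraMap ℚ_[p] L u ≠ 0 := by
    rw [Ne, map_eq_zero]; exact u.ne_zero
  rw [coe_rootChar, div_pow, ← Units.val_pow_eq_pow_val, ← map_pow ζ, h1, pow_right_comm,
    ← map_pow (algebraMap ℚ_[p] L) _ 2, ← Units.val_pow_eq_pow_val, h1,
    mul_div_cancel₀ _ (pow_ne_zero a h2)]

theorem isUnitaryChar_rootChar (hp : 2 < p) {ζ : ℚ_[p]ˣ →* Lˣ} (hc : Continuous ζ)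
    (hn : ∀ x, ‖(ζ x : L)‖ = 1) (a : ℕ) : IsUnitaryChar (rootChar hp ζ a) := by
  refine ⟨?_, fun x => ?_⟩
  · have hs := continuous_sqrtPr hp
    rw [Units.isEmbedding_val₀.continuous_iff]
    have h1 : Continuous fun x => (ζ (sqrtPr p ℚ_[p] hp x) : L) :=
      Units.continuous_val.comp (hc.comp hs)
    have h2 : Continuous fun x => algebraMap ℚ_[p] L (sqrtPr p ℚ_[p] hp x : ℚ_[p]) ^ a :=
      ((continuous_algebraMap ℚ_[p] L).comp (Units.continuous_val.comp hs)).pow a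
    refine (h1.div h2 fun x => pow_ne_zero _ ?_).congr fun x => (coe_rootChar hp ζ a x).symm
    rw [Ne, map_eq_zero]
    exact Units.ne_zero _
  · rw [coe_rootChar, norm_div, hn, norm_pow, norm_algebraMap', norm_sqrtPr, one_pow, div_one]

end Final

end QuatRep

end

theorem mainTheorem10 (p : ℕ) [Fact p.Prime] (hp : 2 < p)
    {D : Type*} [DivisionRing D] [Algebra ℚ_[p] D] [Algebra.IsCentral ℚ_[p] D]
    [FiniteDimensional ℚ_[p] D] (hD : Module.finrank ℚ_[p] D = 4)
    [TopologicalSpace D] [IsModuleTopology ℚ_[p] D]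
    {L : Type*} [NormedField L] [NormedAlgebra ℚ_[p] L] [FiniteDimensional ℚ_[p] L]
    (e : L ⊗[ℚ_[p]] D ≃ₐ[L] Matrix (Fin 2) (Fin 2) L)
    {B : Type*} [NormedAddCommGroup B] [NormedSpace L B] [FiniteDimensional L B]
    (ρ : Representation L Dˣ B) (hρ : QuatRep.IsUnitary ρ)
    (ζ : ℚ_[p]ˣ →* Lˣ)
    (hζ : ∀ (x : ℚ_[p]ˣ) (v : B),
      ρ (Units.map (algebraMap ℚ_[p] D : ℚ_[p] →* D) x) v = (ζ x : L) • v) :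
    ρ.IsSemisimpleRepresentation ∧
    QuatRep.IsSumOfBlocks e ρ (fun η => QuatRep.IsUnitaryChar η) ∧
    (QuatRep.IsLocallyAlgebraic ζ →
      QuatRep.IsSumOfBlocks e ρ (fun η => η = 1 ∨ η = QuatRep.sqrtPr p L hp)) := by
  have hc : ∀ (v : B) (l : B →ₗ[L] L), Continuous fun g => l (ρ g v) := fun v l =>
    (QuatRep.continuous_linearFunctional p l).comp
      (hρ.1.comp (continuous_id.prodMk continuous_const))
  have hss : ρ.IsSemisimpleRepresentation :=
    QuatRep.isSemisimpleRepresentation_of_continuous e hc fun x => ⟨_, hζ x⟩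
  refine ⟨hss, QuatRep.isSumOfBlocks_of_forall e hc hζ hss fun hB a => ?_, ?_⟩
  -- With η unrestricted apart from unitarity, b = 0 suffices: `rootChar` absorbs the whole twist.
  · refine ⟨0, QuatRep.rootChar hp ζ a, QuatRep.isUnitaryChar_rootChar hp
      (QuatRep.continuous_centralChar hc hζ) (QuatRep.norm_centralChar hρ hζ) a, ?_⟩
    filter_upwards [QuatRep.eventually_norm_sub_one_lt] with u hu
    rw [mul_zero, add_zero, zpow_natCast]
    exact QuatRep.rootChar_sq hp ζ a hu
  · rintro ⟨c, U, hU, hUc⟩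
    have hev := hU.mem_nhds U.one_mem
    refine QuatRep.isSumOfBlocks_of_forall e hc hζ hss fun _ a => ?_
    -- The equation is u^c = u^(a+2b) η(u)². If c - a is even, η = 1; if it is odd, the remaining
    -- factor u is the square of `sqrtPr` near 1.
    rcases Int.even_or_odd' (c - a) with ⟨b, hb | hb⟩
    · refine ⟨b, 1, Or.inl rfl, ?_⟩
      filter_upwards [hev] with u hu
      rw [hUc u hu, ← hb]
      simp
    · refine ⟨b, _, Or.inr rfl, ?_⟩
      filter_upwards [hev, QuatRep.eventually_norm_sub_one_lt] with u hu hu'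
      have h0 : algebraMap ℚ_[p] L u ≠ 0 := by
        rw [Ne, map_eq_zero]; exact u.ne_zero
      rw [hUc u hu, QuatRep.sqrtPr_sq hp hu', ← zpow_add_one₀ h0]
      congr 1
      omega
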